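/- Let $N\ge 1$, let $\Omega\subset\mathbb R^N$ be a bounded connected open set with $C^2$ boundary, and let $a^{ij}(x,y)$, $b^j(x,y)$, $c(x,y)\in C^1(\overline\Omega\times\mathbb R^N)$ be periodic in $y$ with periodicity cell $Y=(0,1)^N$, with $a^{ij}=a^{ji}$ and $a^{ij}(x,y)\zeta_i\zeta_j\ge m|\zeta|^2$ for some $m>0$ and all $\zeta\in\mathbb R^N$. Put $H(p,x,y)=a^{ij}(x,y)p_ip_j-b^j(x,y)p_j+c(x,y)$. Fix $\alpha>0$ and let $\overline H(p,x)$, $p\in\mathbb R^N$, $x\in\overline\Omega$, be the effective Hamiltonian: - if $\alpha>1$, $\overline H(p,x)=\int_Y H(p,x,y)\vartheta(y)\,dy$, where $\vartheta$ is the positive $Y$-periodic (continuous, $W^{1,2}$) solution of $\frac{\partial^2}{\partial y_i\partial y_j}(a^{ij}(x,y)\vartheta)=0$ (in the sense of distributions) with $\int_Y\vartheta\,dy=1$; - if $\alpha=1$, $\overline H(p,x)$ is the first eigenvalue (the eigenvalue with maximal real part, having a positive eigenfunction) of the operator $a^{ij}\frac{\partial^2}{\partial y_i\partial y_j}+(b^j-2a^{ij}p_i)\frac{\partial}{\partial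 y_j}+H(p,x,y)$ acting on $Y$-periodic functions of class $C^2$ of $y$; - if $0<\alpha<1$, $\overline H(p,x)$ is the unique number for which $H(p+\nabla\vartheta(y),x,y)=\overline H(p,x)$ has a continuous $Y$-periodic viscosity solution $\vartheta(y)$. For $\lambda\in\mathbb R$ and $W\in C(\overline\Omega)$ consider, in the viscosity sense, $$(1)\quad \overline H(\nabla W(x),x)\le\lambda\ \text{ in }\Omega,\qquad\qquad (2)\quad \overline H(\nabla W(x),x)\ge\lambda\ \text{ in }\overline\Omega,$$ where (2) is tested at points of $\overline\Omega$ at which $W-\phi$, $\phi\in C^1$, has a local minimum relative to $\overline\Omega$. Let $$\lambda=\lambda_{\overline H}=\inf\{\lambda:\ (1)\text{ has a solution } W\in C(\overline\Omega)\},$$ $$d(x,y)=\sup\{W(x)-W(y):\ W\in C(\overline\Omega)\text{ solves }(1)\text{ with }\lambda=\lambda_{\overline H}\},\qquad x,y\in\overline\Omega,$$ $$\mathcal A=\{y\in\overline\Omega:\ d(\cdot,y)\text{ solves }(2)\text{ with }\lambda=\lambda_{\overline H}\},\qquad S(x,y)=d(x,y)+d(y,x).$$ Then, for $\lambda=\lambda_{\overline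 H}$, the state constraint problem (1)--(2) has a solution $W\in C(\overline\Omega)$, and this solution is unique up to an additive constant if and only if $S(x,y)=0$ for all $x,y\in\mathcal A$. -/

import Mathlib

open MeasureTheory Set
open scoped Matrix

noncomputable section

/-- `ℝ^N` with its Euclidean norm. -/
abbrev Space (N : ℕ) : Type := EuclideanSpace ℝ (Fin N)

/-- `Ω` has a `C²` boundary: near each boundary point, `Ω` is the set where a `C²` function with
non-vanishing differential at that point is negative. -/
def HasC2Boundary {N : ℕ} (Ω : Set (Space N)) : Prop :=
  ∀ x₀ ∈ frontier Ω, ∃ U : Set (Space N), IsOpen U ∧ x₀ ∈ U ∧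
    ∃ ρ : Space N → ℝ, ContDiff ℝ 2 ρ ∧ fderiv ℝ ρ x₀ ≠ 0 ∧ Ω ∩ U = {x | ρ x < 0} ∩ U

/-- Periodicity with period one in each coordinate. -/
def IsYPeriodic {N : ℕ} {F : Type*} (f : Space N → F) : Prop :=
  ∀ (i : Fin N) (y : Space N), f (y + EuclideanSpace.single i 1) = f y

/-- The periodicity cell `Y = (0,1)^N`. -/
def unitCell (N : ℕ) : Set (Space N) := {y | ∀ i, y i ∈ Ioo (0 : ℝ) 1}

/-- The partial derivative `∂f/∂y_i`. -/
def pderiv {N : ℕ} {F : Type*} [NormedAddCommGroup F] [NormedSpace ℝ F]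
    (i : Fin N) (f : Space N → F) (y : Space N) : F :=
  fderiv ℝ f y (EuclideanSpace.single i 1)

/-- The standing assumptions on the domain and on the coefficients
`a^{ij}(x,y)`, `b^j(x,y)`, `c(x,y)`. -/
structure StandingAssumptions {N : ℕ} (Ω : Set (Space N))
    (a : Space N → Space N → Matrix (Fin N) (Fin N) ℝ)
    (b : Space N → Space N → Space N) (c : Space N → Space N → ℝ) : Prop where
  isOpen : IsOpen Ω
  isBounded : Bornology.IsBounded Ω
  isConnected : IsConnected Ω
  boundary : HasC2Boundary Ω
  a_C1 : ∀ i j, ContDiffOn ℝ 1 (fun z : Space N × Space N => a z.1 z.2 i j)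
    (closure Ω ×ˢ univ)
  b_C1 : ContDiffOn ℝ 1 (fun z : Space N × Space N => b z.1 z.2) (closure Ω ×ˢ univ)
  c_C1 : ContDiffOn ℝ 1 (fun z : Space N × Space N => c z.1 z.2) (closure Ω ×ˢ univ)
  a_periodic : ∀ x ∈ closure Ω, IsYPeriodic (a x)
  b_periodic : ∀ x ∈ closure Ω, IsYPeriodic (b x)
  c_periodic : ∀ x ∈ closure Ω, IsYPeriodic (c x)
  a_symm : ∀ x ∈ closure Ω, ∀ y, (a x y).IsSymm
  elliptic : ∃ m : ℝ, 0 < m ∧ ∀ x ∈ closure Ω, ∀ y ζ : Space N,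
    m * ‖ζ‖ ^ 2 ≤ ∑ i, ∑ j, a x y i j * ζ i * ζ j

/-- `H(p,x,y) = a^{ij}(x,y) p_i p_j - b^j(x,y) p_j + c(x,y)`. -/
def microHamiltonian {N : ℕ} (a : Space N → Space N → Matrix (Fin N) (Fin N) ℝ)
    (b : Space N → Space N → Space N) (c : Space N → Space N → ℝ) (p x y : Space N) : ℝ :=
  (∑ i, ∑ j, a x y i j * p i * p j) - (∑ j, b x y j * p j) + c x y

/-- `W` satisfies `F(∇W(x),x) ≤ lam` in `D` in the viscosity sense. -/
def IsViscositySubsolution {N : ℕ} (F : Space N → Space N → ℝ) (D : Set (Space N)) (lam : ℝ)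
    (W : Space N → ℝ) : Prop :=
  ∀ φ : Space N → ℝ, ContDiff ℝ 1 φ → ∀ x ∈ D,
    IsLocalMaxOn (fun z => W z - φ z) D x → F (gradient φ x) x ≤ lam

/-- `W` satisfies `F(∇W(x),x) ≥ lam` in `D` in the viscosity sense. The minimum is relative to `D`,
so that for closed `D` the condition at the boundary is the state constraint condition. -/
def IsViscositySupersolution {N : ℕ} (F : Space N → Space N → ℝ) (D : Set (Space N)) (lam : ℝ)
    (W : Space N → ℝ) : Prop :=
  ∀ φ : Space N → ℝ, ContDiff ℝ 1 φ → ∀ x ∈ D,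
    IsLocalMinOn (fun z => W z - φ z) D x → lam ≤ F (gradient φ x) x

/-- `θ` is the positive `Y`-periodic solution, normalized by `∫_Y θ = 1`, of
`∂²/∂y_i∂y_j (A^{ij}(y) θ) = 0`. The solution is continuous, belongs to the periodic Sobolev space
`W^{1,2}` (its weak gradient is `g`), and satisfies the equation in the sense of distributions. -/
def IsInvariantDensity {N : ℕ} (A : Space N → Matrix (Fin N) (Fin N) ℝ)
    (θ : Space N → ℝ) : Prop :=
  Continuous θ ∧ IsYPeriodic θ ∧ (∀ y, 0 < θ y) ∧
  (∃ g : Space N → Space N, MemLp g 2 (volume.restrict (unitCell N)) ∧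
    ∀ φ : Space N → ℝ, ContDiff ℝ 1 φ → IsYPeriodic φ → ∀ i,
      ∫ y in unitCell N, θ y * pderiv i φ y = -∫ y in unitCell N, g y i * φ y) ∧
  (∀ φ : Space N → ℝ, ContDiff ℝ 2 φ → IsYPeriodic φ →
    ∫ y in unitCell N, (∑ i, ∑ j, A y i j * pderiv i (pderiv j φ) y) * θ y = 0) ∧
  ∫ y in unitCell N, θ y = 1

/-- The operator `a^{ij} ∂²u/∂y_i∂y_j + (b^j - 2 a^{ij} p_i) ∂u/∂y_j + H(p,x,y) u`, acting on real or
complex valued functions of `y`. -/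
def cellOperator {N : ℕ} {F : Type*} [NormedAddCommGroup F] [NormedSpace ℝ F]
    (a : Space N → Space N → Matrix (Fin N) (Fin N) ℝ)
    (b : Space N → Space N → Space N) (c : Space N → Space N → ℝ) (p x : Space N)
    (u : Space N → F) (y : Space N) : F :=
  (∑ i, ∑ j, a x y i j • pderiv i (pderiv j u) y)
    + (∑ j, (b x y j - 2 * ∑ i, a x y i j * p i) • pderiv j u y)
    + microHamiltonian a b c p x y • u y

/-- `μ` is the first eigenvalue of the cell operator on `Y`-periodic functions: it has a
positive eigenfunction, and every complex eigenvalue `ν` has real part at most `μ`. -/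
def IsFirstEigenvalue {N : ℕ} (a : Space N → Space N → Matrix (Fin N) (Fin N) ℝ)
    (b : Space N → Space N → Space N) (c : Space N → Space N → ℝ) (p x : Space N)
    (μ : ℝ) : Prop :=
  (∃ u : Space N → ℝ, ContDiff ℝ 2 u ∧ IsYPeriodic u ∧ (∀ y, 0 < u y) ∧
    ∀ y, cellOperator a b c p x u y = μ * u y) ∧
  ∀ (ν : ℂ) (u : Space N → ℂ), ContDiff ℝ 2 u → IsYPeriodic u → u ≠ 0 →
    (∀ y, cellOperator a b c p x u y = ν * u y) → ν.re ≤ μ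

/-- `μ` is the (unique) number for which `H(p + ∇θ(y), x, y) = μ` has a continuous `Y`-periodic
viscosity solution `θ`. -/
def IsErgodicConstant {N : ℕ} (a : Space N → Space N → Matrix (Fin N) (Fin N) ℝ)
    (b : Space N → Space N → Space N) (c : Space N → Space N → ℝ) (p x : Space N)
    (μ : ℝ) : Prop :=
  ∃ θ : Space N → ℝ, Continuous θ ∧ IsYPeriodic θ ∧
    IsViscositySubsolution (fun q y => microHamiltonian a b c (p + q) x y) univ μ θ ∧
    IsViscositySupersolution (fun q y => microHamiltonian a b c (p + q) x y) univ μ θ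

/-- `H` is the effective Hamiltonian on `ℝ^N × closure Ω` (arguments `p`, `x` in this order)
associated with the coefficients and the exponent `α > 0`. -/
def IsEffectiveHamiltonian {N : ℕ} (Ω : Set (Space N)) (α : ℝ)
    (a : Space N → Space N → Matrix (Fin N) (Fin N) ℝ)
    (b : Space N → Space N → Space N) (c : Space N → Space N → ℝ)
    (H : Space N → Space N → ℝ) : Prop :=
  ∀ x ∈ closure Ω,
    (1 < α → ∃ θ : Space N → ℝ, IsInvariantDensity (a x) θ ∧
      ∀ p, H p x = ∫ y in unitCell N, microHamiltonian a b c p x y * θ y) ∧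
    (α = 1 → ∀ p, IsFirstEigenvalue a b c p x (H p x)) ∧
    (α < 1 → ∀ p, IsErgodicConstant a b c p x (H p x))

/-- `W ∈ C(closure Ω)` and `H(∇W(x),x) ≤ lam` in `Ω`. -/
def IsSubsol {N : ℕ} (Ω : Set (Space N)) (H : Space N → Space N → ℝ) (lam : ℝ)
    (W : Space N → ℝ) : Prop :=
  ContinuousOn W (closure Ω) ∧ IsViscositySubsolution H Ω lam W

/-- `W ∈ C(closure Ω)` and `H(∇W(x),x) ≥ lam` in `closure Ω`. -/
def IsSupersol {N : ℕ} (Ω : Set (Space N)) (H : Space N → Space N → ℝ) (lam : ℝ)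
    (W : Space N → ℝ) : Prop :=
  ContinuousOn W (closure Ω) ∧ IsViscositySupersolution H (closure Ω) lam W

/-- `W` solves the ergodic problem with state constraint boundary condition. -/
def IsErgodicSolution {N : ℕ} (Ω : Set (Space N)) (H : Space N → Space N → ℝ) (lam : ℝ)
    (W : Space N → ℝ) : Prop :=
  IsSubsol Ω H lam W ∧ IsSupersol Ω H lam W

/-- The additive eigenvalue. -/
def additiveEigenvalue {N : ℕ} (Ω : Set (Space N)) (H : Space N → Space N → ℝ) : ℝ :=
  sInf {lam : ℝ | ∃ W : Space N → ℝ, IsSubsol Ω H lam W}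

/-- The distance function `d_{H - lam}(x,y)`. -/
def hjDist {N : ℕ} (Ω : Set (Space N)) (H : Space N → Space N → ℝ) (lam : ℝ)
    (x y : Space N) : ℝ :=
  sSup {r : ℝ | ∃ W : Space N → ℝ, IsSubsol Ω H lam W ∧ r = W x - W y}

/-- The symmetrized distance `S_{H - lam}(x,y)`. -/
def symmDist {N : ℕ} (Ω : Set (Space N)) (H : Space N → Space N → ℝ) (lam : ℝ)
    (x y : Space N) : ℝ :=
  hjDist Ω H lam x y + hjDist Ω H lam y x

/-- The Aubry set `𝒜_{H - lam}`. -/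
def aubrySet {N : ℕ} (Ω : Set (Space N)) (H : Space N → Space N → ℝ) (lam : ℝ) :
    Set (Space N) :=
  {y | y ∈ closure Ω ∧ IsSupersol Ω H lam (fun x => hjDist Ω H lam x y)}

end

/-!
The proof separates the homogenization from the ergodic problem: for each range of `α` the effective
Hamiltonian is continuous on `ℝ^N × closure Ω`, convex and coercive in `p` (`IsConvexCoercive`), and
for such a Hamiltonian the statement holds on any bounded domain with the interior cone property
(`ergodic_of_isConvexCoercive`).

*The ergodic problem.* Doubling the variables with a shift into `Ω`, as for state constraints, gives
a common gradient at the maximum points of the difference of a Lipschitz subsolution and a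
supersolution, up to the boundary (`exists_le_and_le_of_isMax_sub`). It also shows that convex
combinations of subsolutions are subsolutions. By coercivity subsolutions are equi-Lipschitz near
every point of `closure Ω`, so that the infimum defining the additive eigenvalue is attained, and
the distance function is itself a subsolution. If `y` is not in the Aubry set, a test function at
which `d(·, y)` fails to be a supersolution can be used to raise `d(·, y)` to a subsolution which is
strict near `y`; by convexity and compactness there is a subsolution that is strict near any given
compact set disjoint from the Aubry set. Such a subsolution cannot be strict on all of `closure Ω`,
by minimality of the eigenvalue. Hence the Aubry set is not empty, and `d(·, y)` with `y` in it is a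
solution. For two solutions, the set where their difference is maximal meets the Aubry set by
comparison with a subsolution strict near that set; so solutions are determined by their values on
the Aubry set, where the vanishing of the symmetrized distance makes all differences constant.
Conversely, if `S(x, y) ≠ 0` with `x` and `y` in the Aubry set, the solutions `d(·, x)` and
`d(·, y)` do not differ by a constant.

*The case `α < 1`.* Comparing the equations at an extremum of the difference of two correctors
bounds the difference of the ergodic constants by the difference of the Hamiltonians on a compact
set of gradients. Convexity comes from combining correctors.

*The case `α = 1`.* The logarithm of a positive eigenfunction solves an equation that is convex in
the unknown and its gradient, and the same comparison applies to `C²` functions.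

*The case `α > 1`.* Convexity and coercivity are clear from the integral formula; continuity in `x`
needs the invariant density to depend continuously on `x`. An integration by parts puts its equation
in the divergence form `div (T ∇θ + θ β) = 0` (`IsFluxDensity`). For two densities with quotient
`h = θ₂ / θ₁`, test the second equation with `h` and the first one with `h² / 2`. The difference is
`∫ θ₁ ⟪T₁ ∇h, ∇h⟫`, up to terms bounded by the distance of the coefficients; with Poincaré's
inequality this bounds the variance of `h`, and `h` is then close to one because both densities have mass one
(`IsFluxDensity.exists_forall_integral_sq_sub_le`). Test functions have to be smooth, so `h` is
replaced by a quotient of mollifications. A periodic trigonometric kernel is used, since it is an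
admissible test function in the definition of the weak gradient.
-/

section Viscosity
open Filter Topology Metric Function
open scoped NNReal RealInnerProductSpace

variable {N : ℕ}

/-! ### Gradients of test functions -/

lemma hasGradientAt_mul_norm_sub_sq (A : ℝ) (q z : Space N) :
    HasGradientAt (fun z : Space N => A * ‖z - q‖ ^ 2) ((2 * A) • (z - q)) z := by
  rw [hasGradientAt_iff_hasFDerivAt]
  refine HasFDerivAt.congr_fderiv (((hasFDerivAt_id z).sub_const q).norm_sq.const_mul A) ?_
  ext v
  simp [mul_assoc, mul_left_comm]

lemma contDiff_mul_norm_sub_sq (A : ℝ) (q : Space N) :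
    ContDiff ℝ 1 (fun z : Space N => A * ‖z - q‖ ^ 2) :=
  contDiff_const.mul ((contDiff_id.sub contDiff_const).norm_sq ℝ)

lemma HasGradientAt.add' {f g : Space N → ℝ} {f' g' x : Space N} (hf : HasGradientAt f f' x)
    (hg : HasGradientAt g g' x) : HasGradientAt (fun z => f z + g z) (f' + g') x := by
  rw [hasGradientAt_iff_hasFDerivAt] at *
  exact HasFDerivAt.congr_fderiv (hf.add hg) (by simp)

lemma HasGradientAt.const_mul' {f : Space N → ℝ} {f' x : Space N} (hf : HasGradientAt f f' x)
    (k : ℝ) : HasGradientAt (fun z => k * f z) (k • f') x := by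
  rw [hasGradientAt_iff_hasFDerivAt] at *
  exact HasFDerivAt.congr_fderiv (hf.const_mul k) (by simp)

lemma ContDiff.hasGradientAt {f : Space N → ℝ} (hf : ContDiff ℝ 1 f) (x : Space N) :
    HasGradientAt f (gradient f x) x :=
  (hf.differentiable (by norm_num) x).hasGradientAt

lemma ContDiff.continuous_gradient {f : Space N → ℝ} (hf : ContDiff ℝ 1 f) :
    Continuous (gradient f) :=
  (InnerProductSpace.toDual ℝ (Space N)).symm.continuous.comp (hf.continuous_fderiv (by norm_num))

/-- A `C¹` function on an open set coincides near each point with a globally `C¹` function, so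
test functions need only be smooth near the point of contact. -/
lemma exists_contDiff_eventuallyEq {f : Space N → ℝ} {U : Set (Space N)} {x : Space N}
    (hU : IsOpen U) (hx : x ∈ U) (hf : ContDiffOn ℝ 1 f U) :
    ∃ g : Space N → ℝ, ContDiff ℝ 1 g ∧ g =ᶠ[𝓝 x] f := by
  obtain ⟨r, hr, hrU⟩ := Metric.nhds_basis_closedBall.mem_iff.1 (hU.mem_nhds hx)
  let χ : ContDiffBump x := ⟨r / 2, r, by positivity, by linarith⟩
  refine ⟨fun z => χ z * f z, ?_, ?_⟩
  · rw [contDiff_iff_contDiffAt]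
    intro z
    by_cases hz : z ∈ U
    · exact χ.contDiffAt.mul (hf.contDiffAt (hU.mem_nhds hz))
    · have hz' : z ∈ (closedBall x r)ᶜ := fun h => hz (hrU h)
      refine (contDiffAt_const (c := (0 : ℝ))).congr_of_eventuallyEq ?_
      filter_upwards [isClosed_closedBall.isOpen_compl.mem_nhds hz'] with y hy
      have : χ y = 0 := χ.zero_of_le_dist (by
        have : r < dist y x := by simpa using hy
        exact this.le)
      simp [this]
  · filter_upwards [χ.eventuallyEq_one] with y hy
    simp [hy]

lemma IsViscositySubsolution.le_of_isLocalMaxOn {F : Space N → Space N → ℝ}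
    {D U : Set (Space N)} {l : ℝ} {W φ : Space N → ℝ} {x p : Space N}
    (h : IsViscositySubsolution F D l W) (hx : x ∈ D) (hU : IsOpen U) (hxU : x ∈ U)
    (hφ : ContDiffOn ℝ 1 φ U) (hp : HasGradientAt φ p x)
    (hmax : IsLocalMaxOn (fun z => W z - φ z) D x) : F p x ≤ l := by
  obtain ⟨g, hg, hgf⟩ := exists_contDiff_eventuallyEq hU hxU hφ
  have hgp : gradient g x = p := (hp.congr_of_eventuallyEq hgf).gradient
  have h1 := h g hg x hx ?_
  · rwa [hgp] at h1
  · have h2 := hgf.eq_of_nhds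
    filter_upwards [hmax, hgf.filter_mono nhdsWithin_le_nhds] with z hz hz'
    rw [hz', h2]
    exact hz

lemma IsViscositySubsolution.mono {F : Space N → Space N → ℝ} {D D' : Set (Space N)} {l l' : ℝ}
    {W : Space N → ℝ} (h : IsViscositySubsolution F D l W) (hD : D' ⊆ D) (hD' : IsOpen D')
    (hl : l ≤ l') : IsViscositySubsolution F D' l' W := by
  intro φ hφ x hx hm
  refine (h φ hφ x (hD hx) ?_).trans hl
  have hm' : ∀ᶠ z in 𝓝 x, W z - φ z ≤ W x - φ x := by
    have := hm
    rwa [IsLocalMaxOn, IsMaxFilter, hD'.nhdsWithin_eq hx] at this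
  exact hm'.filter_mono nhdsWithin_le_nhds

lemma IsViscositySupersolution.inter_open {F : Space N → Space N → ℝ} {D U : Set (Space N)} {l : ℝ}
    {W : Space N → ℝ} (h : IsViscositySupersolution F D l W) (hU : IsOpen U) :
    IsViscositySupersolution F (D ∩ U) l W := by
  intro φ hφ x hx hm
  refine h φ hφ x hx.1 ?_
  have := hm
  rwa [IsLocalMinOn, IsMinFilter, nhdsWithin_inter_of_mem' (nhdsWithin_le_nhds (hU.mem_nhds hx.2))]
    at this

/-! ### Comparison at a maximum point -/

/-- One step of the doubling of variables: the penalisation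
`A‖x - y - ε n‖² + ‖y - x₀‖²` with `A = 2L/(cε)` pushes the point `x`, at which the subsolution is
tested, into the open set `D`. -/
lemma exists_doubling {F G : Space N → Space N → ℝ} {D E : Set (Space N)}
    {x₀ n : Space N} {r c lF lG L ε : ℝ} {u v : Space N → ℝ}
    (hx₀ : x₀ ∈ E) (hr : 0 < r) (hc : 0 < c) (hL : 0 < L) (hε : 0 < ε) (hDE : D ⊆ E)
    (hK : IsCompact (E ∩ closedBall x₀ r))
    (hcone : ∀ y ∈ E, dist y x₀ ≤ r → ∀ t, 0 < t → t ≤ r → ∀ w : Space N, ‖w‖ < c →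
      y + t • (n + w) ∈ D)
    (hu : ∀ x ∈ E ∩ closedBall x₀ r, ∀ y ∈ E ∩ closedBall x₀ r, u x - u y ≤ L * dist x y)
    (huc : ContinuousOn u (E ∩ closedBall x₀ r))
    (hv : ContinuousOn v (E ∩ closedBall x₀ r))
    (hmax : ∀ z ∈ E ∩ closedBall x₀ r, u z - v z ≤ u x₀ - v x₀)
    (hsub : IsViscositySubsolution F (D ∩ ball x₀ r) lF u)
    (hsup : IsViscositySupersolution G (E ∩ ball x₀ r) lG v)
    (hε1 : ε * (‖n‖ + c) < r / 2) (hε2 : L * ε * (2 * ‖n‖ + c) < (r / 2) ^ 2) (hε3 : ε ≤ r) :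
    ∃ x ∈ E, ∃ y ∈ E, ∃ p : Space N, ‖p‖ ≤ 2 * L ∧ dist x y ≤ ε * (‖n‖ + c) ∧
      dist y x₀ ^ 2 ≤ L * ε * (2 * ‖n‖ + c) ∧ F p x ≤ lF ∧ lG ≤ G (p + (-2 : ℝ) • (y - x₀)) y := by
  set A : ℝ := 2 * L / (c * ε) with hA
  have hA0 : 0 < A := by positivity
  have hK2 : IsCompact (E ∩ closedBall x₀ (r / 2)) := by
    have : E ∩ closedBall x₀ (r / 2) = (E ∩ closedBall x₀ r) ∩ closedBall x₀ (r / 2) := by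
      rw [inter_assoc, inter_eq_self_of_subset_right (closedBall_subset_closedBall (by linarith))]
    rw [this]
    exact hK.inter_right isClosed_closedBall
  have hsub2 : E ∩ closedBall x₀ (r / 2) ⊆ E ∩ closedBall x₀ r :=
    inter_subset_inter_right _ (closedBall_subset_closedBall (by linarith))
  let Φ : Space N × Space N → ℝ := fun z =>
    u z.1 - v z.2 - A * ‖z.1 - z.2 - ε • n‖ ^ 2 - ‖z.2 - x₀‖ ^ 2
  have hΦ : ContinuousOn Φ ((E ∩ closedBall x₀ r) ×ˢ (E ∩ closedBall x₀ (r / 2))) := by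
    refine ContinuousOn.sub (ContinuousOn.sub (ContinuousOn.sub ?_ ?_) ?_) ?_
    · exact huc.comp continuousOn_fst fun z hz => hz.1
    · exact hv.comp continuousOn_snd fun z hz => hsub2 hz.2
    · fun_prop
    · fun_prop
  have hx₀r : x₀ ∈ E ∩ closedBall x₀ r := ⟨hx₀, mem_closedBall_self hr.le⟩
  have hx₀r2 : x₀ ∈ E ∩ closedBall x₀ (r / 2) := ⟨hx₀, mem_closedBall_self (by linarith)⟩
  obtain ⟨⟨x, y⟩, ⟨hx, hy⟩, hxy⟩ := (hK.prod hK2).exists_isMaxOn ⟨(x₀, x₀), hx₀r, hx₀r2⟩ hΦ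
  have hmx : ∀ a ∈ E ∩ closedBall x₀ r, ∀ b ∈ E ∩ closedBall x₀ (r / 2), Φ (a, b) ≤ Φ (x, y) :=
    fun a ha b hb => hxy (show (a, b) ∈ _ from ⟨ha, hb⟩)
  simp only [Φ] at hmx
  -- shifted points are admissible
  have hshift : ∀ b ∈ E ∩ closedBall x₀ (r / 2), b + ε • n ∈ E ∩ closedBall x₀ r := by
    intro b hb
    refine ⟨hDE ?_, ?_⟩
    · have := hcone b hb.1 ((mem_closedBall.1 hb.2).trans (by linarith)) ε hε hε3 0 (by simpa)
      simpa using this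
    · have h1 : dist b x₀ ≤ r / 2 := hb.2
      have h2 : dist (b + ε • n) b = ε * ‖n‖ := by
        simp [dist_eq_norm, norm_smul, abs_of_pos hε]
      have h3 := dist_triangle (b + ε • n) b x₀
      rw [mem_closedBall]
      nlinarith
  have hy' := hsub2 hy
  set d : Space N := x - y - ε • n with hd
  -- the shift is almost exact
  have hd1 : ‖d‖ ≤ c * ε / 2 := by
    have h1 := hmx _ (hshift y hy) y hy
    have h2 := hu x hx _ (hshift y hy)
    have h3 : dist x (y + ε • n) = ‖d‖ := by rw [dist_eq_norm, hd]; congr 1; abel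
    have h4 : y + ε • n - y - ε • n = 0 := by abel
    rw [h4] at h1
    rw [h3] at h2
    simp only [norm_zero] at h1
    have h5 : A * ‖d‖ ^ 2 ≤ L * ‖d‖ := by linarith
    by_contra hcon
    push Not at hcon
    have h6 : 0 < ‖d‖ := lt_trans (by positivity) hcon
    have h7 : A * ‖d‖ ≤ L := by
      have : A * ‖d‖ * ‖d‖ ≤ L * ‖d‖ := by linarith
      exact le_of_mul_le_mul_right this h6
    have h8 : A * (c * ε / 2) = L := by rw [hA]; field_simp
    have := mul_lt_mul_of_pos_left hcon hA0
    linarith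
  have hxyd : dist x y ≤ ε * (‖n‖ + c) := by
    have h1 : x - y = d + ε • n := by rw [hd]; abel
    rw [dist_eq_norm, h1]
    refine (norm_add_le _ _).trans ?_
    rw [norm_smul, Real.norm_of_nonneg hε.le]
    nlinarith
  have hyx₀ : dist y x₀ ^ 2 ≤ L * ε * (2 * ‖n‖ + c) := by
    have h1 := hmx _ (hshift x₀ hx₀r2) x₀ hx₀r2
    have h4 : x₀ + ε • n - x₀ - ε • n = 0 := by abel
    rw [h4] at h1
    simp only [norm_zero, sub_self] at h1
    have h2 := hu x hx y hy'
    have h3 := hu x₀ hx₀r _ (hshift x₀ hx₀r2)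
    have h5 : dist x₀ (x₀ + ε • n) = ε * ‖n‖ := by
      simp [dist_eq_norm, norm_smul, abs_of_pos hε]
    rw [h5] at h3
    have h6 := hmax y hy'
    have h7 : 0 ≤ A * ‖d‖ ^ 2 := by positivity
    have h8 := mul_le_mul_of_nonneg_left hxyd hL.le
    rw [dist_eq_norm y x₀]
    nlinarith
  have hyball : dist y x₀ < r / 2 :=
    lt_of_pow_lt_pow_left₀ 2 (by linarith) (hyx₀.trans_lt hε2)
  have hxball : x ∈ ball x₀ r := by
    have := dist_triangle x y x₀
    rw [mem_ball]
    linarith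
  have hxD : x ∈ D := by
    have h1 := hcone y hy.1 (by linarith) ε hε hε3 (ε⁻¹ • d) (by
      rw [norm_smul, norm_inv, Real.norm_of_nonneg hε.le, inv_mul_lt_iff₀ hε]
      nlinarith)
    have h2 : y + ε • (n + ε⁻¹ • d) = x := by
      rw [smul_add, smul_smul, mul_inv_cancel₀ hε.ne', one_smul, hd]; abel
    rwa [h2] at h1
  refine ⟨x, hx.1, y, hy.1, (2 * A) • d, ?_, hxyd, hyx₀, ?_, ?_⟩
  · rw [norm_smul, Real.norm_of_nonneg (by positivity)]
    have h8 : A * (c * ε / 2) = L := by rw [hA]; field_simp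
    nlinarith [mul_le_mul_of_nonneg_left hd1 hA0.le]
  · have hg := hasGradientAt_mul_norm_sub_sq A (y + ε • n) x
    have hd' : x - (y + ε • n) = d := by rw [hd]; abel
    rw [hd'] at hg
    rw [← hg.gradient]
    refine hsub _ (contDiff_mul_norm_sub_sq A (y + ε • n)) x ⟨hxD, hxball⟩ ?_
    filter_upwards [self_mem_nhdsWithin] with z hz
    have h1 := hmx z ⟨hDE hz.1, ball_subset_closedBall hz.2⟩ y hy
    have h2 : z - (y + ε • n) = z - y - ε • n := by abel
    rw [h2, hd']
    linarith
  · have hg := (hasGradientAt_mul_norm_sub_sq (-A) (x - ε • n) y).add'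
      (hasGradientAt_mul_norm_sub_sq (-1) x₀ y)
    have hg' : (2 * -A) • (y - (x - ε • n)) + (2 * -1 : ℝ) • (y - x₀)
        = (2 * A) • d + (-2 : ℝ) • (y - x₀) := by
      rw [hd]
      module
    rw [hg'] at hg
    rw [← hg.gradient]
    refine hsup _ ((contDiff_mul_norm_sub_sq _ _).add (contDiff_mul_norm_sub_sq _ _)) y
      ⟨hy.1, mem_ball.2 (by linarith)⟩ ?_
    have hb : ∀ᶠ z in 𝓝[E ∩ ball x₀ r] y, z ∈ ball x₀ (r / 2) :=
      nhdsWithin_le_nhds (isOpen_ball.mem_nhds hyball)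
    filter_upwards [self_mem_nhdsWithin, hb] with z hz hz'
    have h1 := hmx x hx z ⟨hz.1, ball_subset_closedBall hz'⟩
    have h2 : ‖z - (x - ε • n)‖ = ‖x - z - ε • n‖ := by rw [← norm_neg]; congr 1; abel
    have h3 : ‖y - (x - ε • n)‖ = ‖d‖ := by rw [← norm_neg, hd]; congr 1; abel
    rw [h2, h3]
    linarith

/-- Comparison at a maximum point `x₀` of `u - v`, where `u` is a Lipschitz subsolution in the open
set `D` and `v` is a supersolution in `E ⊇ D`, `D` containing a cone `y + t(n + w)`, `‖w‖ < c`, at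
each point `y` of `E` near `x₀`: some vector `p` lies in both the sublevel set of `F` and the
superlevel set of `G` at `x₀`. -/
theorem exists_le_and_le_of_isMax_sub {F G : Space N → Space N → ℝ} {D E : Set (Space N)}
    {x₀ n : Space N} {r c lF lG L : ℝ} {u v : Space N → ℝ}
    (hx₀ : x₀ ∈ E) (hr : 0 < r) (hc : 0 < c) (hDE : D ⊆ E)
    (hK : IsCompact (E ∩ closedBall x₀ r))
    (hcone : ∀ y ∈ E, dist y x₀ ≤ r → ∀ t, 0 < t → t ≤ r → ∀ w : Space N, ‖w‖ < c →
      y + t • (n + w) ∈ D)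
    (hu : ∀ x ∈ E ∩ closedBall x₀ r, ∀ y ∈ E ∩ closedBall x₀ r, u x - u y ≤ L * dist x y)
    (huc : ContinuousOn u (E ∩ closedBall x₀ r))
    (hv : ContinuousOn v (E ∩ closedBall x₀ r))
    (hmax : ∀ z ∈ E ∩ closedBall x₀ r, u z - v z ≤ u x₀ - v x₀)
    (hF : ∀ p, ContinuousWithinAt (uncurry F) (univ ×ˢ E) (p, x₀))
    (hG : ∀ p, ContinuousWithinAt (uncurry G) (univ ×ˢ E) (p, x₀))
    (hsub : IsViscositySubsolution F (D ∩ ball x₀ r) lF u)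
    (hsup : IsViscositySupersolution G (E ∩ ball x₀ r) lG v) :
    ∃ p, F p x₀ ≤ lF ∧ lG ≤ G p x₀ := by
  set L' := max L 1 with hL'
  have hL0 : 0 < L' := by positivity
  have hu' : ∀ x ∈ E ∩ closedBall x₀ r, ∀ y ∈ E ∩ closedBall x₀ r,
      u x - u y ≤ L' * dist x y := fun x hx y hy =>
    (hu x hx y hy).trans (mul_le_mul_of_nonneg_right (le_max_left _ _) dist_nonneg)
  let e : ℕ → ℝ := fun k => 1 / ((k : ℝ) + 1)
  have he : Tendsto e atTop (𝓝 0) := tendsto_one_div_add_atTop_nhds_zero_nat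
  have he0 : ∀ k, 0 < e k := fun k => by positivity
  have e1 : Tendsto (fun k => e k * (‖n‖ + c)) atTop (𝓝 0) := by simpa using he.mul_const (‖n‖ + c)
  have e2 : Tendsto (fun k => L' * e k * (2 * ‖n‖ + c)) atTop (𝓝 0) := by
    simpa using (he.const_mul L').mul_const (2 * ‖n‖ + c)
  obtain ⟨k₀, hk₀⟩ := eventually_atTop.1
    ((e1.eventually_lt_const (show (0 : ℝ) < r / 2 by positivity)).and
    ((e2.eventually_lt_const (show (0:ℝ) < (r / 2) ^ 2 by positivity)).and
      (he.eventually_le_const hr)))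
  have key : ∀ k, ∃ z : Space N × Space N × Space N, z.1 ∈ E ∧ z.2.1 ∈ E ∧ ‖z.2.2‖ ≤ 2 * L' ∧
      dist z.1 z.2.1 ≤ e (k + k₀) * (‖n‖ + c) ∧
      dist z.2.1 x₀ ^ 2 ≤ L' * e (k + k₀) * (2 * ‖n‖ + c) ∧ F z.2.2 z.1 ≤ lF ∧
      lG ≤ G (z.2.2 + (-2 : ℝ) • (z.2.1 - x₀)) z.2.1 := by
    intro k
    obtain ⟨h1, h2, h3⟩ := hk₀ (k + k₀) (by omega)
    obtain ⟨x, hx, y, hy, p, h⟩ := exists_doubling hx₀ hr hc hL0 (he0 (k + k₀)) hDE hK hcone hu'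
      huc hv hmax hsub hsup h1 h2 h3
    exact ⟨(x, y, p), hx, hy, h⟩
  choose z hzx hzy hzp hzd hzy0 hzF hzG using key
  have e1' := e1.comp (tendsto_add_atTop_nat k₀)
  have e2' := e2.comp (tendsto_add_atTop_nat k₀)
  have hy : Tendsto (fun k => (z k).2.1) atTop (𝓝 x₀) := by
    rw [tendsto_iff_dist_tendsto_zero]
    have : Tendsto (fun k => dist (z k).2.1 x₀ ^ 2) atTop (𝓝 0) :=
      squeeze_zero (fun _ => by positivity) hzy0 e2'
    simpa using this.sqrt
  have hx : Tendsto (fun k => (z k).1) atTop (𝓝 x₀) := by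
    have h1 : Tendsto (fun k => dist (z k).2.1 (z k).1) atTop (𝓝 0) :=
      squeeze_zero (fun _ => dist_nonneg) (fun k => by rw [dist_comm]; exact hzd k) e1'
    exact tendsto_of_tendsto_of_dist hy h1
  obtain ⟨p, -, φ, hφ, hp⟩ := (isCompact_closedBall (0 : Space N) (2 * L')).tendsto_subseq
    (x := fun k => (z k).2.2) (fun k => by simpa using hzp k)
  have hx' := hx.comp hφ.tendsto_atTop
  have hy' := hy.comp hφ.tendsto_atTop
  refine ⟨p, ?_, ?_⟩
  · have h1 : Tendsto (fun k => ((z (φ k)).2.2, (z (φ k)).1)) atTop (𝓝[univ ×ˢ E] (p, x₀)) :=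
      tendsto_nhdsWithin_iff.2
        ⟨hp.prodMk_nhds hx', Eventually.of_forall fun k => ⟨mem_univ _, hzx _⟩⟩
    exact le_of_tendsto ((hF p).tendsto.comp h1) (Eventually.of_forall fun k => hzF _)
  · have h0 : Tendsto (fun k => (z (φ k)).2.2 + (-2 : ℝ) • ((z (φ k)).2.1 - x₀)) atTop (𝓝 p) := by
      have := hp.add ((hy'.sub_const x₀).const_smul (-2 : ℝ))
      simpa using this
    have h1 : Tendsto (fun k => ((z (φ k)).2.2 + (-2 : ℝ) • ((z (φ k)).2.1 - x₀), (z (φ k)).2.1))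
        atTop (𝓝[univ ×ˢ E] (p, x₀)) :=
      tendsto_nhdsWithin_iff.2
        ⟨h0.prodMk_nhds hy', Eventually.of_forall fun k => ⟨mem_univ _, hzy _⟩⟩
    exact ge_of_tendsto ((hG p).tendsto.comp h1) (Eventually.of_forall fun k => hzG _)

end Viscosity

section Viscosity
open Filter Topology Metric Function
open scoped NNReal RealInnerProductSpace

variable {N : ℕ}

/-- Convex combinations of subsolutions. If `t u₁ + (1 - t) u₂ - φ` has a local maximum at `x₀`,
then `u₁ - v` has one too, where `v = (φ - (1 - t) u₂) / t` is a supersolution for the Hamiltonian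
`(q, y) ↦ -F₂((∇φ(y) - t q) / (1 - t), y)`; the comparison at a maximum point applies. -/
lemma exists_convex_combination_of_isLocalMaxOn {F₁ F₂ : Space N → Space N → ℝ} {D : Set (Space N)}
    {x₀ : Space N} {r t l₁ l₂ L : ℝ} {u₁ u₂ φ : Space N → ℝ} (hD : IsOpen D) (hx₀ : x₀ ∈ D)
    (hr : 0 < r) (ht0 : 0 < t) (ht1 : t < 1)
    (hu₁ : ∀ x ∈ D ∩ ball x₀ r, ∀ y ∈ D ∩ ball x₀ r, u₁ x - u₁ y ≤ L * dist x y)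
    (hc₁ : ContinuousOn u₁ D) (hc₂ : ContinuousOn u₂ D)
    (hF₁ : ContinuousOn (uncurry F₁) (univ ×ˢ D)) (hF₂ : ContinuousOn (uncurry F₂) (univ ×ˢ D))
    (h₁ : IsViscositySubsolution F₁ D l₁ u₁) (h₂ : IsViscositySubsolution F₂ D l₂ u₂)
    (hφ : ContDiff ℝ 1 φ) (hmax : IsLocalMaxOn (fun z => t * u₁ z + (1 - t) * u₂ z - φ z) D x₀) :
    ∃ p₁ p₂ : Space N, t • p₁ + (1 - t) • p₂ = gradient φ x₀ ∧ F₁ p₁ x₀ ≤ l₁ ∧ F₂ p₂ x₀ ≤ l₂ := by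
  have ht1' : 0 < 1 - t := by linarith
  let T : Space N × Space N → Space N × Space N := fun z =>
    ((1 - t)⁻¹ • (gradient φ z.2 - t • z.1), z.2)
  have hT : Continuous T :=
    (((hφ.continuous_gradient.comp continuous_snd).sub
      (continuous_fst.const_smul t)).const_smul (1 - t)⁻¹).prodMk continuous_snd
  let G : Space N → Space N → ℝ := fun q y => -F₂ (T (q, y)).1 y
  have hG : ContinuousOn (uncurry G) (univ ×ˢ D) :=
    (hF₂.comp hT.continuousOn fun z hz => ⟨mem_univ _, hz.2⟩).neg
  let v : Space N → ℝ := fun z => t⁻¹ * (φ z - (1 - t) * u₂ z)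
  have hvc : ContinuousOn v D :=
    continuousOn_const.mul (hφ.continuous.continuousOn.sub (continuousOn_const.mul hc₂))
  have hsup : IsViscositySupersolution G D (-l₂) v := by
    intro ψ hψ y hy hm
    have hg : HasGradientAt (fun z => (1 - t)⁻¹ * (φ z + (-t) * ψ z))
        ((1 - t)⁻¹ • (gradient φ y + (-t) • gradient ψ y)) y :=
      ((hφ.hasGradientAt y).add' ((hψ.hasGradientAt y).const_mul' _)).const_mul' _
    have h := h₂ (fun z => (1 - t)⁻¹ * (φ z + (-t) * ψ z))
      (contDiff_const.mul (hφ.add (contDiff_const.mul hψ))) y hy ?_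
    · rw [hg.gradient] at h
      have h3 : gradient φ y + (-t) • gradient ψ y = gradient φ y - t • gradient ψ y := by module
      rw [h3] at h
      simp only [G, T]
      linarith
    · filter_upwards [hm] with z hz
      have h3 : ∀ z, u₂ z - (1 - t)⁻¹ * (φ z + -t * ψ z) = -((1 - t)⁻¹ * t) * (v z - ψ z) := by
        intro z
        simp only [v]
        field_simp
        ring
      rw [h3, h3]
      exact mul_le_mul_of_nonpos_left hz (by simp; positivity)
  obtain ⟨δ, hδ, hδD⟩ := Metric.isOpen_iff.1 hD x₀ hx₀
  have hmax' : ∀ᶠ z in 𝓝 x₀, t * u₁ z + (1 - t) * u₂ z - φ z ≤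
      t * u₁ x₀ + (1 - t) * u₂ x₀ - φ x₀ := by
    have := hmax
    rwa [IsLocalMaxOn, IsMaxFilter, hD.nhdsWithin_eq hx₀] at this
  obtain ⟨δ', hδ', hδm⟩ := Metric.eventually_nhds_iff.1 hmax'
  set s : ℝ := min (r / 2) (min (δ / 3) (δ' / 2)) with hs
  have hs0 : 0 < s := by positivity
  have hs1 : s ≤ r / 2 := min_le_left _ _
  have hs2 : s ≤ δ / 3 := (min_le_right _ _).trans (min_le_left _ _)
  have hs3 : s ≤ δ' / 2 := (min_le_right _ _).trans (min_le_right _ _)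
  have hsub : closedBall x₀ s ⊆ D := fun z hz => hδD (by
    rw [mem_ball]; rw [mem_closedBall] at hz; linarith)
  have hDs : D ∩ closedBall x₀ s = closedBall x₀ s := inter_eq_self_of_subset_right hsub
  have hball : D ∩ closedBall x₀ s ⊆ D ∩ ball x₀ r :=
    inter_subset_inter_right _ (closedBall_subset_ball (by linarith))
  have hcone : ∀ y ∈ D, dist y x₀ ≤ s → ∀ τ, 0 < τ → τ ≤ s → ∀ w : Space N, ‖w‖ < 1 →
      y + τ • (0 + w) ∈ D := by
    intro y _ hy τ hτ hτs w hw
    apply hδD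
    rw [mem_ball]
    have h1 := dist_triangle (y + τ • (0 + w)) y x₀
    have h2 : dist (y + τ • (0 + w)) y = τ * ‖w‖ := by
      simp [dist_eq_norm, norm_smul, abs_of_pos hτ]
    nlinarith
  have hmaxv : ∀ z ∈ D ∩ closedBall x₀ s, u₁ z - v z ≤ u₁ x₀ - v x₀ := by
    intro z hz
    have h1 : dist z x₀ ≤ s := hz.2
    have h2 := hδm (show dist z x₀ < δ' by linarith)
    have h3 : ∀ z, u₁ z - v z = t⁻¹ * (t * u₁ z + (1 - t) * u₂ z - φ z) := by
      intro z
      simp only [v]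
      field_simp
      ring
    rw [h3, h3]
    exact mul_le_mul_of_nonneg_left h2 (by positivity)
  obtain ⟨p, hp1, hp2⟩ := exists_le_and_le_of_isMax_sub (F := F₁) (G := G) (D := D) (E := D)
    (n := 0) (c := 1) (u := u₁) (v := v) (lF := l₁) (lG := -l₂) hx₀ hs0 one_pos subset_rfl
    (by rw [hDs]; exact isCompact_closedBall _ _) hcone
    (fun x hx y hy => hu₁ x (hball hx) y (hball hy)) (hc₁.mono inter_subset_left)
    (hvc.mono inter_subset_left) hmaxv (fun p => hF₁ _ ⟨mem_univ _, hx₀⟩)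
    (fun p => hG _ ⟨mem_univ _, hx₀⟩) (h₁.mono inter_subset_left (hD.inter isOpen_ball) le_rfl)
    (hsup.inter_open isOpen_ball)
  refine ⟨p, (T (p, x₀)).1, ?_, hp1, ?_⟩
  · simp only [T]
    rw [smul_smul, mul_inv_cancel₀ ht1'.ne', one_smul]
    abel
  · have : -l₂ ≤ -F₂ (T (p, x₀)).1 x₀ := hp2
    linarith

/-! ### Lipschitz bounds for subsolutions -/

lemma hasGradientAt_norm_sub {q z : Space N} (h : z ≠ q) :
    HasGradientAt (fun z : Space N => ‖z - q‖) (‖z - q‖⁻¹ • (z - q)) z := by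
  have h0 : ‖z - q‖ ≠ 0 := norm_ne_zero_iff.2 (sub_ne_zero.2 h)
  have h1 := hasGradientAt_mul_norm_sub_sq 1 q z
  rw [hasGradientAt_iff_hasFDerivAt] at *
  have h2 := h1.sqrt (by positivity)
  have h3 : (fun z : Space N => √(1 * ‖z - q‖ ^ 2)) = fun z => ‖z - q‖ := by
    ext z; rw [one_mul, Real.sqrt_sq (norm_nonneg _)]
  rw [h3] at h2
  refine h2.congr_fderiv ?_
  rw [one_mul, Real.sqrt_sq (norm_nonneg _), mul_one, ← LinearIsometryEquiv.map_smul, smul_smul]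
  congr 2
  field_simp

lemma sub_le_of_closedBall {F : Space N → Space N → ℝ} {D : Set (Space N)} {l R R' M r : ℝ}
    {W : Space N → ℝ} {q : Space N} (hr : 0 < r) (hR : 0 ≤ R) (hR' : R < R')
    (hcoer : ∀ x ∈ D, ∀ p, F p x ≤ l → ‖p‖ ≤ R) (hW : ContinuousOn W D)
    (hsub : IsViscositySubsolution F D l W) (hq : closedBall q r ⊆ D)
    (hM : ∀ z ∈ closedBall q r, |W z| ≤ M) :
    ∀ z ∈ closedBall q r, W z - W q ≤ R' * dist z q + (2 * M + 1) / r ^ 2 * dist z q ^ 2 := by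
  set K : ℝ := (2 * M + 1) / r ^ 2 with hK
  have hqq : q ∈ closedBall q r := mem_closedBall_self hr.le
  have hM0 : 0 ≤ M := (abs_nonneg _).trans (hM q hqq)
  have hK0 : 0 < K := by positivity
  have hφc : Continuous fun z : Space N => R' * ‖z - q‖ + K * ‖z - q‖ ^ 2 := by fun_prop
  obtain ⟨m, hm, hmax⟩ := (isCompact_closedBall q r).exists_isMaxOn ⟨q, hqq⟩
    ((hW.mono hq).sub hφc.continuousOn)
  have hmax' : ∀ z ∈ closedBall q r, W z - (R' * ‖z - q‖ + K * ‖z - q‖ ^ 2) ≤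
    W m - (R' * ‖m - q‖ + K * ‖m - q‖ ^ 2) := fun z hz => hmax hz
  by_cases hmq : m = q
  · intro z hz
    have h1 := hmax' z hz
    rw [hmq] at h1
    simp only [sub_self, norm_zero] at h1
    rw [dist_eq_norm]
    linarith
  exfalso
  have hpos : 0 < ‖m - q‖ := norm_pos_iff.2 (sub_ne_zero.2 hmq)
  rcases (mem_closedBall.1 hm).lt_or_eq with hlt | heq
  · have hg := ((hasGradientAt_norm_sub hmq).const_mul' R').add'
      (hasGradientAt_mul_norm_sub_sq K q m)
    have hmD : m ∈ D := hq hm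
    have h1 := hsub.le_of_isLocalMaxOn hmD isOpen_compl_singleton (show m ∈ ({q}ᶜ : Set _) from hmq)
      ?_ hg ?_
    · have h2 := hcoer m hmD _ h1
      have h3 : R' • ‖m - q‖⁻¹ • (m - q) + (2 * K) • (m - q)
          = (R' * ‖m - q‖⁻¹ + 2 * K) • (m - q) := by module
      have hR'0 : 0 < R' := by linarith
      rw [h3, norm_smul, Real.norm_of_nonneg (by positivity), add_mul, mul_assoc,
        inv_mul_cancel₀ hpos.ne', mul_one] at h2
      have : 0 < 2 * K * ‖m - q‖ := by positivity
      linarith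
    · refine ContDiffOn.add (contDiffOn_const.mul ?_) (contDiff_mul_norm_sub_sq K q).contDiffOn
      exact (contDiffOn_id.sub contDiffOn_const).norm ℝ fun z hz => sub_ne_zero.2 hz
    · have hb : ∀ᶠ z in 𝓝[D] m, z ∈ ball q r := nhdsWithin_le_nhds (isOpen_ball.mem_nhds hlt)
      filter_upwards [hb] with z hz
      exact hmax' z (ball_subset_closedBall hz)
  · have h1 := hmax' q hqq
    have h2 := abs_le.1 (hM q hqq)
    have h3 := abs_le.1 (hM m hm)
    rw [dist_eq_norm] at heq
    have h4 : K * r ^ 2 = 2 * M + 1 := by rw [hK]; field_simp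
    simp only [sub_self, norm_zero, heq] at h1
    nlinarith

/-- If the sublevel set `{p : F p x ≤ l}` lies in the ball of radius `R`, then subsolutions are
`R`-Lipschitz along segments. -/
theorem sub_le_of_segment_subset {F : Space N → Space N → ℝ} {D : Set (Space N)} {l R : ℝ}
    {W : Space N → ℝ} {x y : Space N} (hD : IsOpen D) (hR : 0 ≤ R)
    (hcoer : ∀ x ∈ D, ∀ p, F p x ≤ l → ‖p‖ ≤ R) (hW : ContinuousOn W D)
    (hsub : IsViscositySubsolution F D l W) (hxy : segment ℝ x y ⊆ D) :
    W y - W x ≤ R * dist x y := by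
  have hseg : IsCompact (segment ℝ x y) := by
    rw [segment_eq_image']
    exact isCompact_Icc.image (by fun_prop)
  obtain ⟨r, hr, hrD⟩ := hseg.exists_cthickening_subset_open hD hxy
  obtain ⟨M, hM⟩ := hseg.cthickening (r := r) |>.exists_bound_of_continuousOn (hW.mono hrD)
  have hball : ∀ q ∈ segment ℝ x y, closedBall q r ⊆ cthickening r (segment ℝ x y) :=
    fun q hq => closedBall_subset_cthickening hq r
  refine le_of_forall_gt_imp_ge_of_dense fun B hB => ?_
  obtain ⟨R', hR', hR'B⟩ : ∃ R' > R, R' * dist x y < B := by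
    have h1 : Tendsto (fun s => s * dist x y) (𝓝[>] R) (𝓝 (R * dist x y)) :=
      ((continuous_id.mul continuous_const).tendsto R).mono_left nhdsWithin_le_nhds
    obtain ⟨s, hs, hs'⟩ := ((h1.eventually_lt_const hB).and self_mem_nhdsWithin).exists
    exact ⟨s, hs', hs⟩
  refine le_trans ?_ hR'B.le
  set K : ℝ := (2 * M + 1) / r ^ 2
  have hstep : ∀ q ∈ segment ℝ x y, ∀ z ∈ closedBall q r,
      W z - W q ≤ R' * dist z q + K * dist z q ^ 2 := fun q hq =>
    sub_le_of_closedBall hr hR hR' hcoer hW hsub ((hball q hq).trans hrD)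
      fun z hz => hM z (hball q hq hz)
  have hn : ∀ᶠ n : ℕ in atTop, W y - W x ≤ R' * dist x y + K * dist x y ^ 2 * (1 / (n : ℝ)) := by
    have h1 : Tendsto (fun n : ℕ => dist x y * (1 / (n : ℝ))) atTop (𝓝 0) := by
      simpa using (tendsto_one_div_atTop_nhds_zero_nat (𝕜 := ℝ)).const_mul (dist x y)
    filter_upwards [h1.eventually_lt_const hr, eventually_gt_atTop 0] with n hn hn0
    have hn0' : (0 : ℝ) < n := by exact_mod_cast hn0
    let γ : ℕ → Space N := fun i => x + ((i : ℝ) / n) • (y - x)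
    have hγ : ∀ i ∈ Finset.range n, W (γ (i + 1)) - W (γ i) ≤
        R' * (dist x y * (1 / n)) + K * (dist x y * (1 / n)) ^ 2 := by
      intro i hi
      have hi' : (i : ℝ) ≤ n := by exact_mod_cast (Finset.mem_range.1 hi).le
      have hd : dist (γ (i + 1)) (γ i) = dist x y * (1 / n) := by
        have : γ (i + 1) - γ i = (1 / (n : ℝ)) • (y - x) := by
          simp only [γ]; push_cast; module
        rw [dist_eq_norm, this, norm_smul, Real.norm_of_nonneg (by positivity), dist_comm x y,
          dist_eq_norm, mul_comm]
      have := hstep (γ i) ?_ (γ (i + 1)) (by rw [mem_closedBall, hd]; exact hn.le)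
      · rwa [hd] at this
      · rw [segment_eq_image']
        exact ⟨i / n, ⟨by positivity, by rw [div_le_one hn0']; exact hi'⟩, rfl⟩
    have hsum := Finset.sum_le_sum hγ
    rw [Finset.sum_range_sub (fun i => W (γ i)), Finset.sum_const, Finset.card_range,
      nsmul_eq_mul] at hsum
    have e0 : γ 0 = x := by simp [γ]
    have e1 : γ n = y := by simp [γ, hn0'.ne']
    rw [e0, e1] at hsum
    refine hsum.trans (le_of_eq ?_)
    field_simp
  refine ge_of_tendsto ?_ hn
  have := (tendsto_one_div_atTop_nhds_zero_nat (𝕜 := ℝ)).const_mul (K * dist x y ^ 2)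
  simpa using this.const_add (R' * dist x y)

/-! ### Stability -/

/-- Subsolutions are stable under suprema and uniform limits: `W` is a subsolution near `x₀` if it
is approximated at `x₀`, and bounded below nearby, by subsolutions. -/
lemma le_of_isLocalMaxOn_of_approx {F : Space N → Space N → ℝ} {D : Set (Space N)} {l r : ℝ}
    {W φ : Space N → ℝ} {x₀ : Space N} (hD : IsOpen D) (hx₀ : x₀ ∈ D) (hr : 0 < r)
    (hrD : closedBall x₀ r ⊆ D) (hF : ContinuousOn (uncurry F) (univ ×ˢ D))
    (happ : ∀ ε > 0, ∃ V, ContinuousOn V D ∧ IsViscositySubsolution F D (l + ε) V ∧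
      (∀ z ∈ closedBall x₀ r, V z ≤ W z + ε) ∧ W x₀ - ε ≤ V x₀)
    (hφ : ContDiff ℝ 1 φ) (hmax : IsLocalMaxOn (fun z => W z - φ z) D x₀) :
    F (gradient φ x₀) x₀ ≤ l := by
  have hmax' : ∀ᶠ z in 𝓝 x₀, W z - φ z ≤ W x₀ - φ x₀ := by
    have := hmax
    rwa [IsLocalMaxOn, IsMaxFilter, hD.nhdsWithin_eq hx₀] at this
  obtain ⟨δ, hδ, hδm⟩ := Metric.eventually_nhds_iff.1 hmax'
  set s : ℝ := min r (δ / 2) with hs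
  have hs0 : 0 < s := by positivity
  have hs1 : s ≤ r := min_le_left _ _
  have hs2 : s < δ := (min_le_right _ _).trans_lt (by linarith)
  have hsD : closedBall x₀ s ⊆ D := (closedBall_subset_closedBall hs1).trans hrD
  let e : ℕ → ℝ := fun k => 1 / ((k : ℝ) + 1)
  have he : Tendsto e atTop (𝓝 0) := tendsto_one_div_add_atTop_nhds_zero_nat
  have he0 : ∀ k, 0 < e k := fun k => by positivity
  have e2 : Tendsto (fun k => 2 * e k) atTop (𝓝 0) := by simpa using he.const_mul 2
  obtain ⟨k₀, hk₀⟩ := eventually_atTop.1 (e2.eventually_lt_const (show (0:ℝ) < s ^ 2 by positivity))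
  have key : ∀ k, ∃ z ∈ D, dist z x₀ ^ 2 ≤ 2 * e (k + k₀) ∧
      F (gradient φ z + (2 * 1 : ℝ) • (z - x₀)) z ≤ l + e (k + k₀) := by
    intro k
    obtain ⟨V, hVc, hV, hVW, hVx⟩ := happ (e (k + k₀)) (he0 _)
    have hφc : Continuous fun z : Space N => φ z + 1 * ‖z - x₀‖ ^ 2 := by
      have := hφ.continuous; fun_prop
    obtain ⟨z, hz, hzm⟩ := (isCompact_closedBall x₀ s).exists_isMaxOn
      ⟨x₀, mem_closedBall_self hs0.le⟩ ((hVc.mono hsD).sub hφc.continuousOn)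
    have hzm' : ∀ w ∈ closedBall x₀ s, V w - (φ w + 1 * ‖w - x₀‖ ^ 2) ≤
      V z - (φ z + 1 * ‖z - x₀‖ ^ 2) := fun w hw => hzm hw
    have hd : dist z x₀ ^ 2 ≤ 2 * e (k + k₀) := by
      have h1 := hzm' x₀ (mem_closedBall_self hs0.le)
      have h2 := hVW z (closedBall_subset_closedBall hs1 hz)
      have h3 := hδm (lt_of_le_of_lt hz hs2)
      simp only [sub_self, norm_zero] at h1
      rw [dist_eq_norm]
      linarith
    have hzb : dist z x₀ < s :=
      lt_of_pow_lt_pow_left₀ 2 hs0.le (hd.trans_lt (hk₀ _ (by omega)))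
    refine ⟨z, hsD hz, hd, ?_⟩
    have hg := (hφ.hasGradientAt z).add' (hasGradientAt_mul_norm_sub_sq 1 x₀ z)
    rw [← hg.gradient]
    refine hV _ (hφ.add (contDiff_mul_norm_sub_sq 1 x₀)) z (hsD hz) ?_
    have hb : ∀ᶠ w in 𝓝[D] z, w ∈ ball x₀ s := nhdsWithin_le_nhds (isOpen_ball.mem_nhds hzb)
    filter_upwards [hb] with w hw
    exact hzm' w (ball_subset_closedBall hw)
  choose z hzD hzd hzF using key
  have hz : Tendsto z atTop (𝓝 x₀) := by
    rw [tendsto_iff_dist_tendsto_zero]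
    have : Tendsto (fun k => dist (z k) x₀ ^ 2) atTop (𝓝 0) :=
      squeeze_zero (fun _ => by positivity) hzd (e2.comp (tendsto_add_atTop_nat k₀))
    simpa using this.sqrt
  have hp : Tendsto (fun k => gradient φ (z k) + (2 * 1 : ℝ) • (z k - x₀)) atTop
      (𝓝 (gradient φ x₀)) := by
    have := ((hφ.continuous_gradient.tendsto x₀).comp hz).add
      ((hz.sub_const x₀).const_smul (2 * 1 : ℝ))
    simpa using this
  have h1 : Tendsto (fun k => (gradient φ (z k) + (2 * 1 : ℝ) • (z k - x₀), z k)) atTop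
      (𝓝[univ ×ˢ D] (gradient φ x₀, x₀)) :=
    tendsto_nhdsWithin_iff.2 ⟨hp.prodMk_nhds hz, Eventually.of_forall fun k => ⟨mem_univ _, hzD _⟩⟩
  have h2 : Tendsto (fun k => l + e (k + k₀)) atTop (𝓝 l) := by
    simpa using (he.comp (tendsto_add_atTop_nat k₀)).const_add l
  exact le_of_tendsto_of_tendsto' ((hF _ ⟨mem_univ _, hx₀⟩).tendsto.comp h1) h2 hzF

end Viscosity

section Domain
open Filter Topology Metric Function
open scoped NNReal RealInnerProductSpace

variable {N : ℕ}

/-! ### The interior cone property -/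

/-- Near each point of its closure, `Ω` contains a truncated open cone of uniform shape with vertex
at any point of the closure. -/
def HasInteriorCone (Ω : Set (Space N)) : Prop :=
  ∀ x₀ ∈ closure Ω, ∃ n : Space N, ∃ r > 0, ∃ c > 0, ∀ y ∈ closure Ω, dist y x₀ ≤ r →
    ∀ t, 0 < t → t ≤ r → ∀ w : Space N, ‖w‖ < c → y + t • (n + w) ∈ Ω

lemma dist_add_smul_le (x₀ y n w : Space N) {t c : ℝ} (ht : 0 < t) (hw : ‖w‖ < c) :
    dist (y + t • (n + w)) x₀ ≤ dist y x₀ + t * (‖n‖ + c) := by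
  have h1 := dist_triangle (y + t • (n + w)) y x₀
  have h2 : dist (y + t • (n + w)) y = t * ‖n + w‖ := by
    rw [dist_self_add_left, norm_smul, Real.norm_of_nonneg ht.le]
  have h3 := norm_add_le n w
  nlinarith

/-- A direction in which the defining function strictly decreases points into `Ω`. -/
theorem HasC2Boundary.hasInteriorCone {Ω : Set (Space N)} (hΩ : IsOpen Ω) (h : HasC2Boundary Ω) :
    HasInteriorCone Ω := by
  intro x₀ hx₀
  by_cases hx₀' : x₀ ∈ Ω
  · obtain ⟨δ, hδ, hδΩ⟩ := Metric.isOpen_iff.1 hΩ x₀ hx₀'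
    refine ⟨0, δ / 3, by positivity, 1, one_pos, fun y _ hy t ht htr w hw => hδΩ ?_⟩
    have := dist_add_smul_le x₀ y 0 w ht hw
    rw [norm_zero] at this
    rw [mem_ball]
    linarith
  obtain ⟨U, hU, hxU, ρ, hρ, hρ0, hΩU⟩ := h x₀ ⟨hx₀, fun h' => hx₀' (interior_subset h')⟩
  obtain ⟨n, hn⟩ : ∃ n, fderiv ℝ ρ x₀ n < 0 := by
    obtain ⟨v, hv⟩ : ∃ v, fderiv ℝ ρ x₀ v ≠ 0 := by
      by_contra hcon
      push Not at hcon
      exact hρ0 (by ext v; simpa using hcon v)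
    rcases lt_or_gt_of_ne hv with h1 | h1
    · exact ⟨v, h1⟩
    · exact ⟨-v, by simpa using h1⟩
  have hcont : Continuous fun z : Space N × Space N => fderiv ℝ ρ z.1 (n + z.2) := by
    have := hρ.continuous_fderiv (by norm_num)
    fun_prop
  have hev : ∀ᶠ z : Space N × Space N in 𝓝 (x₀, 0), fderiv ℝ ρ z.1 (n + z.2) < 0 ∧ z.1 ∈ U :=
    (hcont.continuousAt.eventually_lt_const (by simpa using hn)).and
      (continuous_fst.continuousAt.eventually (hU.mem_nhds hxU))
  obtain ⟨δ, hδ, hδ'⟩ := Metric.eventually_nhds_iff.1 hev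
  have hball : ∀ z w : Space N, dist z x₀ < δ → ‖w‖ < δ → fderiv ℝ ρ z (n + w) < 0 ∧ z ∈ U :=
    fun z w hz hw => hδ' (y := (z, w)) (by simp [Prod.dist_eq, hz, hw])
  have hden : 0 < 1 + ‖n‖ + δ := by positivity
  refine ⟨n, δ / (2 * (1 + ‖n‖ + δ)), by positivity, δ, hδ, fun y hy hyr t ht htr w hw => ?_⟩
  set r := δ / (2 * (1 + ‖n‖ + δ)) with hr
  have hrδ : r * (1 + ‖n‖ + δ) = δ / 2 := by rw [hr]; field_simp
  have hin : ∀ s, 0 ≤ s → s ≤ t → dist (y + s • (n + w)) x₀ < δ := by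
    intro s hs hst
    rcases hs.eq_or_lt with rfl | hs
    · simp only [zero_smul, add_zero]
      nlinarith [norm_nonneg n]
    · have := dist_add_smul_le x₀ y n w hs hw
      nlinarith [norm_nonneg n]
  have hyU : y ∈ U := (hball y 0 (by simpa using hin 0 le_rfl ht.le) (by simpa using hδ)).2
  have hρy : ρ y ≤ 0 := by
    have h1 : y ∈ closure (Ω ∩ U) := by
      rw [inter_comm]
      exact hU.inter_closure ⟨hyU, hy⟩
    have h2 : Ω ∩ U ⊆ {z | ρ z ≤ 0} := by
      rw [hΩU]
      exact fun z hz => le_of_lt (a := ρ z) hz.1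
    exact closure_minimal h2 (isClosed_le hρ.continuous continuous_const) h1
  have hder : ∀ s : ℝ, HasDerivAt (fun s : ℝ => ρ (y + s • (n + w)))
      (fderiv ℝ ρ (y + s • (n + w)) (n + w)) s := by
    intro s
    have h1 : HasDerivAt (fun s : ℝ => y + s • (n + w)) (n + w) s := by
      simpa using ((hasDerivAt_id s).smul_const (n + w)).const_add y
    exact ((hρ.differentiable (by norm_num)) _).hasFDerivAt.comp_hasDerivAt s h1
  have hanti : StrictAntiOn (fun s : ℝ => ρ (y + s • (n + w))) (Icc 0 t) := by
    refine strictAntiOn_of_deriv_neg (convex_Icc 0 t)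
      (fun s _ => (hder s).continuousAt.continuousWithinAt) fun s hs => ?_
    rw [interior_Icc] at hs
    rw [(hder s).deriv]
    exact (hball _ w (hin s hs.1.le hs.2.le) hw).1
  have hlt := hanti (left_mem_Icc.2 ht.le) (right_mem_Icc.2 ht.le) ht
  simp only [zero_smul, add_zero] at hlt
  have hmem : y + t • (n + w) ∈ {x | ρ x < 0} ∩ U :=
    ⟨lt_of_lt_of_le hlt hρy, (hball _ w (hin t ht.le le_rfl) hw).2⟩
  rw [← hΩU] at hmem
  exact hmem.1

/-! ### Convex coercive Hamiltonians -/

/-- The structural properties of the effective Hamiltonian on which the ergodic problem depends. -/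
structure IsConvexCoercive (Ω : Set (Space N)) (H : Space N → Space N → ℝ) : Prop where
  cont : ContinuousOn (uncurry H) (univ ×ˢ closure Ω)
  convex : ∀ x ∈ closure Ω, ConvexOn ℝ univ fun p => H p x
  coercive : ∀ l : ℝ, ∃ R : ℝ, 0 ≤ R ∧ ∀ x ∈ closure Ω, ∀ p, H p x ≤ l → ‖p‖ ≤ R

variable {Ω : Set (Space N)} {H : Space N → Space N → ℝ}

lemma IsSubsol.mono {l l' : ℝ} {W : Space N → ℝ} (hΩ : IsOpen Ω) (h : IsSubsol Ω H l W)
    (hl : l ≤ l') : IsSubsol Ω H l' W :=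
  ⟨h.1, h.2.mono subset_rfl hΩ hl⟩

lemma IsViscositySubsolution.sub_const {F : Space N → Space N → ℝ} {D : Set (Space N)} {l : ℝ}
    {W : Space N → ℝ} (h : IsViscositySubsolution F D l W) (k : ℝ) :
    IsViscositySubsolution F D l fun x => W x - k := by
  intro φ hφ x hx hm
  refine h φ hφ x hx ?_
  filter_upwards [hm] with z hz
  linarith

/-- Subsolutions are equi-Lipschitz near each point of the closure: boundary points are first moved
inwards along the axis of the cone. -/
theorem exists_lipschitz_near (hΩ : IsOpen Ω) (hcone : HasInteriorCone Ω)
    (hH : IsConvexCoercive Ω H) (l : ℝ) {x₀ : Space N} (hx₀ : x₀ ∈ closure Ω) :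
    ∃ r > 0, ∃ C : ℝ, 0 ≤ C ∧ ∀ W, IsSubsol Ω H l W → ∀ x ∈ closure Ω ∩ ball x₀ r,
      ∀ y ∈ closure Ω ∩ ball x₀ r, W x - W y ≤ C * dist x y := by
  obtain ⟨R, hR, hcoer⟩ := hH.coercive l
  obtain ⟨n, r₀, hr₀, c, hc, hcone⟩ := hcone x₀ hx₀
  refine ⟨min r₀ (c * r₀ / 4), by positivity, R * (4 * ‖n‖ / c + 1), by positivity, ?_⟩
  intro W hW x hx y hy
  have hcoer' : ∀ x ∈ Ω, ∀ p, H p x ≤ l → ‖p‖ ≤ R := fun x hx => hcoer x (subset_closure hx)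
  have hseg : ∀ x y, segment ℝ x y ⊆ Ω → W y - W x ≤ R * dist x y := fun x y h =>
    sub_le_of_segment_subset hΩ hR hcoer' (hW.1.mono subset_closure) hW.2 h
  -- along the axis of the cone
  have haxis : ∀ z ∈ closure Ω, dist z x₀ ≤ r₀ → ∀ t, 0 < t → t ≤ r₀ →
      |W (z + t • n) - W z| ≤ R * (‖n‖ * t) := by
    intro z hz hzr t ht htr
    have hin : ∀ s, 0 < s → s ≤ r₀ → z + s • n ∈ Ω := fun s hs hsr => by
      simpa using hcone z hz hzr s hs hsr 0 (by simpa)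
    have hlim : Tendsto (fun s : ℝ => |W (z + t • n) - W (z + s • n)|) (𝓝[>] 0)
        (𝓝 |W (z + t • n) - W z|) := by
      have h1 : Tendsto (fun s : ℝ => z + s • n) (𝓝[>] 0) (𝓝[closure Ω] z) := by
        refine tendsto_nhdsWithin_iff.2 ⟨?_, ?_⟩
        · have : Continuous fun s : ℝ => z + s • n := by fun_prop
          have h2 := this.tendsto 0
          simp only [zero_smul, add_zero] at h2
          exact h2.mono_left nhdsWithin_le_nhds
        · filter_upwards [Ioo_mem_nhdsGT hr₀] with s hs
          exact subset_closure (hin s hs.1 hs.2.le)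
      exact (((hW.1 z hz).tendsto.comp h1).const_sub _).abs
    refine le_of_tendsto hlim ?_
    filter_upwards [Ioo_mem_nhdsGT ht] with s hs
    have hsub : ∀ a b : ℝ, 0 < a → 0 < b → a ≤ r₀ → b ≤ r₀ →
        segment ℝ (z + a • n) (z + b • n) ⊆ Ω := by
      intro a b ha hb har hbr w hw
      rw [segment_eq_image] at hw
      obtain ⟨θ, hθ, rfl⟩ := hw
      have : (1 - θ) • (z + a • n) + θ • (z + b • n) = z + ((1 - θ) * a + θ * b) • n := by module
      simp only [this]
      refine hin _ ?_ ?_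
      · rcases hθ.1.eq_or_lt with h0 | h0
        · rw [← h0]; simpa
        · nlinarith [mul_pos h0 hb, mul_nonneg (sub_nonneg.2 hθ.2) ha.le]
      · nlinarith [hθ.1, hθ.2, mul_le_mul_of_nonneg_left hbr hθ.1,
          mul_le_mul_of_nonneg_left har (sub_nonneg.2 hθ.2)]
    have hd : dist (z + s • n) (z + t • n) ≤ ‖n‖ * t := by
      have : z + s • n - (z + t • n) = (s - t) • n := by module
      rw [dist_eq_norm, this, norm_smul, mul_comm]
      refine mul_le_mul_of_nonneg_left ?_ (norm_nonneg n)
      rw [Real.norm_eq_abs, abs_sub_comm, abs_of_nonneg (by linarith [hs.2])]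
      linarith [hs.1]
    have h1 := hseg _ _ (hsub s t hs.1 ht (hs.2.le.trans htr) htr)
    have h2 := hseg _ _ (hsub t s ht hs.1 htr (hs.2.le.trans htr))
    rw [dist_comm] at h2
    have h3 := mul_le_mul_of_nonneg_left hd hR
    rw [abs_le]
    constructor <;> linarith
  have hxr : dist x x₀ < r₀ := lt_of_lt_of_le hx.2 (min_le_left _ _)
  have hyr : dist y x₀ < r₀ := lt_of_lt_of_le hy.2 (min_le_left _ _)
  rcases (dist_nonneg (x := x) (y := y)).eq_or_lt with h0 | h0
  · rw [dist_eq_zero.1 h0.symm]; simp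
  have hd : dist x y ≤ c * r₀ / 2 := by
    have h1 : dist x x₀ < c * r₀ / 4 := lt_of_lt_of_le hx.2 (min_le_right _ _)
    have h2 : dist y x₀ < c * r₀ / 4 := lt_of_lt_of_le hy.2 (min_le_right _ _)
    linarith [dist_triangle_right x y x₀]
  set t : ℝ := 2 * dist x y / c with ht
  have htc : t * c = 2 * dist x y := by rw [ht]; field_simp
  have ht0 : 0 < t := by positivity
  have htr : t ≤ r₀ := by rw [ht, div_le_iff₀ hc]; linarith
  have h1 := abs_le.1 (haxis x hx.1 hxr.le t ht0 htr)
  have h2 := abs_le.1 (haxis y hy.1 hyr.le t ht0 htr)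
  have h3 : W (x + t • n) - W (y + t • n) ≤ R * dist (y + t • n) (x + t • n) := by
    refine hseg _ _ ?_
    intro w hw
    rw [segment_eq_image'] at hw
    obtain ⟨θ, hθ, rfl⟩ := hw
    have h4 : y + t • n + θ • (x + t • n - (y + t • n)) = y + t • (n + (θ / t) • (x - y)) := by
      rw [smul_add, smul_smul, mul_div_cancel₀ _ ht0.ne']; module
    simp only [h4]
    refine hcone y hy.1 hyr.le t ht0 htr _ ?_
    rw [norm_smul, ← dist_eq_norm, Real.norm_of_nonneg (div_nonneg hθ.1 ht0.le), div_mul_eq_mul_div,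
      div_lt_iff₀ ht0]
    nlinarith [hθ.1, hθ.2]
  rw [dist_add_right, dist_comm] at h3
  have h5 : R * (4 * ‖n‖ / c + 1) * dist x y = 2 * (R * (‖n‖ * t)) + R * dist x y := by
    rw [ht]; field_simp; ring
  linarith

/-- The oscillation of subsolutions between two points is bounded. -/
theorem exists_sub_le (hΩ : IsOpen Ω) (hcon : IsConnected Ω) (hcone : HasInteriorCone Ω)
    (hH : IsConvexCoercive Ω H) (l : ℝ) {x y : Space N} (hx : x ∈ closure Ω) (hy : y ∈ closure Ω) :
    ∃ C : ℝ, ∀ W, IsSubsol Ω H l W → W x - W y ≤ C := by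
  refine hcon.isPreconnected.closure.induction₂'
    (fun x y => ∃ C : ℝ, ∀ W, IsSubsol Ω H l W → W x - W y ≤ C) ?_ ?_ hx hy
  · intro x hx
    obtain ⟨r, hr, C, hC, hlip⟩ := exists_lipschitz_near hΩ hcone hH l hx
    filter_upwards [inter_mem_nhdsWithin (closure Ω) (ball_mem_nhds x hr)] with y hy
    exact ⟨⟨_, fun W hW => hlip W hW x ⟨hx, mem_ball_self hr⟩ y hy⟩,
      ⟨_, fun W hW => hlip W hW y hy x ⟨hx, mem_ball_self hr⟩⟩⟩
  · rintro x y z - - - ⟨C, hC⟩ ⟨C', hC'⟩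
    exact ⟨C + C', fun W hW => by linarith [hC W hW, hC' W hW]⟩

/-! ### The distance function -/

lemma bddAbove_hjDist (hΩ : IsOpen Ω) (hcon : IsConnected Ω) (hcone : HasInteriorCone Ω)
    (hH : IsConvexCoercive Ω H) (l : ℝ) {x y : Space N} (hx : x ∈ closure Ω) (hy : y ∈ closure Ω) :
    BddAbove {r : ℝ | ∃ W : Space N → ℝ, IsSubsol Ω H l W ∧ r = W x - W y} := by
  obtain ⟨C, hC⟩ := exists_sub_le hΩ hcon hcone hH l hx hy
  exact ⟨C, by rintro r ⟨W, hW, rfl⟩; exact hC W hW⟩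

lemma sub_le_hjDist (hΩ : IsOpen Ω) (hcon : IsConnected Ω) (hcone : HasInteriorCone Ω)
    (hH : IsConvexCoercive Ω H) {l : ℝ} {x y : Space N} (hx : x ∈ closure Ω) (hy : y ∈ closure Ω)
    {W : Space N → ℝ} (hW : IsSubsol Ω H l W) : W x - W y ≤ hjDist Ω H l x y :=
  le_csSup (bddAbove_hjDist hΩ hcon hcone hH l hx hy) ⟨W, hW, rfl⟩

lemma hjDist_le {l C : ℝ} (hne : ∃ W, IsSubsol Ω H l W) {x y : Space N}
    (h : ∀ W, IsSubsol Ω H l W → W x - W y ≤ C) : hjDist Ω H l x y ≤ C := by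
  obtain ⟨W, hW⟩ := hne
  refine csSup_le ⟨_, W, hW, rfl⟩ ?_
  rintro r ⟨W, hW, rfl⟩
  exact h W hW

lemma hjDist_self {l : ℝ} (hne : ∃ W, IsSubsol Ω H l W) (y : Space N) :
    hjDist Ω H l y y = 0 := by
  have : {r : ℝ | ∃ W : Space N → ℝ, IsSubsol Ω H l W ∧ r = W y - W y} = {0} := by
    ext r
    simp only [sub_self, mem_ofPred_eq, mem_singleton_iff]
    exact ⟨fun ⟨_, _, h⟩ => h, fun h => ⟨hne.choose, hne.choose_spec, h⟩⟩
  rw [hjDist, this, csSup_singleton]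

lemma continuousOn_of_lipschitz_near {C : Set (Space N)} {u : Space N → ℝ}
    (h : ∀ x ∈ C, ∃ r > 0, ∃ L : ℝ, ∀ y ∈ C ∩ ball x r, ∀ z ∈ C ∩ ball x r,
      u y - u z ≤ L * dist y z) : ContinuousOn u C := by
  intro x hx
  obtain ⟨r, hr, L, hL⟩ := h x hx
  have hxr : x ∈ C ∩ ball x r := ⟨hx, mem_ball_self hr⟩
  rw [ContinuousWithinAt, tendsto_iff_dist_tendsto_zero]
  have h1 : Tendsto (fun y => L * dist y x) (𝓝[C] x) (𝓝 0) := by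
    have : Continuous fun y => L * dist y x := by fun_prop
    have h2 := this.tendsto x
    simp only [dist_self, mul_zero] at h2
    exact h2.mono_left nhdsWithin_le_nhds
  refine squeeze_zero' (Eventually.of_forall fun _ => dist_nonneg) ?_ h1
  filter_upwards [inter_mem_nhdsWithin C (ball_mem_nhds x hr)] with y hy
  rw [Real.dist_eq, abs_le]
  have h2 := hL y hy x hxr
  have h3 := hL x hxr y hy
  rw [dist_comm] at h3
  constructor <;> linarith

lemma hjDist_lipschitz_near (hΩ : IsOpen Ω) (hcon : IsConnected Ω) (hcone : HasInteriorCone Ω)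
    (hH : IsConvexCoercive Ω H) {l l' r C : ℝ} (hne : ∃ W, IsSubsol Ω H l' W) (hl : l' ≤ l)
    {x₀ y : Space N} (hy : y ∈ closure Ω)
    (hC : ∀ W, IsSubsol Ω H l W → ∀ x ∈ closure Ω ∩ ball x₀ r,
      ∀ y ∈ closure Ω ∩ ball x₀ r, W x - W y ≤ C * dist x y) :
    ∀ x ∈ closure Ω ∩ ball x₀ r, ∀ z ∈ closure Ω ∩ ball x₀ r,
      hjDist Ω H l' x y - hjDist Ω H l' z y ≤ C * dist x z := by
  intro x hx z hz
  rw [sub_le_iff_le_add]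
  refine hjDist_le hne fun W hW => ?_
  have h1 := hC W (hW.mono hΩ hl) x hx z hz
  have h2 := sub_le_hjDist hΩ hcon hcone hH hz.1 hy hW
  linarith

/-- The distance from a point is itself a subsolution, as a supremum of subsolutions. -/
theorem isSubsol_hjDist (hΩ : IsOpen Ω) (hcon : IsConnected Ω) (hcone : HasInteriorCone Ω)
    (hH : IsConvexCoercive Ω H) {l : ℝ} (hne : ∃ W, IsSubsol Ω H l W)
    {y : Space N} (hy : y ∈ closure Ω) : IsSubsol Ω H l fun x => hjDist Ω H l x y := by
  refine ⟨continuousOn_of_lipschitz_near fun x hx => ?_, ?_⟩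
  · obtain ⟨r, hr, C, -, hC⟩ := exists_lipschitz_near hΩ hcone hH l hx
    exact ⟨r, hr, C, hjDist_lipschitz_near hΩ hcon hcone hH hne le_rfl hy hC⟩
  · intro φ hφ x hx hm
    obtain ⟨r, hr, hrΩ⟩ := Metric.nhds_basis_closedBall.mem_iff.1 (hΩ.mem_nhds hx)
    refine le_of_isLocalMaxOn_of_approx hΩ hx hr hrΩ
      (hH.cont.mono (prod_mono subset_rfl subset_closure)) (fun ε hε => ?_) hφ hm
    obtain ⟨W₀, hW₀⟩ := hne
    obtain ⟨s, ⟨W, hW, rfl⟩, hs⟩ := exists_lt_of_lt_csSup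
      (s := {r : ℝ | ∃ W : Space N → ℝ, IsSubsol Ω H l W ∧ r = W x - W y}) ⟨_, W₀, hW₀, rfl⟩
      (show hjDist Ω H l x y - ε < sSup _ from sub_lt_self _ hε)
    refine ⟨fun z => W z - W y, (hW.1.mono subset_closure).sub continuousOn_const,
      (hW.2.sub_const _).mono subset_rfl hΩ (by linarith), fun z hz => ?_, hs.le⟩
    have := sub_le_hjDist hΩ hcon hcone hH (subset_closure (hrΩ hz)) hy hW
    linarith

end Domain

section Ergodic
open Filter Topology Metric Function
open scoped NNReal RealInnerProductSpace

variable {N : ℕ} {Ω : Set (Space N)} {H : Space N → Space N → ℝ}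

/-! ### The additive eigenvalue is attained -/

lemma exists_isSubsol (hΩ : IsOpen Ω) (hbd : Bornology.IsBounded Ω) (hH : IsConvexCoercive Ω H) :
    ∃ l W, IsSubsol Ω H l W := by
  have hc : ContinuousOn (fun x => H 0 x) (closure Ω) :=
    hH.cont.comp (f := fun x => ((0 : Space N), x)) (by fun_prop) fun x hx => ⟨mem_univ _, hx⟩
  obtain ⟨C, hC⟩ := hbd.isCompact_closure.exists_bound_of_continuousOn hc
  refine ⟨C, fun _ => 0, continuousOn_const, fun φ hφ x hx hm => ?_⟩
  have hmin : IsLocalMin φ x := by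
    have : ∀ᶠ z in 𝓝 x, (0 : ℝ) - φ z ≤ 0 - φ x := by
      have := hm
      rwa [IsLocalMaxOn, IsMaxFilter, hΩ.nhdsWithin_eq hx] at this
    filter_upwards [this] with z hz
    linarith
  have h0 : gradient φ x = 0 := by simp [gradient, hmin.fderiv_eq_zero]
  rw [h0]
  exact (abs_le.1 (hC x (subset_closure hx))).2

lemma IsViscositySubsolution.exists_le {F : Space N → Space N → ℝ} {l : ℝ} {W : Space N → ℝ}
    (hΩ : IsOpen Ω) (hne : Ω.Nonempty) (hW : ContinuousOn W Ω)
    (h : IsViscositySubsolution F Ω l W) : ∃ x ∈ Ω, ∃ p, F p x ≤ l := by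
  obtain ⟨q, hq⟩ := hne
  obtain ⟨r, hr, hrΩ⟩ := Metric.nhds_basis_closedBall.mem_iff.1 (hΩ.mem_nhds hq)
  obtain ⟨M, hM⟩ := (isCompact_closedBall q r).exists_bound_of_continuousOn (hW.mono hrΩ)
  have hqq : q ∈ closedBall q r := mem_closedBall_self hr.le
  set K : ℝ := (2 * M + 1) / r ^ 2 with hK
  have hφ := contDiff_mul_norm_sub_sq K q
  obtain ⟨m, hm, hmax⟩ := (isCompact_closedBall q r).exists_isMaxOn ⟨q, hqq⟩
    ((hW.mono hrΩ).sub hφ.continuous.continuousOn)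
  have hmax' : ∀ z ∈ closedBall q r, W z - K * ‖z - q‖ ^ 2 ≤ W m - K * ‖m - q‖ ^ 2 :=
    fun z hz => hmax hz
  have hlt : dist m q < r := by
    refine lt_of_le_of_ne hm fun heq => ?_
    have h1 := hmax' q hqq
    have h2 := abs_le.1 (hM q hqq)
    have h3 := abs_le.1 (hM m hm)
    have h4 : K * r ^ 2 = 2 * M + 1 := by rw [hK]; field_simp
    rw [dist_eq_norm] at heq
    rw [heq, h4] at h1
    simp only [sub_self, norm_zero] at h1
    linarith
  refine ⟨m, hrΩ hm, _, h _ hφ m (hrΩ hm) ?_⟩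
  have hb : ∀ᶠ z in 𝓝[Ω] m, z ∈ ball q r := nhdsWithin_le_nhds (isOpen_ball.mem_nhds hlt)
  filter_upwards [hb] with z hz
  exact hmax' z (ball_subset_closedBall hz)

lemma bddBelow_subsol (hΩ : IsOpen Ω) (hbd : Bornology.IsBounded Ω) (hne : Ω.Nonempty)
    (hH : IsConvexCoercive Ω H) : BddBelow {l : ℝ | ∃ W : Space N → ℝ, IsSubsol Ω H l W} := by
  obtain ⟨R, hR, hcoer⟩ := hH.coercive 0
  have hK : IsCompact (closedBall (0 : Space N) R ×ˢ closure Ω) :=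
    (isCompact_closedBall _ _).prod hbd.isCompact_closure
  obtain ⟨C, hC⟩ := hK.exists_bound_of_continuousOn
    (hH.cont.mono (prod_mono (subset_univ _) subset_rfl))
  refine ⟨min 0 (-C), ?_⟩
  rintro l ⟨W, hW⟩
  obtain ⟨x, hx, p, hp⟩ := hW.2.exists_le hΩ hne (hW.1.mono subset_closure)
  have hx' := subset_closure hx
  rcases le_total (H p x) 0 with h | h
  · have h1 := abs_le.1 (hC (p, x) ⟨by simpa using hcoer x hx' p h, hx'⟩)
    exact (min_le_right _ _).trans (h1.1.trans hp)
  · exact (min_le_left _ _).trans (h.trans hp)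

/-- There is a subsolution at the critical level: the distances at slightly larger levels decrease
to one. -/
theorem exists_isSubsol_additiveEigenvalue (hΩ : IsOpen Ω) (hbd : Bornology.IsBounded Ω)
    (hcon : IsConnected Ω) (hcone : HasInteriorCone Ω) (hH : IsConvexCoercive Ω H) :
    ∃ W, IsSubsol Ω H (additiveEigenvalue Ω H) W := by
  set l := additiveEigenvalue Ω H with hl
  obtain ⟨y, hy⟩ := hcon.nonempty
  have hy' := subset_closure hy
  let e : ℕ → ℝ := fun k => 1 / ((k : ℝ) + 1)
  have he0 : ∀ k, 0 < e k := fun k => by positivity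
  have he1 : ∀ k, e k ≤ 1 := fun k => by
    simp only [e]; rw [div_le_one (by positivity)]; linarith [(Nat.cast_nonneg k : (0:ℝ) ≤ k)]
  have he : Tendsto e atTop (𝓝 0) := tendsto_one_div_add_atTop_nhds_zero_nat
  have hanti : Antitone e := fun i j hij => by
    simp only [e]; gcongr
  have hne : ∀ k, ∃ W, IsSubsol Ω H (l + e k) W := by
    intro k
    obtain ⟨l₀, W₀, hW₀⟩ := exists_isSubsol hΩ hbd hH
    obtain ⟨l', ⟨W, hW⟩, hl'⟩ := exists_lt_of_csInf_lt
      (s := {l : ℝ | ∃ W : Space N → ℝ, IsSubsol Ω H l W}) ⟨l₀, W₀, hW₀⟩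
      (show sInf _ < l + e k from lt_add_of_pos_right _ (he0 k))
    exact ⟨W, hW.mono hΩ hl'.le⟩
  let D : ℕ → Space N → ℝ := fun k x => hjDist Ω H (l + e k) x y
  have hD : ∀ k, IsSubsol Ω H (l + e k) (D k) := fun k =>
    isSubsol_hjDist hΩ hcon hcone hH (hne k) hy'
  have hDanti : ∀ x ∈ closure Ω, Antitone fun k => D k x := by
    intro x hx i j hij
    refine hjDist_le (hne j) fun W hW => ?_
    exact sub_le_hjDist hΩ hcon hcone hH hx hy' (hW.mono hΩ (by linarith [hanti hij]))
  have hDbd : ∀ x ∈ closure Ω, BddBelow (range fun k => D k x) := by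
    intro x hx
    refine ⟨-hjDist Ω H (l + 1) y x, ?_⟩
    rintro _ ⟨k, rfl⟩
    obtain ⟨W, hW⟩ := hne k
    have h1 := sub_le_hjDist hΩ hcon hcone hH hx hy' hW
    have h2 := sub_le_hjDist hΩ hcon hcone hH hy' hx (hW.mono hΩ (show l + e k ≤ l + 1 by
      linarith [he1 k]))
    simp only [D]
    linarith
  let W : Space N → ℝ := fun x => ⨅ k, D k x
  have hlim : ∀ x ∈ closure Ω, Tendsto (fun k => D k x) atTop (𝓝 (W x)) := fun x hx =>
    tendsto_atTop_ciInf (hDanti x hx) (hDbd x hx)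
  have hWc : ContinuousOn W (closure Ω) := by
    refine continuousOn_of_lipschitz_near fun x hx => ?_
    obtain ⟨r, hr, C, -, hC⟩ := exists_lipschitz_near hΩ hcone hH (l + 1) hx
    refine ⟨r, hr, C, fun z hz w hw => ?_⟩
    exact le_of_tendsto' ((hlim z hz.1).sub (hlim w hw.1)) fun k =>
      hC _ ((hD k).mono hΩ (by linarith [he1 k])) z hz w hw
  refine ⟨W, hWc, fun φ hφ x hx hm => ?_⟩
  obtain ⟨r, hr, hrΩ⟩ := Metric.nhds_basis_closedBall.mem_iff.1 (hΩ.mem_nhds hx)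
  have hrΩ' := hrΩ.trans subset_closure
  refine le_of_isLocalMaxOn_of_approx hΩ hx hr hrΩ
    (hH.cont.mono (prod_mono subset_rfl subset_closure)) (fun ε hε => ?_) hφ hm
  have hunif : TendstoUniformlyOn D W atTop (closedBall x r) :=
    Antitone.tendstoUniformlyOn_of_forall_tendsto (isCompact_closedBall x r)
      (fun k => (hD k).1.mono hrΩ') (fun z hz => hDanti z (hrΩ' hz)) (hWc.mono hrΩ')
      fun z hz => hlim z (hrΩ' hz)
  obtain ⟨k, hk1, hk2⟩ := ((Metric.tendstoUniformlyOn_iff.1 hunif ε hε).and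
    (he.eventually_lt_const hε)).exists
  refine ⟨D k, (hD k).1.mono subset_closure, (hD k).2.mono subset_rfl hΩ (by linarith), ?_, ?_⟩
  · intro z hz
    have := hk1 z hz
    rw [Real.dist_eq, abs_lt] at this
    linarith [this.1]
  · have := ciInf_le (hDbd x (subset_closure hx)) k
    simp only [W]
    linarith

/-! ### Strict subsolutions away from the Aubry set -/

lemma IsViscositySubsolution.union {F : Space N → Space N → ℝ} {D₁ D₂ : Set (Space N)} {l : ℝ}
    {W : Space N → ℝ} (h₁ : IsViscositySubsolution F D₁ l W)
    (h₂ : IsViscositySubsolution F D₂ l W) : IsViscositySubsolution F (D₁ ∪ D₂) l W := by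
  rintro φ hφ x (hx | hx) hm
  · exact h₁ φ hφ x hx (hm.filter_mono (nhdsWithin_mono x subset_union_left))
  · exact h₂ φ hφ x hx (hm.filter_mono (nhdsWithin_mono x subset_union_right))

/-- The convexity of the Hamiltonian passes to subsolutions, also when their levels differ. -/
theorem IsViscositySubsolution.convex_combination (hH : IsConvexCoercive Ω H) {D : Set (Space N)}
    {l₁ l₂ t : ℝ} {u₁ u₂ : Space N → ℝ} (hD : IsOpen D) (hDΩ : D ⊆ Ω) (ht0 : 0 < t) (ht1 : t < 1)
    (hc₁ : ContinuousOn u₁ D) (hc₂ : ContinuousOn u₂ D)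
    (h₁ : IsViscositySubsolution H D l₁ u₁) (h₂ : IsViscositySubsolution H D l₂ u₂) :
    IsViscositySubsolution H D (t * l₁ + (1 - t) * l₂) fun x => t * u₁ x + (1 - t) * u₂ x := by
  intro φ hφ x hx hm
  have hDc : D ⊆ closure Ω := hDΩ.trans subset_closure
  obtain ⟨R, hR, hcoer⟩ := hH.coercive l₁
  obtain ⟨r, hr, hrD⟩ := Metric.isOpen_iff.1 hD x hx
  have hHc := hH.cont.mono (prod_mono (subset_refl univ) hDc)
  obtain ⟨p₁, p₂, hp, hp₁, hp₂⟩ := exists_convex_combination_of_isLocalMaxOn (L := R) hD hx hr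
    ht0 ht1 (fun z hz w hw => by
      have := sub_le_of_segment_subset hD hR (fun x hx => hcoer x (hDc hx)) hc₁ h₁
        (((convex_ball x r).segment_subset hw.2 hz.2).trans hrD)
      rwa [dist_comm] at this) hc₁ hc₂ hHc hHc h₁ h₂ hφ hm
  rw [← hp]
  have h3 := (hH.convex x (hDc hx)).2 (mem_univ p₁) (mem_univ p₂) ht0.le (sub_nonneg.2 ht1.le)
    (by ring)
  simp only [smul_eq_mul] at h3
  nlinarith [mul_le_mul_of_nonneg_left hp₁ ht0.le,
    mul_le_mul_of_nonneg_left hp₂ (sub_nonneg.2 ht1.le)]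

/-- Where a test function touches a subsolution from below with a strict inequality, the
subsolution can be raised, and made strict near the point of contact. -/
lemma exists_raised_subsol (hΩ : IsOpen Ω) (hH : IsConvexCoercive Ω H) {l ρ : ℝ}
    {u φ : Space N → ℝ} {x₀ : Space N} (hx₀ : x₀ ∈ closure Ω) (hu : IsSubsol Ω H l u)
    (hφ : ContDiff ℝ 1 φ) (hmin : IsLocalMinOn (fun z => u z - φ z) (closure Ω) x₀)
    (hlt : H (gradient φ x₀) x₀ < l) (hρ : 0 < ρ) :
    ∃ ψ, IsSubsol Ω H l ψ ∧ u x₀ < ψ x₀ ∧ (∀ z, ρ ≤ dist z x₀ → ψ z = u z) ∧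
      ∃ U, IsOpen U ∧ x₀ ∈ U ∧ ∃ δ > 0, IsViscositySubsolution H (Ω ∩ U) (l - δ) ψ := by
  obtain ⟨l', hl', hl'l⟩ := exists_between hlt
  -- a radius on which the perturbed test function is a strict subsolution
  have hcontg : Continuous fun z => gradient φ z + (2 * -1 : ℝ) • (z - x₀) :=
    hφ.continuous_gradient.add (by fun_prop)
  have hcontH : ContinuousWithinAt (fun z => H (gradient φ z + (2 * -1 : ℝ) • (z - x₀)) z)
      (closure Ω) x₀ :=
    (hH.cont.comp (f := fun z => (gradient φ z + (2 * -1 : ℝ) • (z - x₀), z))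
      (hcontg.prodMk continuous_id).continuousOn fun x hx => ⟨mem_univ _, hx⟩) x₀ hx₀
  have hev1 : ∀ᶠ z in 𝓝[closure Ω] x₀, H (gradient φ z + (2 * -1 : ℝ) • (z - x₀)) z < l' :=
    hcontH.eventually_lt_const (by simpa using hl')
  have hev := hev1.and hmin
  obtain ⟨s, hs, hsb⟩ := Metric.mem_nhdsWithin_iff.1 hev
  set r : ℝ := min s ρ with hr
  have hr0 : 0 < r := by positivity
  have hrs : r ≤ s := min_le_left _ _
  have hrρ : r ≤ ρ := min_le_right _ _
  have hb : ∀ z ∈ closure Ω, dist z x₀ < r →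
      H (gradient φ z + (2 * -1 : ℝ) • (z - x₀)) z < l' ∧ u x₀ - φ x₀ ≤ u z - φ z :=
    fun z hz hzr => hsb ⟨lt_of_lt_of_le hzr hrs, hz⟩
  set ε : ℝ := r ^ 2 / 8 with hε
  have hε0 : 0 < ε := by positivity
  let χ : Space N → ℝ := fun z => φ z + -1 * ‖z - x₀‖ ^ 2 + (u x₀ - φ x₀ + ε)
  have hχ : ContDiff ℝ 1 χ := (hφ.add (contDiff_mul_norm_sub_sq (-1) x₀)).add contDiff_const
  have hχg : ∀ z, gradient χ z = gradient φ z + (2 * -1 : ℝ) • (z - x₀) := by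
    intro z
    have h1 := ((hφ.hasGradientAt z).add' (hasGradientAt_mul_norm_sub_sq (-1) x₀ z)).add'
      (hasGradientAt_const z (u x₀ - φ x₀ + ε))
    rw [add_zero] at h1
    exact h1.gradient
  have hχsub : ∀ z ∈ closure Ω, dist z x₀ < r → H (gradient χ z) z < l' := fun z hz hzr => by
    rw [hχg]; exact (hb z hz hzr).1
  have hχu : ∀ z ∈ closure Ω, dist z x₀ < r → r / 2 ≤ dist z x₀ → χ z ≤ u z := by
    intro z hz hzr hzr2
    have h1 := (hb z hz hzr).2
    rw [dist_eq_norm] at hzr2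
    have h2 : (r / 2) ^ 2 ≤ ‖z - x₀‖ ^ 2 := pow_le_pow_left₀ (by positivity) hzr2 2
    simp only [χ]
    nlinarith
  have hχ0 : χ x₀ = u x₀ + ε := by simp [χ]; ring
  let ψ : Space N → ℝ := fun z => if dist z x₀ < r then max (u z) (χ z) else u z
  have hψin : ∀ z ∈ ball x₀ r, ψ z = max (u z) (χ z) := fun z hz => if_pos hz
  have hψout : ∀ z ∈ closure Ω, r / 2 ≤ dist z x₀ → ψ z = u z := by
    intro z hz hzr
    by_cases h : dist z x₀ < r
    · simp only [ψ, if_pos h]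
      exact max_eq_left (hχu z hz h hzr)
    · exact if_neg h
  have hopen : IsOpen {z : Space N | r / 2 < dist z x₀} :=
    isOpen_lt continuous_const (by fun_prop)
  have hψnear : ∀ z ∈ ball x₀ r, ψ =ᶠ[𝓝 z] fun w => max (u w) (χ w) := fun z hz => by
    filter_upwards [isOpen_ball.mem_nhds hz] with w hw using hψin w hw
  have hψfar : ∀ z, r / 2 < dist z x₀ → ψ =ᶠ[𝓝[closure Ω] z] u := fun z hz => by
    filter_upwards [self_mem_nhdsWithin, nhdsWithin_le_nhds (hopen.mem_nhds hz)] with w hw hw'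
    exact hψout w hw hw'.le
  have hcont : ContinuousOn ψ (closure Ω) := by
    intro z hz
    by_cases h : dist z x₀ < r
    · have h1 : ContinuousWithinAt (fun w => max (u w) (χ w)) (closure Ω) z :=
        (hu.1 z hz).max hχ.continuous.continuousWithinAt
      exact h1.congr_of_eventuallyEq ((hψnear z h).filter_mono nhdsWithin_le_nhds) (hψin z h)
    · have h' : r / 2 < dist z x₀ := by linarith [not_lt.1 h]
      exact (hu.1 z hz).congr_of_eventuallyEq (hψfar z h') (hψout z hz h'.le)
  -- contact with the maximum reduces to contact with one of the two functions
  have htest : ∀ θ : Space N → ℝ, ContDiff ℝ 1 θ → ∀ x ∈ Ω, dist x x₀ < r → ψ x = χ x →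
      IsLocalMaxOn (fun z => ψ z - θ z) Ω x → H (gradient θ x) x < l' := by
    intro θ hθ x hx hxr hxχ hm
    have hloc : IsLocalMax (fun z => χ z - θ z) x := by
      have h1 : ∀ᶠ z in 𝓝 x, ψ z - θ z ≤ ψ x - θ x := by
        have := hm
        rwa [IsLocalMaxOn, IsMaxFilter, hΩ.nhdsWithin_eq hx] at this
      filter_upwards [h1, hψnear x hxr] with z hz hz'
      rw [hz', hxχ] at hz
      linarith [le_max_right (u z) (χ z)]
    have h0 : HasGradientAt (fun z => χ z - θ z) (gradient χ x - gradient θ x) x := by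
      have h1 := (hχ.hasGradientAt x).add' ((hθ.hasGradientAt x).const_mul' (-1))
      convert h1 using 1
      · ext z; ring
      · module
    have h2 : gradient (fun z => χ z - θ z) x = 0 := by simp [gradient, hloc.fderiv_eq_zero]
    rw [h0.gradient, sub_eq_zero] at h2
    rw [← h2]
    exact hχsub x (subset_closure hx) hxr
  refine ⟨ψ, ⟨hcont, fun θ hθ x hx hm => ?_⟩, ?_, fun z hz => if_neg (by linarith), ?_⟩
  · by_cases hcase : dist x x₀ < r ∧ ψ x = χ x
    · exact ((htest θ hθ x hx hcase.1 hcase.2 hm).trans hl'l).le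
    · have hxu : ψ x = u x := by
        by_cases h : dist x x₀ < r
        · have h1 := hψin x h
          rcases max_choice (u x) (χ x) with h2 | h2
          · rw [h1, h2]
          · exact absurd ⟨h, h1.trans h2⟩ hcase
        · exact if_neg h
      refine hu.2 θ hθ x hx ?_
      filter_upwards [hm] with z hz
      have h1 : u z ≤ ψ z := by
        by_cases h : dist z x₀ < r
        · rw [hψin z h]; exact le_max_left _ _
        · exact (if_neg h).ge
      rw [hxu] at hz
      linarith
  · rw [hψin x₀ (mem_ball_self hr0), hχ0]
    exact lt_of_lt_of_le (by linarith) (le_max_right _ _)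
  · have hlt' : ∀ᶠ z in 𝓝[closure Ω] x₀, u z < χ z :=
      Tendsto.eventually_lt (hu.1 x₀ hx₀).tendsto hχ.continuous.continuousWithinAt.tendsto
        (by rw [hχ0]; linarith)
    obtain ⟨s', hs', hsb'⟩ := Metric.mem_nhdsWithin_iff.1 hlt'
    refine ⟨ball x₀ (min s' r), isOpen_ball, mem_ball_self (by positivity), l - l', by linarith,
      fun θ hθ x hx hm => ?_⟩
    have hxr : dist x x₀ < r := lt_of_lt_of_le hx.2 (min_le_right _ _)
    have hxs : u x < χ x := hsb' ⟨ball_subset_ball (min_le_left _ _) hx.2,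
      subset_closure hx.1⟩
    have hxψ : ψ x = χ x := by rw [hψin x hxr]; exact max_eq_right hxs.le
    have hm' : IsLocalMaxOn (fun z => ψ z - θ z) Ω x := by
      have := hm
      rwa [IsLocalMaxOn, IsMaxFilter,
        nhdsWithin_inter_of_mem' (nhdsWithin_le_nhds (isOpen_ball.mem_nhds hx.2))] at this
    linarith [htest θ hθ x hx.1 hxr hxψ hm']

/-- Away from the Aubry set the distance fails to be a supersolution; by maximality it can fail only
at its vertex, near which it can be replaced by a strict subsolution. -/
theorem exists_strict_near_of_notMem_aubrySet (hΩ : IsOpen Ω)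
    (hcon : IsConnected Ω) (hcone : HasInteriorCone Ω) (hH : IsConvexCoercive Ω H) {l : ℝ}
    (hne : ∃ W, IsSubsol Ω H l W) {y : Space N} (hy : y ∈ closure Ω) (hyA : y ∉ aubrySet Ω H l) :
    ∃ ψ, IsSubsol Ω H l ψ ∧ ∃ U, IsOpen U ∧ y ∈ U ∧ ∃ δ > 0,
      IsViscositySubsolution H (Ω ∩ U) (l - δ) ψ := by
  have hd := isSubsol_hjDist hΩ hcon hcone hH hne hy
  have hnot : ¬ IsViscositySupersolution H (closure Ω) l fun x => hjDist Ω H l x y :=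
    fun h => hyA ⟨hy, hd.1, h⟩
  simp only [IsViscositySupersolution, not_forall] at hnot
  obtain ⟨φ, hφ, x₀, hx₀, hmin, hlt⟩ := hnot
  rw [not_le] at hlt
  by_cases hxy : x₀ = y
  · subst hxy
    obtain ⟨ψ, hψ, -, -, h⟩ := exists_raised_subsol hΩ hH hx₀ hd hφ hmin hlt one_pos
    exact ⟨ψ, hψ, h⟩
  · exfalso
    obtain ⟨ψ, hψ, hgt, hout, -⟩ := exists_raised_subsol hΩ hH hx₀ hd hφ hmin hlt
      (ρ := dist y x₀) (dist_pos.2 (Ne.symm hxy))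
    have h1 := sub_le_hjDist hΩ hcon hcone hH hx₀ hy hψ
    rw [hout y le_rfl, hjDist_self hne] at h1
    linarith

/-- Averaging finitely many local constructions gives one subsolution which is strict near a given
compact set disjoint from the Aubry set. -/
theorem exists_strict_near_compact (hΩ : IsOpen Ω)
    (hcon : IsConnected Ω) (hcone : HasInteriorCone Ω) (hH : IsConvexCoercive Ω H) {l : ℝ}
    (hne : ∃ W, IsSubsol Ω H l W) {K : Set (Space N)} (hK : IsCompact K) (hKΩ : K ⊆ closure Ω)
    (hKA : Disjoint K (aubrySet Ω H l)) :
    ∃ ψ, IsSubsol Ω H l ψ ∧ ∃ U, IsOpen U ∧ K ⊆ U ∧ ∃ δ > 0,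
      IsViscositySubsolution H (Ω ∩ U) (l - δ) ψ := by
  refine hK.induction_on (p := fun K => ∃ ψ, IsSubsol Ω H l ψ ∧ ∃ U, IsOpen U ∧ K ⊆ U ∧ ∃ δ > 0,
      IsViscositySubsolution H (Ω ∩ U) (l - δ) ψ) ?_ ?_ ?_ ?_
  · obtain ⟨W, hW⟩ := hne
    exact ⟨W, hW, ∅, isOpen_empty, subset_rfl, 1, one_pos, fun _ _ x hx => absurd hx.2 id⟩
  · rintro s t hst ⟨ψ, hψ, U, hU, htU, h⟩
    exact ⟨ψ, hψ, U, hU, hst.trans htU, h⟩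
  · rintro s t ⟨ψ₁, hψ₁, U₁, hU₁, hs, δ₁, hδ₁, h₁⟩ ⟨ψ₂, hψ₂, U₂, hU₂, ht, δ₂, hδ₂, h₂⟩
    have hc₁ := hψ₁.1.mono (subset_closure (s := Ω))
    have hc₂ := hψ₂.1.mono (subset_closure (s := Ω))
    have hhalf : (0 : ℝ) < 1 / 2 ∧ (1 / 2 : ℝ) < 1 := by norm_num
    refine ⟨fun x => 1 / 2 * ψ₁ x + (1 - 1 / 2) * ψ₂ x, ⟨?_, ?_⟩, U₁ ∪ U₂, hU₁.union hU₂,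
      union_subset_union hs ht, 1 / 2 * min δ₁ δ₂, by positivity, ?_⟩
    · exact (continuousOn_const.mul hψ₁.1).add (continuousOn_const.mul hψ₂.1)
    · have := hψ₁.2.convex_combination hH hΩ subset_rfl hhalf.1 hhalf.2 hc₁ hc₂ hψ₂.2
      exact this.mono subset_rfl hΩ (by linarith)
    · have e₁ := h₁.convex_combination hH (hΩ.inter hU₁) inter_subset_left hhalf.1 hhalf.2
        (hc₁.mono inter_subset_left) (hc₂.mono inter_subset_left)
        (hψ₂.2.mono inter_subset_left (hΩ.inter hU₁) le_rfl)
      have e₂ := (hψ₁.2.mono inter_subset_left (hΩ.inter hU₂) le_rfl).convex_combination hH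
        (hΩ.inter hU₂) inter_subset_left hhalf.1 hhalf.2
        (hc₁.mono inter_subset_left) (hc₂.mono inter_subset_left) h₂
      rw [inter_union_distrib_left]
      exact (e₁.mono subset_rfl (hΩ.inter hU₁) (by linarith [min_le_left δ₁ δ₂])).union
        (e₂.mono subset_rfl (hΩ.inter hU₂) (by linarith [min_le_right δ₁ δ₂]))
  · intro y hy
    obtain ⟨ψ, hψ, U, hU, hyU, h⟩ := exists_strict_near_of_notMem_aubrySet hΩ hcon hcone hH hne
      (hKΩ hy) (disjoint_left.1 hKA hy)
    exact ⟨U, nhdsWithin_le_nhds (hU.mem_nhds hyU), ψ, hψ, U, hU, subset_rfl, h⟩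

/-! ### The ergodic problem -/

/-- Comparison up to the boundary: the difference of a subsolution and a state constraint
supersolution has no maximum where the subsolution is strict. -/
lemma exists_sub_lt_of_strict (hΩ : IsOpen Ω) (hbd : Bornology.IsBounded Ω)
    (hcone : HasInteriorCone Ω) (hH : IsConvexCoercive Ω H)
    {l δ : ℝ} {w v : Space N → ℝ} {U : Set (Space N)} {x₀ : Space N} (hU : IsOpen U) (hδ : 0 < δ)
    (hw : IsSubsol Ω H l w) (hwU : IsViscositySubsolution H (Ω ∩ U) (l - δ) w)
    (hv : IsSupersol Ω H l v) (hx₀ : x₀ ∈ closure Ω) (hx₀U : x₀ ∈ U) :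
    ∃ z ∈ closure Ω, w x₀ - v x₀ < w z - v z := by
  by_contra hcon
  push Not at hcon
  obtain ⟨n, r₀, hr₀, c, hc, hcone⟩ := hcone x₀ hx₀
  obtain ⟨r₁, hr₁, L, -, hL⟩ := exists_lipschitz_near hΩ (by assumption) hH l hx₀
  obtain ⟨r₂, hr₂, hr₂U⟩ := Metric.isOpen_iff.1 hU x₀ hx₀U
  set r : ℝ := min r₀ (min (r₁ / 2) r₂) with hr
  have hr0 : 0 < r := by positivity
  have h0 : r ≤ r₀ := min_le_left _ _
  have h1 : r ≤ r₁ / 2 := (min_le_right _ _).trans (min_le_left _ _)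
  have h2 : r ≤ r₂ := (min_le_right _ _).trans (min_le_right _ _)
  have hsub : closure Ω ∩ closedBall x₀ r ⊆ closure Ω ∩ ball x₀ r₁ :=
    inter_subset_inter_right _ (closedBall_subset_ball (by linarith))
  have hHc : ∀ p, ContinuousWithinAt (uncurry H) (univ ×ˢ closure Ω) (p, x₀) :=
    fun p => hH.cont _ ⟨mem_univ _, hx₀⟩
  obtain ⟨p, hp1, hp2⟩ := exists_le_and_le_of_isMax_sub (F := H) (G := H) hx₀ hr0 hc subset_closure
    (hbd.isCompact_closure.inter_right isClosed_closedBall)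
    (fun y hy hyr t ht htr w hw => hcone y hy (hyr.trans h0) t ht (htr.trans h0) w hw)
    (fun x hx y hy => hL w hw x (hsub hx) y (hsub hy)) (hw.1.mono inter_subset_left)
    (hv.1.mono inter_subset_left) (fun z hz => hcon z hz.1) hHc hHc
    (hwU.mono (inter_subset_inter_right _ ((ball_subset_ball h2).trans hr₂U))
      (hΩ.inter isOpen_ball) le_rfl) (hv.2.inter_open isOpen_ball)
  linarith

/-- Two solutions differ most on the Aubry set. -/
theorem exists_isMaxOn_aubrySet (hΩ : IsOpen Ω) (hbd : Bornology.IsBounded Ω)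
    (hcon : IsConnected Ω) (hcone : HasInteriorCone Ω) (hH : IsConvexCoercive Ω H) {l : ℝ}
    {W₁ W₂ : Space N → ℝ} (h₁ : IsSubsol Ω H l W₁) (h₂ : IsSupersol Ω H l W₂) :
    ∃ x ∈ aubrySet Ω H l, ∀ z ∈ closure Ω, W₁ z - W₂ z ≤ W₁ x - W₂ x := by
  have hK : IsCompact (closure Ω) := hbd.isCompact_closure
  have hne := hcon.nonempty.mono (subset_closure (s := Ω))
  have hfc : ContinuousOn (fun z => W₁ z - W₂ z) (closure Ω) := h₁.1.sub h₂.1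
  obtain ⟨m, hm, hmax⟩ := hK.exists_isMaxOn hne hfc
  have hmax' : ∀ z ∈ closure Ω, W₁ z - W₂ z ≤ W₁ m - W₂ m := fun z hz => hmax hz
  set M := W₁ m - W₂ m with hM
  let Z : Set (Space N) := closure Ω ∩ (fun z => W₁ z - W₂ z) ⁻¹' Ici M
  have hZ : IsCompact Z := hK.of_isClosed_subset
    (hfc.preimage_isClosed_of_isClosed isClosed_closure isClosed_Ici) inter_subset_left
  by_contra hcontra
  push Not at hcontra
  have hZA : Disjoint Z (aubrySet Ω H l) := by
    rw [disjoint_left]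
    intro z hz hzA
    obtain ⟨w, hw, hlt⟩ := hcontra z hzA
    have h3 : M ≤ W₁ z - W₂ z := hz.2
    linarith [hmax' w hw]
  obtain ⟨ψ, hψ, U, hU, hZU, δ, hδ, hstrict⟩ := exists_strict_near_compact hΩ hcon hcone hH
    ⟨W₁, h₁⟩ hZ inter_subset_left hZA
  -- off `U` the difference stays below its maximum
  obtain ⟨η, hη, hηM⟩ : ∃ η > 0, ∀ z ∈ closure Ω \ U, W₁ z - W₂ z ≤ M - η := by
    rcases (closure Ω \ U).eq_empty_or_nonempty with he | hne'
    · exact ⟨1, one_pos, by simp [he]⟩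
    · obtain ⟨q, hq, hqm⟩ := (hK.diff hU).exists_isMaxOn hne' (hfc.mono sdiff_subset)
      refine ⟨M - (W₁ q - W₂ q), ?_, fun z hz => ?_⟩
      · rw [gt_iff_lt, sub_pos]
        by_contra hge
        exact hq.2 (hZU ⟨hq.1, not_lt.1 hge⟩)
      · have : W₁ z - W₂ z ≤ W₁ q - W₂ q := hqm hz
        linarith
  obtain ⟨B, hB⟩ := hK.exists_bound_of_continuousOn (hψ.1.sub h₁.1)
  have hB' : ∀ z ∈ closure Ω, |ψ z - W₁ z| ≤ B := hB
  have hB0 : 0 ≤ B := (abs_nonneg _).trans (hB' m hm)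
  -- the weight of the strict subsolution is too small to move the maximum out of `U`
  obtain ⟨θ, hθ0, hθ1, hθB⟩ : ∃ θ : ℝ, 0 < θ ∧ θ < 1 ∧ 2 * θ * B < η := by
    have hpos : 0 < η / (2 * B + η + 1) := by positivity
    refine ⟨η / (2 * B + η + 1), hpos, ?_, ?_⟩
    · rw [div_lt_one (by positivity)]; linarith
    · have : 2 * (η / (2 * B + η + 1)) * B = η * (2 * B / (2 * B + η + 1)) := by ring
      rw [this]
      have h3 : 2 * B / (2 * B + η + 1) < 1 := by rw [div_lt_one (by positivity)]; linarith
      nlinarith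
  let w : Space N → ℝ := fun x => θ * ψ x + (1 - θ) * W₁ x
  have hwΩ : IsSubsol Ω H l w := by
    refine ⟨(continuousOn_const.mul hψ.1).add (continuousOn_const.mul h₁.1), ?_⟩
    have := hψ.2.convex_combination hH hΩ subset_rfl hθ0 hθ1 (hψ.1.mono subset_closure)
      (h₁.1.mono subset_closure) h₁.2
    exact this.mono subset_rfl hΩ (by linarith)
  have hwU : IsViscositySubsolution H (Ω ∩ U) (l - θ * δ) w := by
    have := hstrict.convex_combination hH (hΩ.inter hU) inter_subset_left hθ0 hθ1
      (hψ.1.mono (inter_subset_left.trans subset_closure))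
      (h₁.1.mono (inter_subset_left.trans subset_closure))
      (h₁.2.mono inter_subset_left (hΩ.inter hU) le_rfl)
    exact this.mono subset_rfl (hΩ.inter hU) (by linarith)
  obtain ⟨q, hq, hqmax⟩ := hK.exists_isMaxOn hne (hwΩ.1.sub h₂.1)
  have hqmax' : ∀ z ∈ closure Ω, w z - W₂ z ≤ w q - W₂ q := fun z hz => hqmax hz
  have hqU : q ∈ U := by
    by_contra hqU
    have h3 := hηM q ⟨hq, hqU⟩
    have h4 := hqmax' m hm
    have h5 := abs_le.1 (hB' m hm)
    have h6 := abs_le.1 (hB' q hq)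
    have e : ∀ z, w z = W₁ z + θ * (ψ z - W₁ z) := fun z => by simp only [w]; ring
    rw [e, e] at h4
    nlinarith [mul_le_mul_of_nonneg_left h5.1 hθ0.le, mul_le_mul_of_nonneg_left h6.2 hθ0.le]
  obtain ⟨z, hz, hlt⟩ := exists_sub_lt_of_strict hΩ hbd hcone hH hU (mul_pos hθ0 hδ) hwΩ hwU h₂ hq
    hqU
  linarith [hqmax' z hz]

/-- A subsolution strict on all of `closure Ω` would contradict the minimality of the eigenvalue. -/
theorem nonempty_aubrySet (hΩ : IsOpen Ω) (hbd : Bornology.IsBounded Ω)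
    (hcon : IsConnected Ω) (hcone : HasInteriorCone Ω) (hH : IsConvexCoercive Ω H) :
    (aubrySet Ω H (additiveEigenvalue Ω H)).Nonempty := by
  by_contra hempty
  rw [not_nonempty_iff_eq_empty] at hempty
  obtain ⟨ψ, hψ, U, hU, hKU, δ, hδ, hstrict⟩ := exists_strict_near_compact hΩ hcon hcone hH
    (exists_isSubsol_additiveEigenvalue hΩ hbd hcon hcone hH) hbd.isCompact_closure subset_rfl
    (by rw [hempty]; exact disjoint_empty _)
  rw [inter_eq_self_of_subset_left (subset_closure.trans hKU)] at hstrict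
  have : additiveEigenvalue Ω H ≤ additiveEigenvalue Ω H - δ :=
    csInf_le (bddBelow_subsol hΩ hbd hcon.nonempty hH) ⟨ψ, hψ.1, hstrict⟩
  linarith

/-- Existence for the ergodic problem with state constraints, and the criterion for uniqueness up
to constants, for a convex coercive Hamiltonian. -/
theorem ergodic_of_isConvexCoercive (hΩ : IsOpen Ω) (hbd : Bornology.IsBounded Ω)
    (hcon : IsConnected Ω) (hcone : HasInteriorCone Ω) (hH : IsConvexCoercive Ω H)
    {l : ℝ} (hl : l = additiveEigenvalue Ω H) :
    (∃ W : Space N → ℝ, IsErgodicSolution Ω H l W) ∧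
    ((∀ W₁ W₂ : Space N → ℝ, IsErgodicSolution Ω H l W₁ → IsErgodicSolution Ω H l W₂ →
        ∃ k : ℝ, ∀ x ∈ closure Ω, W₂ x = W₁ x + k) ↔
      ∀ x ∈ aubrySet Ω H l, ∀ y ∈ aubrySet Ω H l, symmDist Ω H l x y = 0) := by
  have hne : ∃ W, IsSubsol Ω H l W := by
    rw [hl]; exact exists_isSubsol_additiveEigenvalue hΩ hbd hcon hcone hH
  have hsol : ∀ y ∈ aubrySet Ω H l, IsErgodicSolution Ω H l fun x => hjDist Ω H l x y :=
    fun y hy => ⟨isSubsol_hjDist hΩ hcon hcone hH hne hy.1, hy.2⟩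
  have hd : ∀ W, IsErgodicSolution Ω H l W → ∀ x ∈ aubrySet Ω H l, ∀ y ∈ aubrySet Ω H l,
      W x - W y ≤ hjDist Ω H l x y := fun W hW x hx y hy =>
    sub_le_hjDist hΩ hcon hcone hH hx.1 hy.1 hW.1
  refine ⟨?_, fun huniq x hx y hy => ?_, fun hS W₁ W₂ h₁ h₂ => ?_⟩
  · obtain ⟨y, hy⟩ := nonempty_aubrySet hΩ hbd hcon hcone hH
    rw [← hl] at hy
    exact ⟨_, hsol y hy⟩
  · obtain ⟨k, hk⟩ := huniq _ _ (hsol x hx) (hsol y hy)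
    have h1 := hk x hx.1
    have h2 := hk y hy.1
    rw [hjDist_self hne] at h1 h2
    rw [symmDist]
    linarith
  · -- on the Aubry set every solution has the same increments
    have hinc : ∀ x ∈ aubrySet Ω H l, ∀ y ∈ aubrySet Ω H l, W₁ x - W₁ y = W₂ x - W₂ y := by
      intro x hx y hy
      have h3 := hS x hx y hy
      rw [symmDist] at h3
      linarith [hd W₁ h₁ x hx y hy, hd W₁ h₁ y hy x hx, hd W₂ h₂ x hx y hy, hd W₂ h₂ y hy x hx]
    obtain ⟨x, hx, hxm⟩ := exists_isMaxOn_aubrySet hΩ hbd hcon hcone hH h₁.1 h₂.2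
    obtain ⟨y, hy, hym⟩ := exists_isMaxOn_aubrySet hΩ hbd hcon hcone hH h₂.1 h₁.2
    refine ⟨W₂ x - W₁ x, fun z hz => ?_⟩
    linarith [hxm z hz, hym z hz, hinc x hx y hy]

end Ergodic

section Periodic
open Filter Topology Metric Function
open scoped NNReal RealInnerProductSpace

variable {N : ℕ}

/-! ### Periodic functions and the coefficients -/

/-- The closed periodicity cell `[0,1]^N`. -/
def closedCell (N : ℕ) : Set (Space N) := {y | ∀ i, y i ∈ Icc (0 : ℝ) 1}

lemma isCompact_closedCell : IsCompact (closedCell N) := by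
  have h : closedCell N
      = (PiLp.homeomorph 2 fun _ : Fin N => ℝ) ⁻¹' (univ.pi fun _ => Icc 0 1) := by
    ext y
    simp [closedCell, PiLp.homeomorph, Pi.le_def, forall_and]
  rw [h]
  exact ((PiLp.homeomorph 2 fun _ : Fin N => ℝ).isCompact_preimage).2
    (isCompact_univ_pi fun _ => isCompact_Icc)

lemma nonempty_closedCell : (closedCell N).Nonempty := ⟨0, fun i => by simp⟩

lemma IsYPeriodic.add_int {F : Type*} {f : Space N → F} (hf : IsYPeriodic f) (k : Fin N → ℤ)
    (y : Space N) : f (y + ∑ i, k i • EuclideanSpace.single i (1 : ℝ)) = f y := by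
  let S : AddSubgroup (Space N) :=
    { carrier := {v | ∀ y, f (y + v) = f y}
      zero_mem' := fun y => by simp
      add_mem' := fun {a b} ha hb y => by rw [← add_assoc, hb, ha]
      neg_mem' := fun {a} ha y => by rw [← ha (y + -a)]; simp }
  have : ∑ i, k i • EuclideanSpace.single i (1 : ℝ) ∈ S :=
    S.sum_mem fun i _ => S.zsmul_mem (show EuclideanSpace.single i (1 : ℝ) ∈ S from hf i) (k i)
  exact this y

/-- Every point has a representative in the closed cell. -/
lemma exists_mem_closedCell (y : Space N) : ∃ k : Fin N → ℤ,
    y + ∑ i, k i • EuclideanSpace.single i (1 : ℝ) ∈ closedCell N := by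
  refine ⟨fun i => -⌊y i⌋, fun j => ?_⟩
  have h : (∑ i, (-⌊y i⌋) • EuclideanSpace.single i (1 : ℝ) : Space N) j = -(⌊y j⌋ : ℝ) := by
    simp [Finset.sum_apply, Pi.single_apply]
  rw [PiLp.add_apply, h]
  constructor <;> linarith [Int.floor_le (y j), Int.lt_floor_add_one (y j)]

lemma IsYPeriodic.exists_mem_closedCell_eq {F : Type*} {f : Space N → F} (hf : IsYPeriodic f)
    (y : Space N) : ∃ z ∈ closedCell N, f z = f y := by
  obtain ⟨k, hk⟩ := exists_mem_closedCell y
  exact ⟨_, hk, hf.add_int k y⟩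

lemma IsYPeriodic.exists_max {f : Space N → ℝ} (hf : IsYPeriodic f) (hc : Continuous f) :
    ∃ y ∈ closedCell N, ∀ z, f z ≤ f y := by
  obtain ⟨y, hy, hmax⟩ := isCompact_closedCell.exists_isMaxOn nonempty_closedCell hc.continuousOn
  refine ⟨y, hy, fun z => ?_⟩
  obtain ⟨w, hw, hwz⟩ := hf.exists_mem_closedCell_eq z
  rw [← hwz]
  exact hmax hw

variable {Ω : Set (Space N)} {a : Space N → Space N → Matrix (Fin N) (Fin N) ℝ}
  {b : Space N → Space N → Space N} {c : Space N → Space N → ℝ}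

lemma StandingAssumptions.cont_a (h : StandingAssumptions Ω a b c) (i j : Fin N) :
    ContinuousOn (fun z : Space N × Space N => a z.1 z.2 i j) (closure Ω ×ˢ univ) :=
  (h.a_C1 i j).continuousOn

lemma StandingAssumptions.cont_b (h : StandingAssumptions Ω a b c) (i : Fin N) :
    ContinuousOn (fun z : Space N × Space N => b z.1 z.2 i) (closure Ω ×ˢ univ) :=
  (EuclideanSpace.proj (𝕜 := ℝ) i).continuous.comp_continuousOn h.b_C1.continuousOn

/-- The Hamiltonian is continuous in all its arguments jointly. -/
lemma StandingAssumptions.cont_micro (h : StandingAssumptions Ω a b c) :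
    ContinuousOn (fun z : Space N × Space N × Space N => microHamiltonian a b c z.1 z.2.1 z.2.2)
      (univ ×ˢ closure Ω ×ˢ univ) := by
  have hm : MapsTo (fun z : Space N × Space N × Space N => z.2) (univ ×ˢ closure Ω ×ˢ univ)
      (closure Ω ×ˢ univ) := fun z hz => hz.2
  unfold microHamiltonian
  refine ContinuousOn.add (ContinuousOn.sub ?_ ?_) ?_
  · refine continuousOn_finsetSum _ fun i _ => continuousOn_finsetSum _ fun j _ => ?_
    exact (((h.cont_a i j).comp continuousOn_snd hm).mul (by fun_prop)).mul (by fun_prop)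
  · refine continuousOn_finsetSum _ fun i _ => ?_
    exact ((h.cont_b i).comp continuousOn_snd hm).mul (by fun_prop)
  · exact h.c_C1.continuousOn.comp continuousOn_snd hm

lemma StandingAssumptions.periodic_micro (h : StandingAssumptions Ω a b c) (p : Space N)
    {x : Space N} (hx : x ∈ closure Ω) : IsYPeriodic (microHamiltonian a b c p x) := by
  intro i y
  simp only [microHamiltonian]
  rw [h.a_periodic x hx i y, h.b_periodic x hx i y, h.c_periodic x hx i y]

/-- A function continuous on `closure Ω × ℝ^N` and periodic in `y` is bounded. -/
lemma exists_bound_of_periodic (hbd : Bornology.IsBounded Ω) {E : Type*} [NormedAddCommGroup E]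
    {f : Space N → Space N → E} (hf : ContinuousOn (uncurry f) (closure Ω ×ˢ univ))
    (hper : ∀ x ∈ closure Ω, IsYPeriodic (f x)) :
    ∃ C, 0 ≤ C ∧ ∀ x ∈ closure Ω, ∀ y, ‖f x y‖ ≤ C := by
  obtain ⟨C, hC⟩ := (hbd.isCompact_closure.prod (isCompact_closedCell (N := N))
    ).exists_bound_of_continuousOn (hf.mono (prod_mono subset_rfl (subset_univ _)))
  refine ⟨max C 0, le_max_right _ _, fun x hx y => ?_⟩
  obtain ⟨z, hz, hzy⟩ := (hper x hx).exists_mem_closedCell_eq y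
  rw [← hzy]
  exact (hC (x, z) ⟨hx, hz⟩).trans (le_max_left _ _)

lemma StandingAssumptions.exists_lower (h : StandingAssumptions Ω a b c) :
    ∃ m > 0, ∃ A, 0 ≤ A ∧ ∀ p, ∀ x ∈ closure Ω, ∀ y,
      m * ‖p‖ ^ 2 - A * ‖p‖ - A ≤ microHamiltonian a b c p x y := by
  obtain ⟨m, hm, hell⟩ := h.elliptic
  obtain ⟨B, hB0, hB⟩ := exists_bound_of_periodic h.isBounded (f := b)
    h.b_C1.continuousOn h.b_periodic
  obtain ⟨C, hC0, hC⟩ := exists_bound_of_periodic h.isBounded (f := c)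
    h.c_C1.continuousOn h.c_periodic
  refine ⟨m, hm, max B C, le_max_of_le_left hB0, fun p x hx y => ?_⟩
  have h1 := hell x hx y p
  have h2 : ∑ j, b x y j * p j ≤ max B C * ‖p‖ := by
    have : ∑ j, b x y j * p j = ⟪p, b x y⟫ := by
      simp [PiLp.inner_apply]
    rw [this]
    refine (real_inner_le_norm _ _).trans ?_
    rw [mul_comm]
    exact mul_le_mul_of_nonneg_right ((hB x hx y).trans (le_max_left _ _)) (norm_nonneg _)
  have h3 := (abs_le.1 (hC x hx y)).1
  have h4 := le_max_right B C
  simp only [microHamiltonian]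
  linarith

lemma StandingAssumptions.convex_micro (h : StandingAssumptions Ω a b c) {x : Space N}
    (hx : x ∈ closure Ω) (y : Space N) :
    ConvexOn ℝ univ fun p => microHamiltonian a b c p x y := by
  obtain ⟨m, hm, hell⟩ := h.elliptic
  refine ⟨convex_univ, fun p _ q _ s t hs ht hst => ?_⟩
  have h0 : 0 ≤ s * t * ∑ i, ∑ j, a x y i j * (p - q) i * (p - q) j :=
    mul_nonneg (mul_nonneg hs ht) (le_trans (by positivity) (hell x hx y (p - q)))
  obtain rfl : s = 1 - t := by linarith
  have h1 : (1 - t) * (∑ i, ∑ j, a x y i j * p i * p j) + t * (∑ i, ∑ j, a x y i j * q i * q j)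
      - ∑ i, ∑ j, a x y i j * ((1 - t) • p + t • q) i * ((1 - t) • p + t • q) j
      = (1 - t) * t * ∑ i, ∑ j, a x y i j * (p - q) i * (p - q) j := by
    simp only [Finset.mul_sum, ← Finset.sum_add_distrib, ← Finset.sum_sub_distrib]
    refine Finset.sum_congr rfl fun i _ => Finset.sum_congr rfl fun j _ => ?_
    simp only [PiLp.add_apply, PiLp.sub_apply, PiLp.smul_apply, smul_eq_mul]
    ring
  have h2 : ∑ j, b x y j * ((1 - t) • p + t • q) j
      = (1 - t) * (∑ j, b x y j * p j) + t * ∑ j, b x y j * q j := by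
    simp only [Finset.mul_sum, ← Finset.sum_add_distrib]
    refine Finset.sum_congr rfl fun j _ => ?_
    simp only [PiLp.add_apply, PiLp.smul_apply, smul_eq_mul]
    ring
  simp only [microHamiltonian, smul_eq_mul]
  rw [h2]
  linarith

/-- Coercivity of any function of `(p, x)` which dominates the minimum of the Hamiltonian over the
cell. -/
lemma StandingAssumptions.coercive_of_lower (h : StandingAssumptions Ω a b c)
    {H : Space N → Space N → ℝ} (hlow : ∀ x ∈ closure Ω, ∀ p B,
      (∀ y, B ≤ microHamiltonian a b c p x y) → B ≤ H p x) (l : ℝ) :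
    ∃ R : ℝ, 0 ≤ R ∧ ∀ x ∈ closure Ω, ∀ p, H p x ≤ l → ‖p‖ ≤ R := by
  obtain ⟨m, hm, A, hA, hmA⟩ := h.exists_lower
  refine ⟨max 1 ((|l| + 2 * A) / m), by positivity, fun x hx p hp => ?_⟩
  have h1 := (hlow x hx p _ fun y => hmA p x hx y).trans hp
  by_contra hcon
  rw [not_le, max_lt_iff, div_lt_iff₀ hm] at hcon
  nlinarith [le_abs_self l, abs_nonneg l, hcon.1, hcon.2]

lemma StandingAssumptions.coercive_micro (h : StandingAssumptions Ω a b c) (l : ℝ) :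
    ∃ R : ℝ, 0 ≤ R ∧ ∀ x ∈ closure Ω, ∀ p y, microHamiltonian a b c p x y ≤ l → ‖p‖ ≤ R := by
  obtain ⟨m, hm, A, hA, hmA⟩ := h.exists_lower
  refine ⟨max 1 ((|l| + 2 * A) / m), by positivity, fun x hx p y hp => ?_⟩
  have h1 := (hmA p x hx y).trans hp
  by_contra hcon
  rw [not_le, max_lt_iff, div_lt_iff₀ hm] at hcon
  nlinarith [le_abs_self l, abs_nonneg l, hcon.1, hcon.2]

/-- Uniform continuity along a compact set of parameters. -/
lemma eventually_forall_abs_sub_lt {X Y : Type*} [TopologicalSpace X] [TopologicalSpace Y]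
    {f : X → Y → ℝ} {S : Set X} {K : Set Y} {x₀ : X} (hK : IsCompact K)
    (hf : ContinuousOn (uncurry f) (S ×ˢ K)) (hx₀ : x₀ ∈ S) {ε : ℝ} (hε : 0 < ε) :
    ∀ᶠ x in 𝓝[S] x₀, ∀ y ∈ K, |f x y - f x₀ y| < ε := by
  obtain ⟨v, hv, hvK⟩ := hK.mem_uniformity_of_prod hf hx₀ (Metric.dist_mem_uniformity hε)
  filter_upwards [hv] with x hx y hy
  exact hvK x hx y hy

end Periodic

section FirstOrderCell
open Filter Topology Metric Function

variable {N : ℕ} {Ω : Set (Space N)} {a : Space N → Space N → Matrix (Fin N) (Fin N) ℝ}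
  {b : Space N → Space N → Space N} {c : Space N → Space N → ℝ}

/-! ### The first order cell problem -/

/-- Comparison for periodic viscosity solutions: at a maximum of `u - v` a common gradient is
admissible for both Hamiltonians. -/
theorem exists_le_and_le_of_periodic {F G : Space N → Space N → ℝ} {lF lG R : ℝ}
    {u v : Space N → ℝ} (hF : Continuous (uncurry F)) (hG : Continuous (uncurry G)) (hR : 0 ≤ R)
    (hcoer : ∀ q y, F q y ≤ lF → ‖q‖ ≤ R) (hu : Continuous u) (hv : Continuous v)
    (hup : IsYPeriodic u) (hvp : IsYPeriodic v) (hsub : IsViscositySubsolution F univ lF u)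
    (hsup : IsViscositySupersolution G univ lG v) :
    ∃ q, ∃ y ∈ closedCell N, F q y ≤ lF ∧ lG ≤ G q y := by
  have hper : IsYPeriodic fun y => u y - v y := fun i y => by
    simp only [hup i y, hvp i y]
  obtain ⟨y, hy, hmax⟩ := hper.exists_max (hu.sub hv)
  obtain ⟨q, hq⟩ := exists_le_and_le_of_isMax_sub (F := F) (G := G) (D := univ) (E := univ)
    (x₀ := y) (n := 0) (r := 1) (c := 1) (L := R) (mem_univ y) one_pos one_pos subset_rfl
    (by rw [univ_inter]; exact isCompact_closedBall _ _) (fun _ _ _ _ _ _ _ _ => mem_univ _)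
    (fun z _ w _ => by
      have := sub_le_of_segment_subset isOpen_univ hR (fun x _ p => hcoer p x) hu.continuousOn hsub
        (subset_univ (segment ℝ w z))
      rwa [dist_comm] at this)
    hu.continuousOn hv.continuousOn (fun z _ => hmax z) (fun p => hF.continuousWithinAt)
    (fun p => hG.continuousWithinAt)
    (hsub.mono (subset_univ _) (isOpen_univ.inter isOpen_ball) le_rfl)
    (hsup.inter_open isOpen_ball)
  exact ⟨q, y, hy, hq⟩

lemma StandingAssumptions.cont_shifted (h : StandingAssumptions Ω a b c) (p : Space N)
    {x : Space N} (hx : x ∈ closure Ω) :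
    Continuous (uncurry fun q y => microHamiltonian a b c (p + q) x y) := by
  rw [← continuousOn_univ]
  exact h.cont_micro.comp (f := fun z : Space N × Space N => (p + z.1, x, z.2)) (by fun_prop)
    fun z _ => ⟨mem_univ _, hx, mem_univ _⟩

/-- Two ergodic constants are compared through a common gradient of the correctors. -/
lemma StandingAssumptions.ergodicConstant_compare (h : StandingAssumptions Ω a b c)
    {p p' x x' : Space N} (hx : x ∈ closure Ω) (hx' : x' ∈ closure Ω) {μ μ' : ℝ}
    (hμ : IsErgodicConstant a b c p x μ) (hμ' : IsErgodicConstant a b c p' x' μ') :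
    ∃ q, ∃ y ∈ closedCell N, microHamiltonian a b c (p + q) x y ≤ μ ∧
      μ' ≤ microHamiltonian a b c (p' + q) x' y := by
  obtain ⟨u, huc, hup, hu, -⟩ := hμ
  obtain ⟨v, hvc, hvp, -, hv⟩ := hμ'
  obtain ⟨R, hR, hcoer⟩ := h.coercive_micro μ
  refine exists_le_and_le_of_periodic (R := R + ‖p‖) (h.cont_shifted p hx) (h.cont_shifted p' hx')
    (by positivity) (fun q y hq => ?_) huc hvc hup hvp hu hv
  have h1 := hcoer x hx _ y hq
  have h2 := norm_sub_le (p + q) p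
  rw [add_sub_cancel_left] at h2
  linarith

/-- Continuity comes from comparing correctors for nearby data, convexity from comparing a convex
combination of correctors with the corrector of the convex combination. -/
theorem StandingAssumptions.isConvexCoercive_of_ergodicConstant (h : StandingAssumptions Ω a b c)
    {H : Space N → Space N → ℝ}
    (hH : ∀ x ∈ closure Ω, ∀ p, IsErgodicConstant a b c p x (H p x)) : IsConvexCoercive Ω H where
  cont := by
    rintro ⟨p₀, x₀⟩ ⟨-, hx₀⟩
    replace hx₀ : x₀ ∈ closure Ω := hx₀
    obtain ⟨R, hR, hcoer⟩ := h.coercive_micro (H p₀ x₀ + 1)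
    let K : Set (Space N × Space N) := closedBall 0 (R + (‖p₀‖ + 1)) ×ˢ closedCell N
    have hK : IsCompact K := (isCompact_closedBall _ _).prod isCompact_closedCell
    have hnear : ∀ ε > 0, ∀ᶠ z : Space N × Space N in 𝓝[univ ×ˢ closure Ω] (p₀, x₀),
        ∀ k ∈ K, |microHamiltonian a b c (z.1 + k.1) z.2 k.2
          - microHamiltonian a b c (p₀ + k.1) x₀ k.2| < ε := by
      intro ε hε
      let T : (Space N × Space N) × (Space N × Space N) → Space N × Space N × Space N :=
        fun w => (w.1.1 + w.2.1, w.1.2, w.2.2)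
      have hT : Continuous T := by fun_prop
      have hm : MapsTo T ((univ ×ˢ closure Ω) ×ˢ K) (univ ×ˢ closure Ω ×ˢ univ) :=
        fun w hw => ⟨mem_univ _, hw.1.2, mem_univ _⟩
      have hc : ContinuousOn (uncurry fun z k : Space N × Space N =>
          microHamiltonian a b c (z.1 + k.1) z.2 k.2) ((univ ×ˢ closure Ω) ×ˢ K) :=
        (h.cont_micro.comp hT.continuousOn hm).congr fun w _ => by
          simp only [uncurry, comp_apply, T]
      have hmem : ((p₀, x₀) : Space N × Space N) ∈ univ ×ˢ closure Ω := ⟨mem_univ _, hx₀⟩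
      exact eventually_forall_abs_sub_lt hK hc hmem hε
    have hup : ∀ ε, 0 < ε → ε ≤ 1 → ∀ᶠ z : Space N × Space N in 𝓝[univ ×ˢ closure Ω] (p₀, x₀),
        H z.1 z.2 ≤ H p₀ x₀ + ε := by
      intro ε hε hε1
      filter_upwards [hnear ε hε, self_mem_nhdsWithin] with z hz hzΩ
      obtain ⟨q, y, hy, h1, h2⟩ := h.ergodicConstant_compare hx₀ hzΩ.2 (hH x₀ hx₀ p₀)
        (hH z.2 hzΩ.2 z.1)
      have h3 := hcoer x₀ hx₀ _ y (h1.trans (by linarith))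
      have h4 := norm_sub_le (p₀ + q) p₀
      rw [add_sub_cancel_left] at h4
      have h5 := (abs_lt.1 (hz (q, y) ⟨by rw [mem_closedBall_zero_iff]; linarith, hy⟩)).2
      simp only at h5
      linarith
    have hball : ∀ᶠ z : Space N × Space N in 𝓝[univ ×ˢ closure Ω] (p₀, x₀), ‖z.1‖ < ‖p₀‖ + 1 :=
      nhdsWithin_le_nhds ((continuous_fst.norm.tendsto (p₀, x₀)).eventually_lt_const
        (show ‖p₀‖ < ‖p₀‖ + 1 by linarith))
    refine Metric.tendsto_nhds.2 fun ε hε => ?_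
    have hε' : 0 < min (ε / 2) 1 := by positivity
    filter_upwards [hnear (ε / 2) (by positivity), hup _ hε' (min_le_right _ _), hball,
      self_mem_nhdsWithin] with z hz hzup hzb hzΩ
    have h0 : H z.1 z.2 ≤ H p₀ x₀ + ε / 2 := hzup.trans (by linarith [min_le_left (ε / 2) 1])
    have h0' : H z.1 z.2 ≤ H p₀ x₀ + 1 := hzup.trans (by linarith [min_le_right (ε / 2) 1])
    obtain ⟨q, y, hy, h1, h2⟩ := h.ergodicConstant_compare hzΩ.2 hx₀ (hH z.2 hzΩ.2 z.1)
      (hH x₀ hx₀ p₀)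
    have h3 := hcoer z.2 hzΩ.2 _ y (h1.trans h0')
    have h4 := norm_sub_le (z.1 + q) z.1
    rw [add_sub_cancel_left] at h4
    have h5 := (abs_lt.1 (hz (q, y) ⟨by rw [mem_closedBall_zero_iff]; linarith, hy⟩)).1
    simp only at h5
    rw [Real.dist_eq, abs_lt]
    simp only [uncurry]
    constructor <;> linarith
  convex := by
    intro x hx
    refine ⟨convex_univ, fun p₁ _ p₂ _ s t hs ht hst => ?_⟩
    rcases hs.eq_or_lt with rfl | hs
    · obtain rfl : t = 1 := by linarith
      simp
    rcases ht.eq_or_lt with rfl | ht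
    · obtain rfl : s = 1 := by linarith
      simp
    obtain rfl : t = 1 - s := by linarith
    have hs1 : s < 1 := by linarith
    obtain ⟨u₁, hc₁, hp₁, hu₁, -⟩ := hH x hx p₁
    obtain ⟨u₂, hc₂, hp₂, hu₂, -⟩ := hH x hx p₂
    obtain ⟨v, hvc, hvp, -, hv⟩ := hH x hx (s • p₁ + (1 - s) • p₂)
    set p := s • p₁ + (1 - s) • p₂ with hp
    set μ := s * H p₁ x + (1 - s) * H p₂ x with hμ
    obtain ⟨R₁, hR₁, hcoer₁⟩ := h.coercive_micro (H p₁ x)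
    -- the convex combination of the correctors is a subsolution of the averaged problem
    have hsub : IsViscositySubsolution (fun q y => microHamiltonian a b c (p + q) x y) univ μ
        fun y => s * u₁ y + (1 - s) * u₂ y := by
      intro φ hφ y hy hm
      obtain ⟨q₁, q₂, hq, h1, h2⟩ := exists_convex_combination_of_isLocalMaxOn
        (L := R₁ + ‖p₁‖) isOpen_univ hy one_pos hs hs1 (fun z _ w _ => by
          have := sub_le_of_segment_subset (R := R₁ + ‖p₁‖) isOpen_univ (by positivity)
            (fun y _ q hq => by
              have h1 := hcoer₁ x hx _ y hq
              have h2 := norm_sub_le (p₁ + q) p₁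
              rw [add_sub_cancel_left] at h2
              linarith) hc₁.continuousOn hu₁ (subset_univ (segment ℝ w z))
          rwa [dist_comm] at this) hc₁.continuousOn hc₂.continuousOn
        (h.cont_shifted p₁ hx).continuousOn (h.cont_shifted p₂ hx).continuousOn hu₁ hu₂ hφ hm
      have h3 := (h.convex_micro hx y).2 (mem_univ (p₁ + q₁)) (mem_univ (p₂ + q₂)) hs.le ht.le hst
      have h4 : s • (p₁ + q₁) + (1 - s) • (p₂ + q₂) = p + gradient φ y := by
        rw [← hq, hp]; module
      rw [h4] at h3
      simp only [smul_eq_mul] at h3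
      nlinarith [mul_le_mul_of_nonneg_left h1 hs.le, mul_le_mul_of_nonneg_left h2 ht.le]
    obtain ⟨R, hR, hcoer⟩ := h.coercive_micro μ
    obtain ⟨q, y, -, h1, h2⟩ := exists_le_and_le_of_periodic (R := R + ‖p‖) (h.cont_shifted p hx)
      (h.cont_shifted p hx) (by positivity) (fun q y hq => by
        have h1 := hcoer x hx _ y hq
        have h2 := norm_sub_le (p + q) p
        rw [add_sub_cancel_left] at h2
        linarith) (by fun_prop) hvc (fun i y => by simp only [hp₁ i y, hp₂ i y]) hvp hsub hv
    exact h2.trans h1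
  coercive := by
    refine h.coercive_of_lower fun x hx p B hB => ?_
    obtain ⟨u, huc, hup, hu, -⟩ := hH x hx p
    obtain ⟨y, -, hmax⟩ := hup.exists_max huc
    -- at a maximum of the corrector the zero gradient is admissible
    have h1 := hu (fun _ => 0) contDiff_const y (mem_univ _)
      (Eventually.of_forall fun z => by simpa using hmax z)
    have h2 : gradient (fun _ : Space N => (0 : ℝ)) y = 0 := (hasGradientAt_const y 0).gradient
    simp only [h2, add_zero] at h1
    exact (hB y).trans h1

end FirstOrderCell

section SecondOrderCell
open Filter Topology Metric Function

variable {N : ℕ} {Ω : Set (Space N)} {a : Space N → Space N → Matrix (Fin N) (Fin N) ℝ}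
  {b : Space N → Space N → Space N} {c : Space N → Space N → ℝ}

/-! ### The second order cell problem -/

lemma ContDiff.pderiv {F : Type*} [NormedAddCommGroup F] [NormedSpace ℝ F] {f : Space N → F}
    {n m : WithTop ℕ∞} (hf : ContDiff ℝ n f) (hmn : m + 1 ≤ n) (i : Fin N) :
    ContDiff ℝ m (pderiv i f) :=
  (hf.fderiv_right hmn).clm_apply contDiff_const

/-- The derivative along a line in terms of the partial derivatives. -/
lemma hasDerivAt_line {f : Space N → ℝ} (hf : ContDiff ℝ 1 f) (y e : Space N) (t : ℝ) :
    HasDerivAt (fun t : ℝ => f (y + t • e)) (∑ i, e i * pderiv i f (y + t • e)) t := by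
  have h1 : HasDerivAt (fun t : ℝ => y + t • e) e t := by
    simpa using ((hasDerivAt_id t).smul_const e).const_add y
  have h2 := ((hf.differentiable (by norm_num)) (y + t • e)).hasFDerivAt.comp_hasDerivAt t h1
  have he : ∑ i, e i • EuclideanSpace.single i (1 : ℝ) = e := by
    ext j
    simp [Finset.sum_apply, Pi.single_apply]
  have h3 : fderiv ℝ f (y + t • e) e = ∑ i, e i * pderiv i f (y + t • e) := by
    conv_lhs => rw [← he, map_sum]
    simp only [map_smul, smul_eq_mul, pderiv, he]
  rw [← h3]
  exact h2

lemma pderiv_eq_gradient {f : Space N → ℝ} {y : Space N} (hf : DifferentiableAt ℝ f y) (i : Fin N) :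
    pderiv i f y = gradient f y i := by
  rw [_root_.pderiv, hf.hasGradientAt.fderiv_apply]
  rw [real_inner_comm, EuclideanSpace.inner_single_left, map_one, one_mul]

/-- At a minimum point the Hessian is nonnegative. -/
lemma sum_pderiv_pderiv_nonneg_of_isLocalMin {f : Space N → ℝ} (hf : ContDiff ℝ 2 f) {y : Space N}
    (hmin : IsLocalMin f y) (e : Space N) :
    0 ≤ ∑ i, ∑ j, e i * e j * pderiv i (pderiv j f) y := by
  let g : ℝ → ℝ := fun t => f (y + t • e)
  have hf1 : ContDiff ℝ 1 f := hf.of_le (by norm_num)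
  have hg' : deriv g = fun t => ∑ j, e j * pderiv j f (y + t • e) :=
    funext fun t => (hasDerivAt_line hf1 y e t).deriv
  have hg'' : deriv (deriv g) 0 = ∑ i, ∑ j, e i * e j * pderiv i (pderiv j f) y := by
    rw [hg']
    have h1 : HasDerivAt (fun t : ℝ => ∑ j, e j * pderiv j f (y + t • e))
        (∑ j, e j * ∑ i, e i * pderiv i (pderiv j f) (y + (0 : ℝ) • e)) 0 :=
      HasDerivAt.fun_sum fun j _ =>
        (hasDerivAt_line (hf.pderiv (by norm_num) j) y e 0).const_mul (e j)
    rw [h1.deriv, Finset.sum_comm]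
    refine Finset.sum_congr rfl fun i _ => ?_
    rw [zero_smul, add_zero, Finset.mul_sum]
    exact Finset.sum_congr rfl fun j _ => by ring
  rw [← hg'']
  have hline : Tendsto (fun t : ℝ => y + t • e) (𝓝 0) (𝓝 y) := by
    have : Continuous fun t : ℝ => y + t • e := by fun_prop
    simpa using this.tendsto 0
  have hgmin : IsLocalMin g 0 := by
    filter_upwards [hline.eventually hmin] with t ht
    simpa [g] using ht
  have hgc : Continuous g := by
    have := hf.continuous
    fun_prop
  -- a negative second derivative would make `0` also a local maximum, hence `g` locally constant
  by_contra hneg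
  have hgmax := isLocalMax_of_deriv_deriv_neg (not_le.1 hneg) hgmin.deriv_eq_zero hgc.continuousAt
  have hconst : g =ᶠ[𝓝 0] fun _ => g 0 := by
    filter_upwards [hgmin, hgmax] with t h1 h2 using le_antisymm h2 h1
  have h0 : deriv (deriv g) 0 = 0 := by
    rw [hconst.deriv.deriv_eq]
    simp
  exact hneg h0.ge

open scoped MatrixOrder Matrix.Norms.L2Operator in
lemma exists_eq_transpose_mul_self {A : Matrix (Fin N) (Fin N) ℝ} (hA : A.IsSymm)
    (hpos : ∀ ζ : Space N, 0 ≤ ∑ i, ∑ j, A i j * ζ i * ζ j) :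
    ∃ B : Matrix (Fin N) (Fin N) ℝ, A = Bᵀ * B := by
  have h : A.PosSemidef := by
    have hA' : A.IsHermitian := by
      rw [Matrix.IsHermitian, Matrix.conjTranspose_eq_transpose_of_trivial]
      exact hA
    refine .of_dotProduct_mulVec_nonneg hA' fun x => ?_
    have := hpos (WithLp.toLp 2 x)
    simp only [dotProduct, Matrix.mulVec, Finset.mul_sum, star_trivial]
    refine this.trans (le_of_eq ?_)
    exact Finset.sum_congr rfl fun i _ => Finset.sum_congr rfl fun j _ => by ring
  obtain ⟨B, hB⟩ := CStarAlgebra.nonneg_iff_eq_star_mul_self.mp h.nonneg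
  exact ⟨B, by rw [hB]; rfl⟩

/-- The maximum principle for the second order part. -/
lemma sum_mul_pderiv_pderiv_nonneg {A : Matrix (Fin N) (Fin N) ℝ} (hA : A.IsSymm)
    (hpos : ∀ ζ : Space N, 0 ≤ ∑ i, ∑ j, A i j * ζ i * ζ j) {f : Space N → ℝ} (hf : ContDiff ℝ 2 f)
    {y : Space N} (hmin : IsLocalMin f y) : 0 ≤ ∑ i, ∑ j, A i j * pderiv i (pderiv j f) y := by
  obtain ⟨B, rfl⟩ := exists_eq_transpose_mul_self hA hpos
  have h : ∑ i, ∑ j, (Bᵀ * B) i j * pderiv i (pderiv j f) y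
      = ∑ k, ∑ i, ∑ j, B k i * B k j * pderiv i (pderiv j f) y := by
    simp only [Matrix.mul_apply, Matrix.transpose_apply, Finset.sum_mul]
    calc _ = ∑ i, ∑ k, ∑ j, B k i * B k j * pderiv i (pderiv j f) y :=
          Finset.sum_congr rfl fun i _ => Finset.sum_comm
      _ = _ := Finset.sum_comm
  rw [h]
  exact Finset.sum_nonneg fun k _ =>
    sum_pderiv_pderiv_nonneg_of_isLocalMin hf hmin (WithLp.toLp 2 (B k))

/-- The operator `v ↦ a^{ij} ∂²v/∂y_i∂y_j + H(p - ∇v, x, y)`, satisfied by the logarithm of an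
eigenfunction of the cell operator. -/
noncomputable def logCellOperator (a : Space N → Space N → Matrix (Fin N) (Fin N) ℝ)
    (b : Space N → Space N → Space N) (c : Space N → Space N → ℝ) (p x : Space N)
    (v : Space N → ℝ) (y : Space N) : ℝ :=
  (∑ i, ∑ j, a x y i j * pderiv i (pderiv j v) y) + microHamiltonian a b c (p - gradient v y) x y

lemma cellOperator_exp (ha : ∀ x ∈ closure Ω, ∀ y, (a x y).IsSymm) (p : Space N) {x : Space N}
    (hx : x ∈ closure Ω) {v : Space N → ℝ} (hv : ContDiff ℝ 2 v) (y : Space N) :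
    cellOperator a b c p x (fun y => Real.exp (v y)) y
      = Real.exp (v y) * logCellOperator a b c p x v y := by
  have hvd : Differentiable ℝ v := hv.differentiable (by norm_num)
  have h1 : ∀ j, pderiv j (fun y => Real.exp (v y)) = fun y => Real.exp (v y) * pderiv j v y := by
    intro j
    ext y
    simp [pderiv, (hvd y).hasFDerivAt.exp.fderiv]
  have h2 : ∀ i j, pderiv i (pderiv j fun y => Real.exp (v y)) y
      = Real.exp (v y) * (pderiv i (pderiv j v) y + pderiv i v y * pderiv j v y) := by
    intro i j
    rw [h1]
    have hd : DifferentiableAt ℝ (pderiv j v) y :=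
      (hv.pderiv (m := 1) (by norm_num) j).differentiable (by norm_num) y
    have := ((hvd y).hasFDerivAt.exp.mul hd.hasFDerivAt).fderiv
    have h3 : fderiv ℝ (fun y => Real.exp (v y) * pderiv j v y) y = _ := this
    rw [pderiv, h3]
    simp only [add_apply, smul_apply, smul_eq_mul]
    simp only [pderiv]
    ring
  have hg : ∀ i, gradient v y i = pderiv i v y := fun i => (pderiv_eq_gradient (hvd y) i).symm
  simp only [cellOperator, logCellOperator, microHamiltonian, h2, PiLp.sub_apply, hg, smul_eq_mul]
  simp only [h1]
  have e1 : ∑ i, ∑ j, a x y i j * (p i - pderiv i v y) * (p j - pderiv j v y)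
      = (∑ i, ∑ j, a x y i j * p i * p j) - 2 * (∑ j, (∑ i, a x y i j * p i) * pderiv j v y)
        + ∑ i, ∑ j, a x y i j * (pderiv i v y * pderiv j v y) := by
    have e2 : ∑ j, (∑ i, a x y i j * p i) * pderiv j v y
        = ∑ i, ∑ j, a x y i j * p i * pderiv j v y := by
      rw [Finset.sum_comm]
      exact Finset.sum_congr rfl fun j _ => Finset.sum_mul _ _ _
    have e3 : ∑ j, (∑ i, a x y i j * p i) * pderiv j v y
        = ∑ i, ∑ j, a x y i j * pderiv i v y * p j := by
      refine Finset.sum_congr rfl fun i _ => ?_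
      rw [Finset.sum_mul]
      refine Finset.sum_congr rfl fun j _ => ?_
      rw [← (ha x hx y).apply i j]
      ring
    rw [two_mul]
    nth_rewrite 1 [e2]
    rw [e3]
    simp only [← Finset.sum_add_distrib, ← Finset.sum_sub_distrib]
    exact Finset.sum_congr rfl fun i _ => Finset.sum_congr rfl fun j _ => by ring
  have e4 : ∑ i, ∑ j, a x y i j * (Real.exp (v y) * (pderiv i (pderiv j v) y
        + pderiv i v y * pderiv j v y))
      = Real.exp (v y) * ((∑ i, ∑ j, a x y i j * pderiv i (pderiv j v) y)
        + ∑ i, ∑ j, a x y i j * (pderiv i v y * pderiv j v y)) := by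
    simp only [mul_add, Finset.mul_sum, ← Finset.sum_add_distrib]
    exact Finset.sum_congr rfl fun i _ => Finset.sum_congr rfl fun j _ => by ring
  have e5 : ∑ j, (b x y j - 2 * ∑ i, a x y i j * p i) * (Real.exp (v y) * pderiv j v y)
      = Real.exp (v y) * ((∑ j, b x y j * pderiv j v y)
        - 2 * ∑ j, (∑ i, a x y i j * p i) * pderiv j v y) := by
    simp only [Finset.mul_sum (s := Finset.univ) (a := Real.exp (v y)), mul_sub,
      Finset.mul_sum (s := Finset.univ) (a := (2 : ℝ)), ← Finset.sum_sub_distrib]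
    refine Finset.sum_congr rfl fun j _ => ?_
    rw [← Finset.mul_sum]
    ring
  have e6 : ∑ j, b x y j * (p j - pderiv j v y)
      = (∑ j, b x y j * p j) - ∑ j, b x y j * pderiv j v y := by
    simp only [mul_sub, Finset.sum_sub_distrib]
  rw [e1, e4, e5, e6]
  ring

lemma IsFirstEigenvalue.exists_log (h : StandingAssumptions Ω a b c) {p x : Space N}
    (hx : x ∈ closure Ω) {μ : ℝ} (hμ : IsFirstEigenvalue a b c p x μ) :
    ∃ v : Space N → ℝ, ContDiff ℝ 2 v ∧ IsYPeriodic v ∧ ∀ y, logCellOperator a b c p x v y = μ := by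
  obtain ⟨⟨u, hu, hup, hu0, hueq⟩, -⟩ := hμ
  have hv : ContDiff ℝ 2 fun y => Real.log (u y) := hu.log fun y => (hu0 y).ne'
  refine ⟨fun y => Real.log (u y), hv, fun i y => by simp only [hup i y], fun y => ?_⟩
  have h1 := cellOperator_exp (b := b) (c := c) h.a_symm p hx hv y
  have h2 : (fun y => Real.exp (Real.log (u y))) = u := funext fun y => Real.exp_log (hu0 y)
  rw [h2, hueq, Real.exp_log (hu0 y), mul_comm μ] at h1
  exact (mul_left_cancel₀ (hu0 y).ne' h1).symm

/-- Comparison for periodic functions, at a minimum point of `v - w`. -/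
lemma StandingAssumptions.exists_logCellOperator_le (h : StandingAssumptions Ω a b c) (p : Space N)
    {x : Space N} (hx : x ∈ closure Ω) {v w : Space N → ℝ} (hv : ContDiff ℝ 2 v)
    (hw : ContDiff ℝ 2 w) (hvp : IsYPeriodic v) (hwp : IsYPeriodic w) :
    ∃ y ∈ closedCell N, logCellOperator a b c p x w y ≤ logCellOperator a b c p x v y := by
  have hper : IsYPeriodic fun y => w y - v y := fun i y => by simp only [hvp i y, hwp i y]
  obtain ⟨y, hy, hmax⟩ := hper.exists_max (hw.sub hv).continuous
  refine ⟨y, hy, ?_⟩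
  have hvd : Differentiable ℝ v := hv.differentiable (by norm_num)
  have hwd : Differentiable ℝ w := hw.differentiable (by norm_num)
  have hmin : IsLocalMin (fun z => v z - w z) y := Eventually.of_forall fun z => by
    have := hmax z
    simp only at this ⊢
    linarith
  obtain ⟨m, hm, hell⟩ := h.elliptic
  have h1 := sum_mul_pderiv_pderiv_nonneg (h.a_symm x hx y)
    (fun ζ => le_trans (by positivity) (hell x hx y ζ)) (hv.sub hw) hmin
  have hsub : ∀ j, pderiv j (fun z => v z - w z) = fun z => pderiv j v z - pderiv j w z := by
    intro j
    ext z
    simp only [pderiv]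
    rw [fderiv_fun_sub (hvd z) (hwd z)]
    rfl
  have hsub2 : ∀ i j, pderiv i (pderiv j fun z => v z - w z) y
      = pderiv i (pderiv j v) y - pderiv i (pderiv j w) y := by
    intro i j
    rw [hsub]
    have hd : ∀ {f : Space N → ℝ}, ContDiff ℝ 2 f → DifferentiableAt ℝ (pderiv j f) y :=
      fun hf => (hf.pderiv (m := 1) (by norm_num) j).differentiable (by norm_num) y
    rw [pderiv, fderiv_fun_sub (hd hv) (hd hw)]
    rfl
  have hgrad : gradient v y = gradient w y := by
    have h0 := hmin.fderiv_eq_zero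
    rw [fderiv_fun_sub (hvd y) (hwd y), sub_eq_zero] at h0
    simp only [gradient, h0]
  have h2 : ∑ i, ∑ j, a x y i j * pderiv i (pderiv j fun z => v z - w z) y
      = (∑ i, ∑ j, a x y i j * pderiv i (pderiv j v) y)
        - ∑ i, ∑ j, a x y i j * pderiv i (pderiv j w) y := by
    simp only [hsub2, mul_sub, Finset.sum_sub_distrib]
  have h3 : 0 ≤ ∑ i, ∑ j, a x y i j * pderiv i (pderiv j fun z => v z - w z) y := h1
  simp only [logCellOperator, hgrad]
  linarith

lemma StandingAssumptions.cont_logCellOperator (h : StandingAssumptions Ω a b c)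
    {v : Space N → ℝ} (hv : ContDiff ℝ 2 v) :
    ContinuousOn (uncurry fun (z : Space N × Space N) y => logCellOperator a b c z.1 z.2 v y)
      ((univ ×ˢ closure Ω) ×ˢ univ) := by
  have hg : Continuous (gradient v) := (hv.of_le (by norm_num)).continuous_gradient
  refine ContinuousOn.add ?_ ?_
  · refine continuousOn_finsetSum _ fun i _ => continuousOn_finsetSum _ fun j _ => ?_
    refine ContinuousOn.mul ?_ ?_
    · exact (h.cont_a i j).comp (f := fun z : (Space N × Space N) × Space N => (z.1.2, z.2))
        (by fun_prop) fun z hz => ⟨hz.1.2, mem_univ _⟩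
    · have : Continuous (pderiv i (pderiv j v)) :=
        ((hv.pderiv (m := 1) (by norm_num) j).pderiv (m := 0) (by norm_num) i).continuous
      fun_prop
  · let T : (Space N × Space N) × Space N → Space N × Space N × Space N :=
      fun z => (z.1.1 - gradient v z.2, z.1.2, z.2)
    have hT : Continuous T := by fun_prop
    have hm : MapsTo T ((univ ×ˢ closure Ω) ×ˢ univ) (univ ×ˢ closure Ω ×ˢ univ) :=
      fun z hz => ⟨mem_univ _, hz.1.2, mem_univ _⟩
    exact (h.cont_micro.comp hT.continuousOn hm).congr fun z _ => by simp only [comp_apply, T]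

/-- The eigenfunction at one point serves as a test function for nearby coefficients, so that no
estimates on eigenfunctions are needed for the continuity of the eigenvalue. -/
theorem StandingAssumptions.isConvexCoercive_of_firstEigenvalue (h : StandingAssumptions Ω a b c)
    {H : Space N → Space N → ℝ}
    (hH : ∀ x ∈ closure Ω, ∀ p, IsFirstEigenvalue a b c p x (H p x)) : IsConvexCoercive Ω H where
  cont := by
    rintro ⟨p₀, x₀⟩ ⟨-, hx₀⟩
    replace hx₀ : x₀ ∈ closure Ω := hx₀
    obtain ⟨v, hv, hvp, hveq⟩ := (hH x₀ hx₀ p₀).exists_log h hx₀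
    have hmem : ((p₀, x₀) : Space N × Space N) ∈ univ ×ˢ closure Ω := ⟨mem_univ _, hx₀⟩
    refine Metric.tendsto_nhds.2 fun ε hε => ?_
    filter_upwards [eventually_forall_abs_sub_lt isCompact_closedCell
      ((h.cont_logCellOperator hv).mono (prod_mono subset_rfl (subset_univ _))) hmem hε,
      self_mem_nhdsWithin] with z hz hzΩ
    obtain ⟨w, hw, hwp, hweq⟩ := (hH z.2 hzΩ.2 z.1).exists_log h hzΩ.2
    obtain ⟨y₁, hy₁, h₁⟩ := h.exists_logCellOperator_le z.1 hzΩ.2 hv hw hvp hwp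
    obtain ⟨y₂, hy₂, h₂⟩ := h.exists_logCellOperator_le z.1 hzΩ.2 hw hv hwp hvp
    have e₁ := (abs_lt.1 (hz y₁ hy₁)).2
    have e₂ := (abs_lt.1 (hz y₂ hy₂)).1
    simp only [hveq] at e₁ e₂
    rw [hweq] at h₁ h₂
    rw [Real.dist_eq, abs_lt]
    simp only [uncurry]
    constructor <;> linarith
  convex := by
    intro x hx
    refine ⟨convex_univ, fun p₁ _ p₂ _ s t hs ht hst => ?_⟩
    obtain ⟨v₁, hv₁, hp₁, h₁⟩ := (hH x hx p₁).exists_log h hx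
    obtain ⟨v₂, hv₂, hp₂, h₂⟩ := (hH x hx p₂).exists_log h hx
    obtain ⟨w, hw, hwp, hweq⟩ := (hH x hx (s • p₁ + t • p₂)).exists_log h hx
    have hv : ContDiff ℝ 2 fun y => s * v₁ y + t * v₂ y :=
      (contDiff_const.mul hv₁).add (contDiff_const.mul hv₂)
    obtain ⟨y, -, hy⟩ := h.exists_logCellOperator_le (s • p₁ + t • p₂) hx hv hw
      (fun i y => by simp only [hp₁ i y, hp₂ i y]) hwp
    rw [hweq] at hy
    refine hy.trans ?_
    have hd₁ : Differentiable ℝ v₁ := hv₁.differentiable (by norm_num)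
    have hd₂ : Differentiable ℝ v₂ := hv₂.differentiable (by norm_num)
    have hlin : ∀ {f g : Space N → ℝ}, Differentiable ℝ f → Differentiable ℝ g → ∀ j,
        pderiv j (fun y => s * f y + t * g y) = fun y => s * pderiv j f y + t * pderiv j g y := by
      intro f g hf hg j
      ext z
      simp only [pderiv]
      rw [fderiv_fun_add ((hf z).const_mul s) ((hg z).const_mul t), fderiv_const_mul (hf z),
        fderiv_const_mul (hg z)]
      rfl
    have hgrad : gradient (fun y => s * v₁ y + t * v₂ y) y
        = s • gradient v₁ y + t • gradient v₂ y :=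
      (((hd₁ y).hasGradientAt.const_mul' s).add' ((hd₂ y).hasGradientAt.const_mul' t)).gradient
    have h3 := (h.convex_micro hx y).2 (mem_univ (p₁ - gradient v₁ y))
      (mem_univ (p₂ - gradient v₂ y)) hs ht hst
    have h4 : s • (p₁ - gradient v₁ y) + t • (p₂ - gradient v₂ y)
        = s • p₁ + t • p₂ - (s • gradient v₁ y + t • gradient v₂ y) := by module
    have h5 : ∀ i j, pderiv i (pderiv j fun y => s * v₁ y + t * v₂ y) y
        = s * pderiv i (pderiv j v₁) y + t * pderiv i (pderiv j v₂) y := by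
      intro i j
      rw [hlin hd₁ hd₂, hlin ((hv₁.pderiv (m := 1) (by norm_num) j).differentiable (by norm_num))
        ((hv₂.pderiv (m := 1) (by norm_num) j).differentiable (by norm_num))]
    have h6 : ∑ i, ∑ j, a x y i j * pderiv i (pderiv j fun y => s * v₁ y + t * v₂ y) y
        = s * (∑ i, ∑ j, a x y i j * pderiv i (pderiv j v₁) y)
          + t * ∑ i, ∑ j, a x y i j * pderiv i (pderiv j v₂) y := by
      simp only [h5, Finset.mul_sum, ← Finset.sum_add_distrib]
      exact Finset.sum_congr rfl fun i _ => Finset.sum_congr rfl fun j _ => by ring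
    have e₁ := h₁ y
    have e₂ := h₂ y
    rw [h4] at h3
    simp only [logCellOperator] at e₁ e₂ ⊢
    simp only [smul_eq_mul] at h3 ⊢
    rw [hgrad, h6, ← e₁, ← e₂]
    linarith
  coercive := by
    refine h.coercive_of_lower fun x hx p B hB => ?_
    obtain ⟨v, hv, hvp, hveq⟩ := (hH x hx p).exists_log h hx
    obtain ⟨y, -, hy⟩ := h.exists_logCellOperator_le p hx hv (w := fun _ => 0) contDiff_const hvp
      fun _ _ => rfl
    have h0 : ∀ j : Fin N, pderiv j (fun _ : Space N => (0 : ℝ)) = fun _ => 0 := by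
      intro j; ext z; simp [pderiv]
    have hg : gradient (fun _ : Space N => (0 : ℝ)) y = 0 := (hasGradientAt_const y 0).gradient
    rw [hveq] at hy
    simp only [logCellOperator, h0, hg, mul_zero, Finset.sum_const_zero, zero_add, sub_zero] at hy
    exact (hB y).trans hy

end SecondOrderCell

section Cell
open Filter Topology Metric Function
open scoped RealInnerProductSpace ENNReal Pointwise

variable {N : ℕ}

/-! ### Integration over the periodicity cell -/

/-- Lebesgue measure on the periodicity cell, a probability measure. -/
noncomputable abbrev cellMeasure (N : ℕ) : Measure (Space N) := volume.restrict (unitCell N)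

lemma unitCell_eq_preimage :
    unitCell N = (WithLp.ofLp : Space N → Fin N → ℝ) ⁻¹' univ.pi fun _ => Ioo 0 1 := by
  ext y; simp [unitCell, Set.mem_pi]

lemma closedCell_eq_preimage :
    closedCell N = (WithLp.ofLp : Space N → Fin N → ℝ) ⁻¹' univ.pi fun _ => Icc 0 1 := by
  ext y; simp [closedCell, Pi.le_def, forall_and]

lemma isOpen_unitCell : IsOpen (unitCell N) := by
  rw [unitCell_eq_preimage]
  exact (isOpen_set_pi finite_univ fun _ _ => isOpen_Ioo).preimage (PiLp.continuous_ofLp 2 _)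

lemma measurableSet_unitCell : MeasurableSet (unitCell N) := isOpen_unitCell.measurableSet

lemma unitCell_subset_closedCell : unitCell N ⊆ closedCell N :=
  fun _ hy i => ⟨(hy i).1.le, (hy i).2.le⟩

lemma unitCell_ae_eq_closedCell : unitCell N =ᵐ[volume] closedCell N := by
  rw [unitCell_eq_preimage, closedCell_eq_preimage, Set.pi_univ_Icc]
  exact (PiLp.volume_preserving_ofLp (Fin N)).quasiMeasurePreserving.preimage_ae_eq
    (Measure.univ_pi_Ioo_ae_eq_Icc (f := fun _ => 0) (g := fun _ => 1))

lemma ae_mem_unitCell : ∀ᵐ y ∂cellMeasure N, y ∈ unitCell N :=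
  ae_restrict_mem measurableSet_unitCell

instance : IsProbabilityMeasure (cellMeasure N) := by
  refine ⟨?_⟩
  rw [Measure.restrict_apply_univ, unitCell_eq_preimage,
    (PiLp.volume_preserving_ofLp (Fin N)).measure_preimage
      (MeasurableSet.univ_pi fun _ => measurableSet_Ioo).nullMeasurableSet]
  simp [Real.volume_pi_Ioo]

/-- Integrals of periodic functions over the cell are translation invariant: a translated cell is
again a fundamental domain of the lattice of periods. -/
theorem IsYPeriodic.integral_add_left {E : Type*} [NormedAddCommGroup E] [NormedSpace ℝ E]
    {f : Space N → E} (hf : IsYPeriodic f) (z : Space N) :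
    ∫ y, f (z + y) ∂cellMeasure N = ∫ y, f y ∂cellMeasure N := by
  let e := (EuclideanSpace.basisFun (Fin N) ℝ).toBasis
  let Λ : AddSubgroup (Space N) := (Submodule.span ℤ (range e)).toAddSubgroup
  have : Countable Λ := inferInstanceAs (Countable (Submodule.span ℤ (range e)))
  have hFD : IsAddFundamentalDomain Λ (ZSpan.fundamentalDomain e) volume :=
    ZSpan.isAddFundamentalDomain' e volume
  have hfd : ZSpan.fundamentalDomain e
      = (WithLp.ofLp : Space N → Fin N → ℝ) ⁻¹' univ.pi fun _ => Ico 0 1 := by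
    ext y
    simp only [ZSpan.mem_fundamentalDomain, mem_preimage, mem_univ_pi]
    rfl
  have hae : unitCell N =ᵐ[volume] ZSpan.fundamentalDomain e := by
    rw [unitCell_eq_preimage, hfd]
    exact (PiLp.volume_preserving_ofLp (Fin N)).quasiMeasurePreserving.preimage_ae_eq
      (Measure.univ_pi_Ioo_ae_eq_Icc.trans Measure.univ_pi_Ico_ae_eq_Icc.symm)
  have hinv : ∀ (g : Λ) (x : Space N), f (g +ᵥ x) = f x := by
    let S : AddSubgroup (Space N) :=
      { carrier := {v | ∀ y, f (v + y) = f y}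
        zero_mem' := fun y => by simp
        add_mem' := fun {a b} ha hb y => by rw [add_assoc, ha, hb]
        neg_mem' := fun {a} ha y => by rw [← ha (-a + y)]; simp }
    have hle : Submodule.span ℤ (range e) ≤ AddSubgroup.toIntSubmodule S := by
      refine Submodule.span_le.2 ?_
      rintro _ ⟨i, rfl⟩ y
      rw [add_comm]
      simpa [e] using hf i y
    exact fun g x => hle g.2 x
  have h1 : ∫ y, f (z + y) ∂cellMeasure N = ∫ y in ZSpan.fundamentalDomain e, f (z + y) :=
    setIntegral_congr_set hae
  have h2 : ∫ y, f y ∂cellMeasure N = ∫ y in ZSpan.fundamentalDomain e, f y :=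
    setIntegral_congr_set hae
  have h3 : ∫ y in z +ᵥ ZSpan.fundamentalDomain e, f y
      = ∫ y in ZSpan.fundamentalDomain e, f (z + y) :=
    (measurePreserving_add_left volume z).setIntegral_image_emb
      (measurableEmbedding_addLeft z) f _
  rw [h1, h2, ← h3]
  exact (hFD.vadd_of_comm z).setIntegral_eq hFD hinv

lemma Continuous.exists_bound_cell {E : Type*} [NormedAddCommGroup E] {f : Space N → E}
    (hf : Continuous f) : ∃ C, ∀ y ∈ unitCell N, ‖f y‖ ≤ C := by
  obtain ⟨C, hC⟩ := isCompact_closedCell.exists_bound_of_continuousOn hf.continuousOn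
  exact ⟨C, fun y hy => hC y (unitCell_subset_closedCell hy)⟩

lemma Continuous.integrable_cell {E : Type*} [NormedAddCommGroup E] {f : Space N → E}
    (hf : Continuous f) : Integrable f (cellMeasure N) :=
  (hf.continuousOn.integrableOn_compact isCompact_closedCell).mono_set unitCell_subset_closedCell

lemma Continuous.memLp_cell {E : Type*} [NormedAddCommGroup E] {f : Space N → E}
    (hf : Continuous f) (p : ℝ≥0∞) : MemLp f p (cellMeasure N) := by
  obtain ⟨C, hC⟩ := hf.exists_bound_cell
  exact MemLp.of_bound hf.integrable_cell.aestronglyMeasurable C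
    (ae_mem_unitCell.mono fun y hy => hC y hy)

/-- Jensen's inequality for the square. -/
lemma sq_integral_le {α : Type*} [MeasurableSpace α] {μ : Measure α} [IsProbabilityMeasure μ]
    {f : α → ℝ} (hf : MemLp f 2 μ) : (∫ y, f y ∂μ) ^ 2 ≤ ∫ y, f y ^ 2 ∂μ := by
  have h1 : Integrable f μ := hf.integrable (by norm_num)
  have h2 : Integrable (fun y => f y ^ 2) μ := hf.integrable_sq
  set c := ∫ y, f y ∂μ with hc
  have h3 : 0 ≤ ∫ y, (f y - c) ^ 2 ∂μ := integral_nonneg fun y => sq_nonneg _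
  have h4 : ∀ y, (f y - c) ^ 2 = f y ^ 2 - 2 * c * f y + c ^ 2 := fun y => by ring
  simp only [h4] at h3
  have i1 : Integrable (fun y => f y ^ 2 - 2 * c * f y) μ := h2.sub (h1.const_mul _)
  rw [integral_add i1 (integrable_const _), integral_sub h2 (h1.const_mul _), integral_const_mul,
    integral_const, ← hc] at h3
  simp at h3
  nlinarith

lemma IsYPeriodic.fderiv {F : Type*} [NormedAddCommGroup F] [NormedSpace ℝ F] {f : Space N → F}
    (hf : IsYPeriodic f) : IsYPeriodic (fderiv ℝ f) := by
  intro i y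
  have h1 : (fun y => f (y + EuclideanSpace.single i 1)) = f := funext fun y => hf i y
  rw [← fderiv_comp_add_right, h1]

lemma IsYPeriodic.gradient {f : Space N → ℝ} (hf : IsYPeriodic f) : IsYPeriodic (gradient f) :=
  fun i y => by simp only [_root_.gradient, hf.fderiv i y]

/-- The integral of the square of the increments of a periodic `C¹` function. -/
lemma integral_sq_increment_le {h : Space N → ℝ} (hh : ContDiff ℝ 1 h) (hp : IsYPeriodic h)
    (z : Space N) : ∫ y, (h (y + z) - h y) ^ 2 ∂cellMeasure N
      ≤ ‖z‖ ^ 2 * ∫ y, ‖gradient h y‖ ^ 2 ∂cellMeasure N := by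
  set μ : Measure ℝ := volume.restrict (Icc 0 1) with hμ
  have : IsProbabilityMeasure μ := ⟨by simp [hμ]⟩
  have hg := hh.continuous_gradient
  have hgp : IsYPeriodic fun y => ‖gradient h y‖ ^ 2 := by
    intro i y
    simp only [hp.gradient i y]
  have hcont : Continuous fun w : Space N × ℝ => ‖gradient h (w.1 + w.2 • z)‖ ^ 2 := by fun_prop
  have hpt : ∀ y, (h (y + z) - h y) ^ 2 ≤ ∫ t, ‖z‖ ^ 2 * ‖gradient h (y + t • z)‖ ^ 2 ∂μ := by
    intro y
    have hc1 : Continuous fun t : ℝ => ⟪gradient h (y + t • z), z⟫ := by fun_prop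
    have hder : ∀ t : ℝ, HasDerivAt (fun t : ℝ => h (y + t • z)) ⟪gradient h (y + t • z), z⟫ t := by
      intro t
      have h1 : HasDerivAt (fun t : ℝ => y + t • z) z t := by
        simpa using ((hasDerivAt_id t).smul_const z).const_add y
      have h2 := (hh.hasGradientAt (y + t • z)).hasFDerivAt.comp_hasDerivAt t h1
      exact h2
    have hftc : ∫ t, ⟪gradient h (y + t • z), z⟫ ∂μ = h (y + z) - h y := by
      have := intervalIntegral.integral_eq_sub_of_hasDerivAt (a := 0) (b := 1)
        (fun t _ => hder t) (hc1.intervalIntegrable _ _)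
      rw [intervalIntegral.integral_of_le zero_le_one, ← integral_Icc_eq_integral_Ioc] at this
      simpa using this
    have hb : ∀ t : ℝ, ⟪gradient h (y + t • z), z⟫ ^ 2
        ≤ ‖z‖ ^ 2 * ‖gradient h (y + t • z)‖ ^ 2 := by
      intro t
      rw [← mul_pow, ← sq_abs]
      refine pow_le_pow_left₀ (abs_nonneg _) ?_ 2
      rw [mul_comm]
      exact abs_real_inner_le_norm _ _
    have hint : ∀ {f : ℝ → ℝ}, Continuous f → Integrable f μ := fun hf =>
      hf.continuousOn.integrableOn_compact isCompact_Icc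
    have hmem : MemLp (fun t : ℝ => ⟪gradient h (y + t • z), z⟫) 2 μ :=
      (memLp_two_iff_integrable_sq hc1.aestronglyMeasurable).2 (hint (hc1.pow 2))
    rw [← hftc]
    refine (sq_integral_le hmem).trans (integral_mono (hint (hc1.pow 2)) (hint ?_) hb)
    fun_prop
  have hh' := hh.continuous
  calc ∫ y, (h (y + z) - h y) ^ 2 ∂cellMeasure N
      ≤ ∫ y, ∫ t, ‖z‖ ^ 2 * ‖gradient h (y + t • z)‖ ^ 2 ∂μ ∂cellMeasure N := by
        refine integral_mono_of_nonneg (Eventually.of_forall fun y => sq_nonneg _) ?_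
          (Eventually.of_forall hpt)
        have hc := continuous_parametric_integral_of_continuous
          (f := fun (y : Space N) (t : ℝ) => ‖z‖ ^ 2 * ‖gradient h (y + t • z)‖ ^ 2) (μ := volume)
          (by simp only [uncurry_def]; fun_prop) (isCompact_Icc (a := (0 : ℝ)) (b := 1))
        exact hc.integrable_cell
    _ = ∫ t, ∫ y, ‖z‖ ^ 2 * ‖gradient h (y + t • z)‖ ^ 2 ∂cellMeasure N ∂μ := by
        refine integral_integral_swap ?_
        have h1 : IntegrableOn (uncurry fun (y : Space N) (t : ℝ) =>
            ‖z‖ ^ 2 * ‖gradient h (y + t • z)‖ ^ 2) (closedCell N ×ˢ Icc (0 : ℝ) 1)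
            (volume.prod volume) :=
          (continuous_const.mul hcont).continuousOn.integrableOn_compact
            (isCompact_closedCell.prod isCompact_Icc)
        rw [Measure.prod_restrict]
        exact h1.mono_set (prod_mono unitCell_subset_closedCell subset_rfl)
    _ = ∫ _t, ‖z‖ ^ 2 * ∫ y, ‖gradient h y‖ ^ 2 ∂cellMeasure N ∂μ := by
        refine integral_congr_ae (Eventually.of_forall fun t => ?_)
        simp only [integral_const_mul]
        have := hgp.integral_add_left (t • z)
        simp only [add_comm (t • z)] at this
        rw [this]
    _ = _ := by simp

/-- Poincaré's inequality on the cell for periodic functions. -/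
theorem variance_le_of_periodic {h : Space N → ℝ} (hh : ContDiff ℝ 1 h) (hp : IsYPeriodic h) :
    ∫ y, h y ^ 2 ∂cellMeasure N - (∫ y, h y ∂cellMeasure N) ^ 2
      ≤ N * ∫ y, ‖gradient h y‖ ^ 2 ∂cellMeasure N := by
  have hc := hh.continuous
  set G := ∫ y, ‖gradient h y‖ ^ 2 ∂cellMeasure N with hG
  have hG0 : 0 ≤ G := integral_nonneg fun y => by positivity
  set I := ∫ y, h y ∂cellMeasure N with hI
  set Q := ∫ y, h y ^ 2 ∂cellMeasure N with hQ
  have hsqp : IsYPeriodic fun y => h y ^ 2 := fun i y => by simp only [hp i y]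
  have hD : ∀ z, 2 * Q - 2 * ∫ y, h y * h (y + z) ∂cellMeasure N ≤ ‖z‖ ^ 2 * G := by
    intro z
    have h1 := integral_sq_increment_le hh hp z
    have h2 : ∀ y, (h (y + z) - h y) ^ 2 = h (y + z) ^ 2 + h y ^ 2 - 2 * (h y * h (y + z)) :=
      fun y => by ring
    have i1 : Integrable (fun y => h (y + z) ^ 2) (cellMeasure N) :=
      Continuous.integrable_cell (by fun_prop)
    have i2 : Integrable (fun y => h y ^ 2) (cellMeasure N) :=
      Continuous.integrable_cell (by fun_prop)
    have i3 : Integrable (fun y => h y * h (y + z)) (cellMeasure N) :=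
      Continuous.integrable_cell (by fun_prop)
    simp only [h2] at h1
    have h4 := hsqp.integral_add_left z
    simp only [add_comm z] at h4
    have i4 : Integrable (fun y => h (y + z) ^ 2 + h y ^ 2) (cellMeasure N) := i1.add i2
    rw [integral_sub i4 (i3.const_mul 2), integral_add i1 i2, integral_const_mul, h4] at h1
    linarith
  have hcz : Continuous fun z => ∫ y, h y * h (y + z) ∂cellMeasure N := by
    have := continuous_parametric_integral_of_continuous
      (f := fun (z y : Space N) => h y * h (y + z)) (μ := volume)
      (by simp only [uncurry_def]; fun_prop) (isCompact_closedCell (N := N))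
    have h2 : (fun z => ∫ y, h y * h (y + z) ∂cellMeasure N)
        = fun z => ∫ y in closedCell N, h y * h (y + z) :=
      funext fun z => setIntegral_congr_set unitCell_ae_eq_closedCell
    rwa [h2]
  have hswap : ∫ z, ∫ y, h y * h (y + z) ∂cellMeasure N ∂cellMeasure N = I ^ 2 := by
    rw [integral_integral_swap]
    · have h1 : ∀ y, ∫ z, h y * h (y + z) ∂cellMeasure N = h y * I := fun y => by
        rw [integral_const_mul, hp.integral_add_left]
      simp only [h1]
      rw [integral_mul_const, sq]
    · have h1 : IntegrableOn (uncurry fun (z y : Space N) => h y * h (y + z))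
          (closedCell N ×ˢ closedCell N) (volume.prod volume) := by
        refine Continuous.continuousOn ?_ |>.integrableOn_compact
          (isCompact_closedCell.prod isCompact_closedCell)
        simp only [uncurry_def]
        fun_prop
      rw [Measure.prod_restrict]
      exact h1.mono_set (prod_mono unitCell_subset_closedCell unitCell_subset_closedCell)
  have hbound : ∀ᵐ z ∂cellMeasure N, 2 * Q - 2 * ∫ y, h y * h (y + z) ∂cellMeasure N ≤ N * G := by
    filter_upwards [ae_mem_unitCell] with z hz
    refine (hD z).trans (mul_le_mul_of_nonneg_right ?_ hG0)
    rw [EuclideanSpace.norm_sq_eq]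
    calc ∑ i, ‖z i‖ ^ 2 ≤ ∑ _i : Fin N, (1 : ℝ) := Finset.sum_le_sum fun i _ => by
          rw [Real.norm_of_nonneg (hz i).1.le]
          exact pow_le_one₀ (hz i).1.le (hz i).2.le
      _ = N := by simp
  have hint := integral_mono_ae ((integrable_const _).sub (hcz.integrable_cell.const_mul 2))
    (integrable_const (N * G)) hbound
  simp only [Pi.sub_apply] at hint
  rw [integral_sub (integrable_const _) (hcz.integrable_cell.const_mul 2),
    integral_const_mul (2 : ℝ) (fun z => ∫ y, h y * h (y + z) ∂cellMeasure N), hswap] at hint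
  simp at hint
  have : 0 ≤ N * G := by positivity
  linarith

end Cell

section Mollification
open Filter Topology Metric Function
open scoped RealInnerProductSpace ENNReal

variable {N : ℕ} {E : Type*} [NormedAddCommGroup E] [NormedSpace ℝ E]

/-! ### Periodic mollification -/

/-- The trigonometric polynomial `∏ i, (1 + cos (2 π w_i))`, whose maximum over a period is
attained only at the lattice points. -/
noncomputable def cosineProduct (w : Space N) : ℝ := ∏ i, (1 + Real.cos (2 * Real.pi * w i))

/-- The normalized powers of `cosineProduct`, a periodic approximate identity. -/
noncomputable def cosineKernel (n : ℕ) (w : Space N) : ℝ :=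
  (∫ z, cosineProduct z ^ n ∂cellMeasure N)⁻¹ * cosineProduct w ^ n

/-- The periodic convolution of `cosineKernel n` with `f`. It only involves the values of `f` in
the cell, so that `f` itself need not be periodic. -/
noncomputable def mollify (n : ℕ) (f : Space N → E) (y : Space N) : E :=
  ∫ z, cosineKernel n (y - z) • f z ∂cellMeasure N

lemma cosineProduct_nonneg (w : Space N) : 0 ≤ cosineProduct w :=
  Finset.prod_nonneg fun i _ => by linarith [Real.neg_one_le_cos (2 * Real.pi * w i)]

lemma contDiff_cosineProduct {k : WithTop ℕ∞} :
    ContDiff ℝ k (cosineProduct : Space N → ℝ) := by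
  refine contDiff_prod fun i _ => contDiff_const.add (Real.contDiff_cos.comp ?_)
  exact contDiff_const.mul (EuclideanSpace.proj (𝕜 := ℝ) i).contDiff

lemma isYPeriodic_cosineProduct : IsYPeriodic (cosineProduct : Space N → ℝ) := by
  intro j y
  refine Finset.prod_congr rfl fun i _ => ?_
  by_cases hij : i = j
  · subst hij
    simp [mul_add, Real.cos_add_two_pi]
  · simp [hij]

lemma cosineProduct_neg (w : Space N) : cosineProduct (-w) = cosineProduct w := by
  simp [cosineProduct]

lemma cosineProduct_lt {w : Space N} (hw : ∀ i, |w i| < 1) (h0 : w ≠ 0) :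
    cosineProduct w < cosineProduct (0 : Space N) := by
  have hne : ∃ i, w i ≠ 0 := by
    by_contra! h
    exact h0 (by ext i; simp [h i])
  obtain ⟨j, hj⟩ := hne
  have h1 : ∀ i, 1 + Real.cos (2 * Real.pi * w i) ≤ 2 := fun i => by
    linarith [Real.cos_le_one (2 * Real.pi * w i)]
  have h2 : ∀ i, 0 ≤ 1 + Real.cos (2 * Real.pi * w i) := fun i => by
    linarith [Real.neg_one_le_cos (2 * Real.pi * w i)]
  have h3 : 1 + Real.cos (2 * Real.pi * w j) < 2 := by
    have hlt : Real.cos (2 * Real.pi * w j) ≠ 1 := by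
      intro h
      have h4 := abs_lt.1 (hw j)
      have h5 := Real.pi_pos
      rw [Real.cos_eq_one_iff_of_lt_of_lt (by nlinarith) (by nlinarith)] at h
      have : 2 * Real.pi ≠ 0 := by positivity
      exact hj ((mul_eq_zero.1 h).resolve_left this)
    have := lt_of_le_of_ne (Real.cos_le_one (2 * Real.pi * w j)) hlt
    linarith
  have hzero : cosineProduct (0 : Space N) = ∏ _i : Fin N, (2 : ℝ) :=
    Finset.prod_congr rfl fun i _ => by norm_num
  rw [hzero, cosineProduct, ← Finset.mul_prod_erase _ _ (Finset.mem_univ j),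
    ← Finset.mul_prod_erase _ (fun _ => (2 : ℝ)) (Finset.mem_univ j)]
  refine (mul_le_mul_of_nonneg_left
    (Finset.prod_le_prod (fun i _ => h2 i) fun i _ => h1 i) (h2 j)).trans_lt ?_
  exact mul_lt_mul_of_pos_right h3 (by positivity)

lemma integral_cosineProduct_pow_pos (n : ℕ) :
    0 < ∫ z, cosineProduct z ^ n ∂cellMeasure N := by
  have hc : Continuous fun z : Space N => cosineProduct z ^ n :=
    (contDiff_cosineProduct (k := 0)).continuous.pow n
  rw [setIntegral_pos_iff_support_of_nonneg_ae
    (Eventually.of_forall fun z => pow_nonneg (cosineProduct_nonneg z) n) hc.integrable_cell]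
  refine (hc.isOpen_support.inter isOpen_unitCell).measure_pos volume
    ⟨WithLp.toLp 2 fun _ => 1 / 4, ?_, ?_⟩
  · have : (2 * Real.pi * (1 / 4)) = Real.pi / 2 := by ring
    simp [cosineProduct, mem_support, show 2 * Real.pi * 4⁻¹ = Real.pi / 2 by ring]
  · intro i
    norm_num

lemma cosineKernel_nonneg (n : ℕ) (w : Space N) : 0 ≤ cosineKernel n w :=
  mul_nonneg (inv_nonneg.2 (integral_cosineProduct_pow_pos n).le)
    (pow_nonneg (cosineProduct_nonneg w) n)

lemma contDiff_cosineKernel (n : ℕ) {k : WithTop ℕ∞} :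
    ContDiff ℝ k (cosineKernel n : Space N → ℝ) :=
  contDiff_const.mul (contDiff_cosineProduct.pow n)

lemma continuous_cosineKernel (n : ℕ) : Continuous (cosineKernel n : Space N → ℝ) :=
  (contDiff_cosineKernel n (k := 0)).continuous

lemma isYPeriodic_cosineKernel (n : ℕ) : IsYPeriodic (cosineKernel n : Space N → ℝ) :=
  fun i y => by simp only [cosineKernel, isYPeriodic_cosineProduct i y]

lemma integral_cosineKernel_left (n : ℕ) (z : Space N) :
    ∫ y, cosineKernel n (y - z) ∂cellMeasure N = 1 := by
  have h := (isYPeriodic_cosineKernel n).integral_add_left (-z)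
  simp only [neg_add_eq_sub] at h
  rw [h]
  simp only [cosineKernel]
  rw [integral_const_mul, inv_mul_cancel₀ (integral_cosineProduct_pow_pos n).ne']

lemma cosineKernel_neg (n : ℕ) (w : Space N) : cosineKernel n (-w) = cosineKernel n w := by
  simp only [cosineKernel, cosineProduct_neg]

lemma integral_cosineKernel_right (n : ℕ) (y : Space N) :
    ∫ z, cosineKernel n (y - z) ∂cellMeasure N = 1 := by
  rw [← integral_cosineKernel_left n y]
  exact integral_congr_ae (Eventually.of_forall fun z => by
    show cosineKernel n (y - z) = cosineKernel n (z - y)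
    rw [← cosineKernel_neg, neg_sub])

lemma IsYPeriodic.exists_bound {F : Type*} [NormedAddCommGroup F] {f : Space N → F}
    (hf : IsYPeriodic f) (hc : Continuous f) : ∃ C, 0 ≤ C ∧ ∀ y, ‖f y‖ ≤ C := by
  obtain ⟨C, hC⟩ := isCompact_closedCell.exists_bound_of_continuousOn hc.continuousOn
  refine ⟨max C 0, le_max_right _ _, fun y => ?_⟩
  obtain ⟨z, hz, hzy⟩ := hf.exists_mem_closedCell_eq y
  rw [← hzy]
  exact (hC z hz).trans (le_max_left _ _)

/-- Differentiation of a periodic convolution under the integral sign. -/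
lemma hasFDerivAt_integral_smul {F : Type*} [NormedAddCommGroup F] [NormedSpace ℝ F]
    {k : Space N → F} (hk : ContDiff ℝ 1 k) (hp : IsYPeriodic k) {f : Space N → ℝ}
    (hf : Integrable f (cellMeasure N)) (y : Space N) :
    HasFDerivAt (fun y => ∫ z, f z • k (y - z) ∂cellMeasure N)
      (∫ z, f z • fderiv ℝ k (y - z) ∂cellMeasure N) y := by
  have hk' : Continuous (fderiv ℝ k) := hk.continuous_fderiv one_ne_zero
  obtain ⟨C₀, hC₀, hb₀⟩ := hp.exists_bound hk.continuous
  obtain ⟨C, hC, hb⟩ := hp.fderiv.exists_bound hk'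
  have hk0 := hk.continuous
  refine hasFDerivAt_integral_of_dominated_of_fderiv_le (s := univ) (bound := fun z => ‖f z‖ * C)
    (F' := fun y z => f z • fderiv ℝ k (y - z)) univ_mem ?_ ?_ ?_ ?_ (hf.norm.mul_const _) ?_
  · exact Eventually.of_forall fun y => hf.aestronglyMeasurable.smul
      (Continuous.aestronglyMeasurable (by fun_prop))
  · exact hf.smul_bdd C₀ (Continuous.aestronglyMeasurable (by fun_prop))
      (Eventually.of_forall fun z => hb₀ _)
  · exact hf.aestronglyMeasurable.smul (Continuous.aestronglyMeasurable (by fun_prop))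
  · refine Eventually.of_forall fun z y _ => ?_
    rw [norm_smul]
    exact mul_le_mul_of_nonneg_left (hb _) (norm_nonneg _)
  · refine Eventually.of_forall fun z y _ => HasFDerivAt.const_smul ?_ _
    have h1 := (hk.differentiable one_ne_zero (y - z)).hasFDerivAt
    exact h1.comp y ((hasFDerivAt_id y).sub_const z)

lemma contDiff_integral_smul {F : Type*} [NormedAddCommGroup F] [NormedSpace ℝ F]
    {k : Space N → F} (hk : ContDiff ℝ 2 k) (hp : IsYPeriodic k) {f : Space N → ℝ}
    (hf : Integrable f (cellMeasure N)) :
    ContDiff ℝ 1 (fun y => ∫ z, f z • k (y - z) ∂cellMeasure N) := by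
  have h1 : ContDiff ℝ 1 k := hk.of_le (by norm_num)
  refine contDiff_one_iff_fderiv.2
    ⟨fun y => (hasFDerivAt_integral_smul h1 hp hf y).differentiableAt, ?_⟩
  have h2 : fderiv ℝ (fun y => ∫ z, f z • k (y - z) ∂cellMeasure N)
      = fun y => ∫ z, f z • fderiv ℝ k (y - z) ∂cellMeasure N :=
    funext fun y => (hasFDerivAt_integral_smul h1 hp hf y).fderiv
  rw [h2]
  refine continuous_iff_continuousAt.2 fun y => ?_
  exact (hasFDerivAt_integral_smul (hk.fderiv_right (by norm_num)) hp.fderiv hf y).continuousAt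

lemma contDiff_mollify (n : ℕ) {f : Space N → ℝ} (hf : Integrable f (cellMeasure N)) :
    ContDiff ℝ 2 (mollify n f) := by
  have hp : IsYPeriodic (cosineKernel n : Space N → ℝ) := isYPeriodic_cosineKernel n
  have h0 : mollify n f = fun y => ∫ z, f z • cosineKernel n (y - z) ∂cellMeasure N := by
    funext y
    simp only [mollify, smul_eq_mul, mul_comm]
  have h2 : fderiv ℝ (mollify n f)
      = fun y => ∫ z, f z • fderiv ℝ (cosineKernel n) (y - z) ∂cellMeasure N := by
    rw [h0]
    exact funext fun y => (hasFDerivAt_integral_smul (contDiff_cosineKernel n) hp hf y).fderiv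
  have h3 : (2 : WithTop ℕ∞) = 1 + 1 := by norm_num
  rw [h3, contDiff_succ_iff_fderiv]
  refine ⟨?_, by simp, ?_⟩
  · rw [h0]
    exact fun y => (hasFDerivAt_integral_smul (contDiff_cosineKernel n) hp hf y).differentiableAt
  · rw [h2]
    exact contDiff_integral_smul ((contDiff_cosineKernel n (k := 3)).fderiv_right (by norm_num))
      hp.fderiv hf

lemma isYPeriodic_mollify (n : ℕ) (f : Space N → E) : IsYPeriodic (mollify n f) := by
  intro i y
  simp only [mollify, add_sub_right_comm, isYPeriodic_cosineKernel n i _]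

lemma integrable_mollify (n : ℕ) {f : Space N → E} (hf : Integrable f (cellMeasure N))
    (y : Space N) : Integrable (fun z => cosineKernel n (y - z) • f z) (cellMeasure N) := by
  obtain ⟨C, -, hC⟩ := (isYPeriodic_cosineKernel (N := N) n).exists_bound
    (continuous_cosineKernel n)
  have := continuous_cosineKernel (N := N) n
  exact hf.bdd_smul C (Continuous.aestronglyMeasurable (by fun_prop))
    (Eventually.of_forall fun z => hC _)

lemma continuous_mollify (n : ℕ) {f : Space N → E} (hf : Integrable f (cellMeasure N)) :
    Continuous (mollify n f) := by
  obtain ⟨C, -, hC⟩ := (isYPeriodic_cosineKernel (N := N) n).exists_bound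
    (continuous_cosineKernel n)
  have := continuous_cosineKernel (N := N) n
  refine continuous_of_dominated (bound := fun z => C * ‖f z‖)
    (fun y => (integrable_mollify n hf y).aestronglyMeasurable)
    (fun y => Eventually.of_forall fun z => ?_) (hf.norm.const_mul C)
    (Eventually.of_forall fun z => by fun_prop)
  rw [norm_smul]
  exact mul_le_mul_of_nonneg_right (hC _) (norm_nonneg _)

lemma mollify_mem_Icc (n : ℕ) {f : Space N → ℝ} (hf : Integrable f (cellMeasure N)) {lo hi : ℝ}
    (h : ∀ y, f y ∈ Icc lo hi) (y : Space N) : mollify n f y ∈ Icc lo hi := by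
  have hK : Integrable (fun z => cosineKernel n (y - z)) (cellMeasure N) := by
    simpa using integrable_mollify n (integrable_const (1 : ℝ)) y
  have h1 : ∀ k : ℝ, ∫ z, cosineKernel n (y - z) * k ∂cellMeasure N = k := fun k => by
    rw [integral_mul_const, integral_cosineKernel_right, one_mul]
  constructor
  · rw [← h1 lo]
    exact integral_mono (hK.mul_const _) (integrable_mollify n hf y) fun z =>
      mul_le_mul_of_nonneg_left (h z).1 (cosineKernel_nonneg n _)
  · rw [← h1 hi]
    exact integral_mono (integrable_mollify n hf y) (hK.mul_const _) fun z =>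
      mul_le_mul_of_nonneg_left (h z).2 (cosineKernel_nonneg n _)

/-- The gradient of a mollified function is the mollification of its weak gradient: the kernel,
being periodic, is an admissible test function. -/
lemma gradient_mollify (n : ℕ) {f : Space N → ℝ} {g : Space N → Space N}
    (hf : Integrable f (cellMeasure N)) (hg : Integrable g (cellMeasure N))
    (hw : ∀ φ : Space N → ℝ, ContDiff ℝ 1 φ → IsYPeriodic φ → ∀ i,
      ∫ y in unitCell N, f y * pderiv i φ y = -∫ y in unitCell N, g y i * φ y) (y : Space N) :
    gradient (mollify n f) y = mollify n g y := by
  have hp : IsYPeriodic (cosineKernel n : Space N → ℝ) := isYPeriodic_cosineKernel n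
  have hk : ContDiff ℝ 1 (cosineKernel n : Space N → ℝ) := contDiff_cosineKernel n
  have h0 : mollify n f = fun y => ∫ z, f z • cosineKernel n (y - z) ∂cellMeasure N := by
    funext y
    simp only [mollify, smul_eq_mul, mul_comm]
  have hk' : Continuous (fderiv ℝ (cosineKernel n : Space N → ℝ)) :=
    hk.continuous_fderiv one_ne_zero
  obtain ⟨C, hC, hb⟩ := hp.fderiv.exists_bound hk'
  ext i
  rw [← pderiv_eq_gradient ((contDiff_mollify n hf).differentiable two_ne_zero y) i, pderiv]
  have h1 : fderiv ℝ (mollify n f) y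
      = ∫ z, f z • fderiv ℝ (cosineKernel n) (y - z) ∂cellMeasure N := by
    rw [h0]
    exact (hasFDerivAt_integral_smul hk hp hf y).fderiv
  have hi : Integrable (fun z => f z • fderiv ℝ (cosineKernel n) (y - z)) (cellMeasure N) :=
    hf.smul_bdd C (Continuous.aestronglyMeasurable (by fun_prop))
      (Eventually.of_forall fun z => hb _)
  rw [h1, ContinuousLinearMap.integral_apply hi]
  set φ : Space N → ℝ := fun z => cosineKernel n (y - z) with hφ
  have hφ1 : ContDiff ℝ 1 φ := hk.comp (contDiff_const.sub contDiff_id)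
  have hφp : IsYPeriodic φ := fun j z => by
    simp only [hφ]
    rw [← hp j (y - (z + EuclideanSpace.single j 1))]
    congr 1
    abel
  have hφd : ∀ z, pderiv i φ z
      = -fderiv ℝ (cosineKernel n) (y - z) (EuclideanSpace.single i 1) := by
    intro z
    have h3 := (hk.differentiable one_ne_zero (y - z)).hasFDerivAt.comp z
      ((hasFDerivAt_id z).const_sub y)
    have h4 : fderiv ℝ φ z = _ := h3.fderiv
    rw [pderiv, h4]
    simp
  have h2 := hw φ hφ1 hφp i
  simp only [hφd, mul_neg, integral_neg, neg_inj] at h2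
  have h3 : mollify n g y i = ∫ z, (cosineKernel n (y - z) • g z) i ∂cellMeasure N :=
    ((EuclideanSpace.proj (𝕜 := ℝ) i).integral_comp_comm (integrable_mollify n hg y)).symm
  rw [h3]
  simpa [mul_comm] using h2

/-- Pointwise convergence of mollifications in the open cell. -/
lemma tendsto_mollify [CompleteSpace E] {f : Space N → E} (hf : Continuous f) {y : Space N}
    (hy : y ∈ unitCell N) : Tendsto (fun n => mollify n f y) atTop (𝓝 (f y)) := by
  have hc : Continuous (cosineProduct : Space N → ℝ) := (contDiff_cosineProduct (k := 0)).continuous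
  have h := tendsto_setIntegral_pow_smul_of_unique_maximum_of_isCompact_of_continuousOn
    (μ := (volume : Measure (Space N))) (x₀ := y) (c := fun z => cosineProduct (y - z)) (g := f)
    isCompact_closedCell (by fun_prop) ?_ (fun z _ => cosineProduct_nonneg _) ?_ ?_ hf.continuousOn
  · refine h.congr fun n => ?_
    have h1 : ∫ z in closedCell N, cosineProduct (y - z) ^ n
        = ∫ z, cosineProduct z ^ n ∂cellMeasure N := by
      rw [← setIntegral_congr_set unitCell_ae_eq_closedCell]
      have hp : IsYPeriodic fun z : Space N => cosineProduct z ^ n := fun i z => by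
        simp only [isYPeriodic_cosineProduct i z]
      rw [← hp.integral_add_left (-y)]
      exact integral_congr_ae (Eventually.of_forall fun z => by
        show cosineProduct (y - z) ^ n = cosineProduct (-y + z) ^ n
        rw [← cosineProduct_neg, neg_sub, neg_add_eq_sub])
    have h2 : ∫ z in closedCell N, cosineProduct (y - z) ^ n • f z
        = ∫ z, cosineProduct (y - z) ^ n • f z ∂cellMeasure N :=
      (setIntegral_congr_set unitCell_ae_eq_closedCell).symm
    rw [h1, h2, ← integral_smul]
    simp only [mollify, cosineKernel, mul_smul]
  · intro z hz hzy
    rw [sub_self]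
    refine cosineProduct_lt (fun i => ?_) (sub_ne_zero.2 hzy.symm)
    have h1 := hy i
    have h2 := hz i
    rw [PiLp.sub_apply, abs_lt]
    constructor <;> linarith [h1.1, h1.2, h2.1, h2.2]
  · rw [sub_self]
    exact Finset.prod_pos fun i _ => by norm_num
  · exact subset_closure (mem_interior.2 ⟨_, unitCell_subset_closedCell, isOpen_unitCell, hy⟩)

/-- Jensen's inequality for the square and a probability density. -/
lemma sq_integral_mul_le {w f : Space N → ℝ} (hw : Integrable w (cellMeasure N)) (h0 : ∀ y, 0 ≤ w y)
    (h1 : ∫ y, w y ∂cellMeasure N = 1) (hf : Integrable (fun y => w y * f y) (cellMeasure N))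
    (hf2 : Integrable (fun y => w y * f y ^ 2) (cellMeasure N)) :
    (∫ y, w y * f y ∂cellMeasure N) ^ 2 ≤ ∫ y, w y * f y ^ 2 ∂cellMeasure N := by
  set c := ∫ y, w y * f y ∂cellMeasure N with hc
  have h3 : 0 ≤ ∫ y, w y * (f y - c) ^ 2 ∂cellMeasure N :=
    integral_nonneg fun y => mul_nonneg (h0 y) (sq_nonneg _)
  have h4 : ∀ y, w y * (f y - c) ^ 2 = w y * f y ^ 2 - 2 * c * (w y * f y) + c ^ 2 * w y :=
    fun y => by ring
  simp only [h4] at h3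
  have i1 : Integrable (fun y => w y * f y ^ 2 - 2 * c * (w y * f y)) (cellMeasure N) :=
    hf2.sub (hf.const_mul _)
  rw [integral_add i1 (hw.const_mul _), integral_sub hf2 (hf.const_mul _), integral_const_mul,
    integral_const_mul, ← hc, h1] at h3
  nlinarith

/-- Mollification is a contraction in `L²`. -/
lemma integral_sq_mollify_le (n : ℕ) {f : Space N → E} (hf : MemLp f 2 (cellMeasure N)) :
    ∫ y, ‖mollify n f y‖ ^ 2 ∂cellMeasure N ≤ ∫ y, ‖f y‖ ^ 2 ∂cellMeasure N := by
  have hf1 : Integrable f (cellMeasure N) := hf.integrable (by norm_num)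
  have hf2 : Integrable (fun z => ‖f z‖ ^ 2) (cellMeasure N) := hf.integrable_norm_pow (by norm_num)
  have hKc := continuous_cosineKernel (N := N) n
  obtain ⟨C, -, hC⟩ := (isYPeriodic_cosineKernel (N := N) n).exists_bound hKc
  have hi : Integrable (uncurry fun y z => cosineKernel n (y - z) * ‖f z‖ ^ 2)
      ((cellMeasure N).prod (cellMeasure N)) := by
    have h1 : Integrable (fun w : Space N × Space N => ‖f w.2‖ ^ 2)
        ((cellMeasure N).prod (cellMeasure N)) := hf2.comp_snd (cellMeasure N)
    have h2 : AEStronglyMeasurable (fun w : Space N × Space N => cosineKernel n (w.1 - w.2))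
        ((cellMeasure N).prod (cellMeasure N)) := Continuous.aestronglyMeasurable (by fun_prop)
    exact h1.bdd_mul h2 (Eventually.of_forall fun z => hC _)
  have hpt : ∀ y, ‖mollify n f y‖ ^ 2 ≤ ∫ z, cosineKernel n (y - z) * ‖f z‖ ^ 2 ∂cellMeasure N := by
    intro y
    have h1 : ‖mollify n f y‖ ≤ ∫ z, cosineKernel n (y - z) * ‖f z‖ ∂cellMeasure N := by
      refine (norm_integral_le_integral_norm _).trans_eq ?_
      simp only [norm_smul, Real.norm_of_nonneg (cosineKernel_nonneg n _)]
    refine (pow_le_pow_left₀ (norm_nonneg _) h1 2).trans ?_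
    refine sq_integral_mul_le ?_ (fun z => cosineKernel_nonneg n _)
      (integral_cosineKernel_right n y) (integrable_mollify n hf1.norm y)
      (integrable_mollify n hf2 y)
    simpa using integrable_mollify n (integrable_const (1 : ℝ)) y
  calc ∫ y, ‖mollify n f y‖ ^ 2 ∂cellMeasure N
      ≤ ∫ y, ∫ z, cosineKernel n (y - z) * ‖f z‖ ^ 2 ∂cellMeasure N ∂cellMeasure N :=
        integral_mono_of_nonneg (Eventually.of_forall fun y => by positivity)
          hi.integral_prod_left (Eventually.of_forall hpt)
    _ = ∫ z, ∫ y, cosineKernel n (y - z) * ‖f z‖ ^ 2 ∂cellMeasure N ∂cellMeasure N :=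
        integral_integral_swap hi
    _ = ∫ z, ‖f z‖ ^ 2 ∂cellMeasure N := by
        simp only [integral_mul_const, integral_cosineKernel_left, one_mul]

lemma mollify_sub (n : ℕ) {f g : Space N → E} (hf : Integrable f (cellMeasure N))
    (hg : Integrable g (cellMeasure N)) (y : Space N) :
    mollify n (fun z => f z - g z) y = mollify n f y - mollify n g y := by
  simp only [mollify, smul_sub]
  exact integral_sub (integrable_mollify n hf y) (integrable_mollify n hg y)

/-- `L²` convergence of mollifications. -/
theorem tendsto_integral_sq_mollify_sub [CompleteSpace E] {f : Space N → E}
    (hf : MemLp f 2 (cellMeasure N)) :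
    Tendsto (fun n => ∫ y, ‖mollify n f y - f y‖ ^ 2 ∂cellMeasure N) atTop (𝓝 0) := by
  have hmem : ∀ n {f : Space N → E}, MemLp f 2 (cellMeasure N) →
      MemLp (mollify n f) 2 (cellMeasure N) := fun n f hf =>
    (continuous_mollify n (hf.integrable (by norm_num))).memLp_cell 2
  -- the convergence for bounded continuous functions, by dominated convergence
  have hbc : ∀ G : BoundedContinuousFunction (Space N) E,
      Tendsto (fun n => ∫ y, ‖mollify n G y - G y‖ ^ 2 ∂cellMeasure N) atTop (𝓝 0) := by
    intro G
    have hGc := G.continuous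
    have hGi : Integrable G (cellMeasure N) := hGc.integrable_cell
    have h0 : ∫ _y, (0 : ℝ) ∂cellMeasure N = 0 := by simp
    rw [← h0]
    refine tendsto_integral_of_dominated_convergence (fun _ => (2 * ‖G‖) ^ 2)
      (fun n => ?_) (integrable_const _) (fun n => Eventually.of_forall fun y => ?_) ?_
    · have := continuous_mollify n hGi
      exact Continuous.aestronglyMeasurable (by fun_prop)
    · have h1 : ‖mollify n G y‖ ≤ ‖G‖ := by
        have h2 : ‖mollify n G y‖ ≤ ∫ z, cosineKernel n (y - z) * ‖G‖ ∂cellMeasure N := by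
          refine norm_integral_le_of_norm_le
            (integrable_mollify n (integrable_const (‖G‖ : ℝ)) y) (Eventually.of_forall fun z => ?_)
          rw [norm_smul, Real.norm_of_nonneg (cosineKernel_nonneg n _)]
          exact mul_le_mul_of_nonneg_left (G.norm_coe_le_norm z) (cosineKernel_nonneg n _)
        rwa [integral_mul_const, integral_cosineKernel_right, one_mul] at h2
      rw [Real.norm_of_nonneg (by positivity)]
      refine pow_le_pow_left₀ (norm_nonneg _) ((norm_sub_le _ _).trans ?_) 2
      linarith [G.norm_coe_le_norm y]
    · filter_upwards [ae_mem_unitCell] with y hy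
      have h1 := ((tendsto_mollify hGc hy).sub_const (G y)).norm.pow 2
      simpa using h1
  refine Metric.tendsto_atTop.2 fun ε hε => ?_
  have hδ : 0 < Real.sqrt (ε / 12) := Real.sqrt_pos.2 (by positivity)
  obtain ⟨G, hG, hGm⟩ := hf.exists_boundedContinuous_eLpNorm_sub_le (by norm_num)
    (ε := ENNReal.ofReal (Real.sqrt (ε / 12))) (by simpa using hδ)
  have hfG : MemLp (fun y => f y - G y) 2 (cellMeasure N) := hf.sub hGm
  have hG2 : ∫ y, ‖f y - G y‖ ^ 2 ∂cellMeasure N ≤ ε / 12 := by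
    have h1 := hfG.eLpNorm_eq_integral_rpow_norm (by norm_num) (by norm_num)
    have h2 : eLpNorm (fun y => f y - G y) 2 (cellMeasure N) ≤ ENNReal.ofReal √(ε / 12) := hG
    rw [h1, ENNReal.ofReal_le_ofReal_iff hδ.le] at h2
    simp only [ENNReal.toReal_ofNat, Real.rpow_two, ← one_div, ← Real.sqrt_eq_rpow] at h2
    exact (Real.sqrt_le_sqrt_iff (by positivity)).1 h2
  obtain ⟨n₀, hn₀⟩ := Metric.tendsto_atTop.1 (hbc G) (ε / 6) (by positivity)
  refine ⟨n₀, fun n hn => ?_⟩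
  have h1 := hn₀ n hn
  have hnn : ∀ u : Space N → E, 0 ≤ ∫ y, ‖u y‖ ^ 2 ∂cellMeasure N :=
    fun u => integral_nonneg fun y => by positivity
  rw [Real.dist_0_eq_abs, abs_of_nonneg (hnn fun y => mollify n G y - G y)] at h1
  rw [Real.dist_0_eq_abs, abs_of_nonneg (hnn fun y => mollify n f y - f y)]
  have i1 : Integrable (fun y => ‖mollify n (fun z => f z - G z) y‖ ^ 2) (cellMeasure N) :=
    (hmem n hfG).integrable_norm_pow (by norm_num)
  have i2 : Integrable (fun y => ‖mollify n G y - G y‖ ^ 2) (cellMeasure N) :=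
    ((hmem n hGm).sub hGm).integrable_norm_pow (by norm_num)
  have i3 : Integrable (fun y => ‖f y - G y‖ ^ 2) (cellMeasure N) :=
    hfG.integrable_norm_pow (by norm_num)
  have i4 : Integrable (fun y => 3 * ‖mollify n (fun z => f z - G z) y‖ ^ 2
      + 3 * ‖mollify n G y - G y‖ ^ 2) (cellMeasure N) := (i1.const_mul 3).add (i2.const_mul 3)
  have h2 : ∫ y, ‖mollify n f y - f y‖ ^ 2 ∂cellMeasure N
      ≤ ∫ y, (3 * ‖mollify n (fun z => f z - G z) y‖ ^ 2 + 3 * ‖mollify n G y - G y‖ ^ 2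
        + 3 * ‖f y - G y‖ ^ 2) ∂cellMeasure N := by
    refine integral_mono (((hmem n hf).sub hf).integrable_norm_pow (by norm_num))
      (i4.add (i3.const_mul 3)) fun y => ?_
    have h3 := mollify_sub n (hf.integrable (by norm_num)) (hGm.integrable (by norm_num)) y
    have h4 : mollify n f y - f y = mollify n (fun z => f z - G z) y + (mollify n G y - G y)
        - (f y - G y) := by
      rw [h3]; abel
    have h5 : ‖mollify n f y - f y‖ ≤ ‖mollify n (fun z => f z - G z) y‖
        + ‖mollify n G y - G y‖ + ‖f y - G y‖ := by
      rw [h4]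
      exact (norm_sub_le _ _).trans (add_le_add_left (norm_add_le _ _) _)
    have h6 := pow_le_pow_left₀ (norm_nonneg _) h5 2
    simp only
    nlinarith [sq_nonneg (‖mollify n (fun z => f z - G z) y‖ - ‖mollify n G y - G y‖),
      sq_nonneg (‖mollify n (fun z => f z - G z) y‖ - ‖f y - G y‖),
      sq_nonneg (‖mollify n G y - G y‖ - ‖f y - G y‖)]
  rw [integral_add i4 (i3.const_mul 3), integral_add (i1.const_mul 3) (i2.const_mul 3),
    integral_const_mul, integral_const_mul, integral_const_mul] at h2
  have h7 := integral_sq_mollify_le n hfG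
  linarith

end Mollification

section FluxDensity
open Filter Topology Metric Function
open scoped RealInnerProductSpace ENNReal

variable {N : ℕ}

/-! ### Stability of stationary densities -/

/-- `θ` is a positive periodic probability density with weak gradient `g` which solves
`div (T ∇θ + θ β) = 0`. -/
structure IsFluxDensity (T : Space N → Space N →L[ℝ] Space N) (β : Space N → Space N)
    (θ : Space N → ℝ) (g : Space N → Space N) : Prop where
  cont_T : Continuous T
  cont_β : Continuous β
  cont : Continuous θ
  periodic : IsYPeriodic θ
  pos : ∀ y, 0 < θ y
  memLp : MemLp g 2 (cellMeasure N)
  weak : ∀ φ : Space N → ℝ, ContDiff ℝ 1 φ → IsYPeriodic φ → ∀ i,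
    ∫ y in unitCell N, θ y * pderiv i φ y = -∫ y in unitCell N, g y i * φ y
  flux : ∀ φ : Space N → ℝ, ContDiff ℝ 2 φ → IsYPeriodic φ →
    ∫ y, ⟪T y (g y) + θ y • β y, gradient φ y⟫ ∂cellMeasure N = 0
  mass : ∫ y, θ y ∂cellMeasure N = 1

section Integrals

variable {α E : Type*} [MeasurableSpace α] {μ : Measure α} [NormedAddCommGroup E]
  [InnerProductSpace ℝ E]

lemma MeasureTheory.MemLp.integrable_inner_two {F G : α → E} (hF : MemLp F 2 μ) (hG : MemLp G 2 μ) :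
    Integrable (fun y => ⟪F y, G y⟫) μ := by
  have h1 : Integrable (fun y => ‖F y‖ * ‖G y‖) μ := hF.norm.integrable_mul hG.norm
  exact h1.mono' (hF.1.inner hG.1) (Eventually.of_forall fun y => norm_inner_le_norm _ _)

lemma abs_integral_inner_le {F G : α → E} (hF : MemLp F 2 μ) (hG : MemLp G 2 μ) :
    |∫ y, ⟪F y, G y⟫ ∂μ| ≤ √(∫ y, ‖F y‖ ^ 2 ∂μ) * √(∫ y, ‖G y‖ ^ 2 ∂μ) := by
  have h2 : (2 : ℝ≥0∞) = ENNReal.ofReal 2 := by norm_num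
  have h1 := integral_mul_norm_le_Lp_mul_Lq (μ := μ) (f := F) (g := G) Real.HolderConjugate.two_two
    (by rwa [← h2]) (by rwa [← h2])
  simp only [Real.rpow_two, ← Real.sqrt_eq_rpow] at h1
  refine le_trans ?_ h1
  rw [← Real.norm_eq_abs]
  refine norm_integral_le_of_norm_le (hF.norm.integrable_mul hG.norm)
    (Eventually.of_forall fun y => norm_inner_le_norm _ _)

lemma tendsto_integral_inner {F G : α → E} {Gn : ℕ → α → E} (hF : MemLp F 2 μ) (hG : MemLp G 2 μ)
    (hGn : ∀ n, MemLp (Gn n) 2 μ)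
    (h : Tendsto (fun n => ∫ y, ‖Gn n y - G y‖ ^ 2 ∂μ) atTop (𝓝 0)) :
    Tendsto (fun n => ∫ y, ⟪F y, Gn n y⟫ ∂μ) atTop (𝓝 (∫ y, ⟪F y, G y⟫ ∂μ)) := by
  rw [tendsto_iff_norm_sub_tendsto_zero]
  have h1 := (h.sqrt.const_mul √(∫ y, ‖F y‖ ^ 2 ∂μ))
  rw [Real.sqrt_zero, mul_zero] at h1
  refine squeeze_zero (fun n => norm_nonneg _) (fun n => ?_) h1
  rw [← integral_sub (hF.integrable_inner_two (hGn n)) (hF.integrable_inner_two hG)]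
  simp only [← inner_sub_right]
  exact abs_integral_inner_le hF ((hGn n).sub hG)

end Integrals

lemma gradient_mul {f h : Space N → ℝ} {y : Space N} (hf : DifferentiableAt ℝ f y)
    (hh : DifferentiableAt ℝ h y) :
    gradient (fun y => f y * h y) y = f y • gradient h y + h y • gradient f y := by
  simp only [gradient, fderiv_fun_mul hf hh, map_add]
  congr 1 <;> exact map_smul _ _ _

/-- Smooth periodic approximation of a continuous periodic function with a weak gradient. -/
lemma exists_smooth_approx {θ : Space N → ℝ} {g : Space N → Space N} (hθ : Continuous θ)
    (hg : MemLp g 2 (cellMeasure N))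
    (hw : ∀ φ : Space N → ℝ, ContDiff ℝ 1 φ → IsYPeriodic φ → ∀ i,
      ∫ y in unitCell N, θ y * pderiv i φ y = -∫ y in unitCell N, g y i * φ y)
    {lo hi : ℝ} (h : ∀ y, θ y ∈ Icc lo hi) :
    ∃ u : ℕ → Space N → ℝ, (∀ n, ContDiff ℝ 2 (u n)) ∧ (∀ n, IsYPeriodic (u n)) ∧
      (∀ n y, u n y ∈ Icc lo hi) ∧
      (∀ y ∈ unitCell N, Tendsto (fun n => u n y) atTop (𝓝 (θ y))) ∧
      Tendsto (fun n => ∫ y, ‖gradient (u n) y - g y‖ ^ 2 ∂cellMeasure N) atTop (𝓝 0) := by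
  have hθi := hθ.integrable_cell
  have hgi : Integrable g (cellMeasure N) := hg.integrable (by norm_num)
  refine ⟨fun n => mollify n θ, fun n => contDiff_mollify n hθi, fun n => isYPeriodic_mollify n θ,
    fun n => mollify_mem_Icc n hθi h, fun y hy => tendsto_mollify hθ hy, ?_⟩
  simp only [gradient_mollify _ hθi hgi hw]
  exact tendsto_integral_sq_mollify_sub hg

variable {T T₁ T₂ : Space N → Space N →L[ℝ] Space N} {β β₁ β₂ g g₁ g₂ : Space N → Space N}
  {θ θ₁ θ₂ : Space N → ℝ}

lemma MeasureTheory.MemLp.clm_apply_cell (hT : Continuous T) (hg : MemLp g 2 (cellMeasure N)) :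
    MemLp (fun y => T y (g y)) 2 (cellMeasure N) := by
  obtain ⟨C, hC⟩ := hT.exists_bound_cell
  refine hg.of_le_mul (c := C) ((ContinuousLinearMap.id ℝ _).aestronglyMeasurable_comp₂
    hT.integrable_cell.aestronglyMeasurable hg.1) ?_
  filter_upwards [ae_mem_unitCell] with y hy
  exact (T y).le_of_opNorm_le (hC y hy) _

lemma IsFluxDensity.memLp_flux (h : IsFluxDensity T β θ g) :
    MemLp (fun y => T y (g y) + θ y • β y) 2 (cellMeasure N) :=
  (h.memLp.clm_apply_cell h.cont_T).add ((h.cont.smul h.cont_β).memLp_cell 2)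

lemma ContDiff.memLp_gradient {φ : Space N → ℝ} (hφ : ContDiff ℝ 2 φ) :
    MemLp (gradient φ) 2 (cellMeasure N) :=
  (hφ.of_le (by norm_num)).continuous_gradient.memLp_cell 2

/-- The energy estimate. -/
lemma IsFluxDensity.integral_sq_gradient_le (h : IsFluxDensity T β θ g) {m B : ℝ} (hm : 0 < m)
    (hell : ∀ y v, m * ‖v‖ ^ 2 ≤ ⟪T y v, v⟫) (hB : ∀ y, ‖β y‖ ≤ B) :
    ∫ y, ‖g y‖ ^ 2 ∂cellMeasure N ≤ (B / m) ^ 2 * ∫ y, θ y ^ 2 ∂cellMeasure N := by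
  obtain ⟨C, -, hC⟩ := h.periodic.exists_bound h.cont
  obtain ⟨u, hu, hup, -, -, hug⟩ := exists_smooth_approx h.cont h.memLp h.weak
    (lo := -C) (hi := C) fun y => abs_le.1 (hC y)
  have h0 : ∫ y, ⟪T y (g y) + θ y • β y, g y⟫ ∂cellMeasure N = 0 := by
    refine tendsto_nhds_unique (tendsto_integral_inner h.memLp_flux h.memLp
      (fun n => (hu n).memLp_gradient) hug) ?_
    simp only [h.flux _ (hu _) (hup _)]
    exact tendsto_const_nhds
  have i1 : Integrable (fun y => ‖g y‖ ^ 2) (cellMeasure N) :=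
    h.memLp.integrable_norm_pow (by norm_num)
  have i2 : Integrable (fun y => θ y ^ 2) (cellMeasure N) := (h.cont.pow 2).integrable_cell
  have i3 := h.memLp_flux.integrable_inner_two h.memLp
  have hpt : ∀ y, m / 2 * ‖g y‖ ^ 2
      ≤ B ^ 2 / (2 * m) * θ y ^ 2 + ⟪T y (g y) + θ y • β y, g y⟫ := by
    intro y
    have h1 := hell y (g y)
    have h2 : -(θ y * (B * ‖g y‖)) ≤ θ y * ⟪β y, g y⟫ := by
      rw [← mul_neg]
      refine mul_le_mul_of_nonneg_left ?_ (h.pos y).le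
      have h3 := (abs_le.1 (abs_real_inner_le_norm (β y) (g y))).1
      have h4 := mul_le_mul_of_nonneg_right (hB y) (norm_nonneg (g y))
      linarith
    rw [inner_add_left, real_inner_smul_left]
    have h5 : B ^ 2 / (2 * m) * θ y ^ 2 - θ y * (B * ‖g y‖) + m / 2 * ‖g y‖ ^ 2
        = (B * θ y - m * ‖g y‖) ^ 2 / (2 * m) := by
      field_simp
      ring
    have h6 : 0 ≤ (B * θ y - m * ‖g y‖) ^ 2 / (2 * m) := by positivity
    linarith
  have h7 := integral_mono (i1.const_mul (m / 2)) ((i2.const_mul (B ^ 2 / (2 * m))).add i3) hpt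
  simp only [Pi.add_apply] at h7
  rw [integral_add (i2.const_mul _) i3, integral_const_mul, integral_const_mul, h0, add_zero] at h7
  have h8 : (B / m) ^ 2 * ∫ y, θ y ^ 2 ∂cellMeasure N
      = 2 / m * (B ^ 2 / (2 * m) * ∫ y, θ y ^ 2 ∂cellMeasure N) := by
    field_simp
  have h9 : ∫ y, ‖g y‖ ^ 2 ∂cellMeasure N
      = 2 / m * (m / 2 * ∫ y, ‖g y‖ ^ 2 ∂cellMeasure N) := by
    field_simp
  rw [h8, h9]
  exact mul_le_mul_of_nonneg_left h7 (by positivity)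

/-- The estimate for the quotient of two densities, in terms of smooth approximations `u = h v` of
the second and `v` of the first. The second equation is tested with `h` and the first one
with `h²`. -/
lemma IsFluxDensity.integral_sq_gradient_quotient_le (h₁ : IsFluxDensity T₁ β₁ θ₁ g₁)
    (h₂ : IsFluxDensity T₂ β₂ θ₂ g₂) {m δ η C B R : ℝ} (hm : 0 < m) (hδ : 0 < δ)
    (hell : ∀ y v, m * ‖v‖ ^ 2 ≤ ⟪T₁ y v, v⟫) (hT : ∀ y, ‖T₂ y - T₁ y‖ ≤ η)
    (hβ : ∀ y, ‖β₂ y - β₁ y‖ ≤ η) (hC : ∀ y, ‖T₁ y‖ ≤ C) (hB : ∀ y, ‖β₁ y‖ ≤ B)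
    {v h : Space N → ℝ} (hv : ContDiff ℝ 2 v) (hh : ContDiff ℝ 2 h) (hhp : IsYPeriodic h)
    (hvδ : ∀ y, δ ≤ v y) (hR : ∀ y, h y ∈ Icc 0 R) :
    (m * δ) ^ 2 * ∫ y, ‖gradient h y‖ ^ 2 ∂cellMeasure N ≤
      5 * (η ^ 2 * ∫ y, ‖g₂ y‖ ^ 2 ∂cellMeasure N + η ^ 2 * ∫ y, θ₂ y ^ 2 ∂cellMeasure N
        + C ^ 2 * ∫ y, ‖gradient (fun y => h y * v y) y - g₂ y‖ ^ 2 ∂cellMeasure N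
        + (R * C) ^ 2 * ∫ y, ‖gradient v y - g₁ y‖ ^ 2 ∂cellMeasure N
        + B ^ 2 * ∫ y, (θ₂ y - h y * θ₁ y) ^ 2 ∂cellMeasure N) := by
  have hh1 : ∀ y, DifferentiableAt ℝ h y := hh.differentiable two_ne_zero
  have hv1 : ∀ y, DifferentiableAt ℝ v y := hv.differentiable two_ne_zero
  have hhc := hh.continuous
  have c1 := h₁.cont
  have c2 := h₂.cont
  have e2 := h₂.flux h hh hhp
  have e1 := h₁.flux (fun y => h y * h y) (hh.mul hh) fun i y => by simp only [hhp i y]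
  have j2 := h₂.memLp_flux.integrable_inner_two hh.memLp_gradient
  have j1 := h₁.memLp_flux.integrable_inner_two (hh.mul hh).memLp_gradient
  have i0 : Integrable (fun y => ‖gradient h y‖ ^ 2) (cellMeasure N) :=
    hh.memLp_gradient.integrable_norm_pow (by norm_num)
  have i1 : Integrable (fun y => ‖g₂ y‖ ^ 2) (cellMeasure N) :=
    h₂.memLp.integrable_norm_pow (by norm_num)
  have i2 : Integrable (fun y => θ₂ y ^ 2) (cellMeasure N) := (c2.pow 2).integrable_cell
  have i3 : Integrable (fun y => ‖gradient (fun y => h y * v y) y - g₂ y‖ ^ 2) (cellMeasure N) :=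
    ((hh.mul hv).memLp_gradient.sub h₂.memLp).integrable_norm_pow (by norm_num)
  have i4 : Integrable (fun y => ‖gradient v y - g₁ y‖ ^ 2) (cellMeasure N) :=
    (hv.memLp_gradient.sub h₁.memLp).integrable_norm_pow (by norm_num)
  have i5 : Integrable (fun y => (θ₂ y - h y * θ₁ y) ^ 2) (cellMeasure N) :=
    Continuous.integrable_cell (by fun_prop)
  set κ := m * δ with hκ
  have hκ0 : 0 < κ := mul_pos hm hδ
  let Q : Space N → ℝ := fun y => 5 * (η ^ 2 * ‖g₂ y‖ ^ 2 + η ^ 2 * θ₂ y ^ 2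
    + C ^ 2 * ‖gradient (fun y => h y * v y) y - g₂ y‖ ^ 2
    + (R * C) ^ 2 * ‖gradient v y - g₁ y‖ ^ 2 + B ^ 2 * (θ₂ y - h y * θ₁ y) ^ 2)
  have iQ : Integrable Q (cellMeasure N) :=
    (((((i1.const_mul _).add (i2.const_mul _)).add (i3.const_mul _)).add (i4.const_mul _)).add
      (i5.const_mul _)).const_mul 5
  have hpt : ∀ y, κ / 2 * ‖gradient h y‖ ^ 2 ≤ 1 / (2 * κ) * Q y
      + ⟪T₂ y (g₂ y) + θ₂ y • β₂ y, gradient h y⟫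
      - 1 / 2 * ⟪T₁ y (g₁ y) + θ₁ y • β₁ y, gradient (fun y => h y * h y) y⟫ := by
    intro y
    set D := gradient h y with hD
    set U := gradient (fun y => h y * v y) y with hU
    set V := gradient v y with hV
    have hUV : U = h y • V + v y • D := gradient_mul (hh1 y) (hv1 y)
    have hhh : gradient (fun y => h y * h y) y = h y • D + h y • D := gradient_mul (hh1 y) (hh1 y)
    obtain ⟨hh0, hhR⟩ := hR y
    -- the remainder in the difference of the two fluxes
    set Z := (T₂ y - T₁ y) (g₂ y) - T₁ y (U - g₂ y) + h y • T₁ y (V - g₁ y)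
      + θ₂ y • (β₂ y - β₁ y) + (θ₂ y - h y * θ₁ y) • β₁ y with hZ
    have hdec : ⟪T₂ y (g₂ y) + θ₂ y • β₂ y, D⟫
        - 1 / 2 * ⟪T₁ y (g₁ y) + θ₁ y • β₁ y, gradient (fun y => h y * h y) y⟫
        = v y * ⟪T₁ y D, D⟫ + ⟪Z, D⟫ := by
      rw [hhh, hZ, hUV]
      simp only [inner_add_left, inner_add_right, inner_sub_left, real_inner_smul_left,
        real_inner_smul_right, map_add, map_sub, map_smul, _root_.sub_apply]
      ring
    have hell' : κ * ‖D‖ ^ 2 ≤ v y * ⟪T₁ y D, D⟫ := by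
      calc κ * ‖D‖ ^ 2 = δ * (m * ‖D‖ ^ 2) := by rw [hκ]; ring
        _ ≤ v y * ⟪T₁ y D, D⟫ :=
          mul_le_mul (hvδ y) (hell y D) (by positivity) (hδ.le.trans (hvδ y))
    have hZQ : ‖Z‖ ^ 2 ≤ Q y := by
      have n1 : ‖(T₂ y - T₁ y) (g₂ y)‖ ≤ η * ‖g₂ y‖ :=
        ContinuousLinearMap.le_of_opNorm_le _ (hT y) _
      have n2 : ‖T₁ y (U - g₂ y)‖ ≤ C * ‖U - g₂ y‖ := ContinuousLinearMap.le_of_opNorm_le _ (hC y) _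
      have n3 : ‖h y • T₁ y (V - g₁ y)‖ ≤ R * C * ‖V - g₁ y‖ := by
        rw [norm_smul, Real.norm_of_nonneg hh0, mul_assoc]
        exact mul_le_mul hhR (ContinuousLinearMap.le_of_opNorm_le _ (hC y) _) (norm_nonneg _)
          (hh0.trans hhR)
      have n4 : ‖θ₂ y • (β₂ y - β₁ y)‖ ≤ η * θ₂ y := by
        rw [norm_smul, Real.norm_of_nonneg (h₂.pos y).le, mul_comm]
        exact mul_le_mul_of_nonneg_right (hβ y) (h₂.pos y).le
      have n5 : ‖(θ₂ y - h y * θ₁ y) • β₁ y‖ ≤ B * |θ₂ y - h y * θ₁ y| := by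
        rw [norm_smul, Real.norm_eq_abs, mul_comm]
        exact mul_le_mul_of_nonneg_right (hB y) (abs_nonneg _)
      have hn : ‖Z‖ ≤ η * ‖g₂ y‖ + C * ‖U - g₂ y‖ + R * C * ‖V - g₁ y‖ + η * θ₂ y
          + B * |θ₂ y - h y * θ₁ y| := by
        refine (norm_add_le _ _).trans (add_le_add ((norm_add_le _ _).trans (add_le_add
          ((norm_add_le _ _).trans (add_le_add ((norm_sub_le _ _).trans (add_le_add n1 n2)) n3))
          n4)) n5)
      refine (pow_le_pow_left₀ (norm_nonneg _) hn 2).trans ?_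
      have hsq : ∀ a b c d e : ℝ, (a + b + c + d + e) ^ 2
          ≤ 5 * (a ^ 2 + d ^ 2 + b ^ 2 + c ^ 2 + e ^ 2) := fun a b c d e => by
        nlinarith [sq_nonneg (a - b), sq_nonneg (a - c), sq_nonneg (a - d), sq_nonneg (a - e),
          sq_nonneg (b - c), sq_nonneg (b - d), sq_nonneg (b - e), sq_nonneg (c - d),
          sq_nonneg (c - e), sq_nonneg (d - e)]
      refine (hsq _ _ _ _ _).trans_eq ?_
      simp only [Q, mul_pow, sq_abs, hU, hV]
    have hY : -(1 / (2 * κ) * ‖Z‖ ^ 2 + κ / 2 * ‖D‖ ^ 2) ≤ ⟪Z, D⟫ := by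
      have h3 := (abs_le.1 (abs_real_inner_le_norm Z D)).1
      have h4 : 1 / (2 * κ) * ‖Z‖ ^ 2 + κ / 2 * ‖D‖ ^ 2 - ‖Z‖ * ‖D‖
          = (‖Z‖ - κ * ‖D‖) ^ 2 / (2 * κ) := by
        field_simp
        ring
      have h5 : 0 ≤ (‖Z‖ - κ * ‖D‖) ^ 2 / (2 * κ) := by positivity
      linarith
    have hQ' : 1 / (2 * κ) * ‖Z‖ ^ 2 ≤ 1 / (2 * κ) * Q y :=
      mul_le_mul_of_nonneg_left hZQ (by positivity)
    linarith
  have k1 : Integrable (fun y => 1 / (2 * κ) * Q y + ⟪T₂ y (g₂ y) + θ₂ y • β₂ y, gradient h y⟫)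
    (cellMeasure N) := (iQ.const_mul _).add j2
  have h7 := integral_mono (i0.const_mul (κ / 2)) (k1.sub (j1.const_mul (1 / 2))) hpt
  simp only [Pi.sub_apply] at h7
  rw [integral_sub k1 (j1.const_mul _), integral_add (iQ.const_mul _) j2,
    integral_const_mul (κ / 2) (fun y => ‖gradient h y‖ ^ 2), integral_const_mul (1 / (2 * κ)) Q,
    integral_const_mul (1 / 2 : ℝ)
      (fun y => ⟪T₁ y (g₁ y) + θ₁ y • β₁ y, gradient (fun y => h y * h y) y⟫),
    e1, e2, mul_zero, add_zero, sub_zero] at h7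
  have hQi : ∫ y, Q y ∂cellMeasure N =
      5 * (η ^ 2 * ∫ y, ‖g₂ y‖ ^ 2 ∂cellMeasure N + η ^ 2 * ∫ y, θ₂ y ^ 2 ∂cellMeasure N
        + C ^ 2 * ∫ y, ‖gradient (fun y => h y * v y) y - g₂ y‖ ^ 2 ∂cellMeasure N
        + (R * C) ^ 2 * ∫ y, ‖gradient v y - g₁ y‖ ^ 2 ∂cellMeasure N
        + B ^ 2 * ∫ y, (θ₂ y - h y * θ₁ y) ^ 2 ∂cellMeasure N) := by
    have k2 : Integrable (fun y => η ^ 2 * ‖g₂ y‖ ^ 2 + η ^ 2 * θ₂ y ^ 2) (cellMeasure N) :=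
      (i1.const_mul _).add (i2.const_mul _)
    have k3 : Integrable (fun y => η ^ 2 * ‖g₂ y‖ ^ 2 + η ^ 2 * θ₂ y ^ 2
      + C ^ 2 * ‖gradient (fun y => h y * v y) y - g₂ y‖ ^ 2) (cellMeasure N) :=
      k2.add (i3.const_mul _)
    have k4 : Integrable (fun y => η ^ 2 * ‖g₂ y‖ ^ 2 + η ^ 2 * θ₂ y ^ 2
      + C ^ 2 * ‖gradient (fun y => h y * v y) y - g₂ y‖ ^ 2
      + (R * C) ^ 2 * ‖gradient v y - g₁ y‖ ^ 2) (cellMeasure N) := k3.add (i4.const_mul _)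
    rw [integral_const_mul, integral_add k4 (i5.const_mul _), integral_add k3 (i4.const_mul _),
      integral_add k2 (i3.const_mul _), integral_add (i1.const_mul _) (i2.const_mul _)]
    simp only [integral_const_mul]
  rw [← hQi]
  have h8 := mul_le_mul_of_nonneg_left h7 (by positivity : 0 ≤ 2 * κ)
  calc κ ^ 2 * ∫ y, ‖gradient h y‖ ^ 2 ∂cellMeasure N
      = 2 * κ * (κ / 2 * ∫ y, ‖gradient h y‖ ^ 2 ∂cellMeasure N) := by ring
    _ ≤ _ := h8
    _ = _ := by field_simp

end FluxDensity

section Stability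
open Filter Topology Metric Function
open scoped RealInnerProductSpace ENNReal

variable {N : ℕ} {T₁ T₂ : Space N → Space N →L[ℝ] Space N} {β₁ β₂ g₁ g₂ : Space N → Space N}
  {θ₁ θ₂ : Space N → ℝ}

lemma tendsto_integral_cell {f : ℕ → Space N → ℝ} {f₀ : Space N → ℝ} (hf : ∀ n, Continuous (f n))
    {K : ℝ} (hK : ∀ n y, |f n y| ≤ K)
    (h : ∀ y ∈ unitCell N, Tendsto (fun n => f n y) atTop (𝓝 (f₀ y))) :
    Tendsto (fun n => ∫ y, f n y ∂cellMeasure N) atTop (𝓝 (∫ y, f₀ y ∂cellMeasure N)) :=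
  tendsto_integral_of_dominated_convergence (fun _ => K)
    (fun n => (hf n).integrable_cell.aestronglyMeasurable) (integrable_const _)
    (fun n => Eventually.of_forall fun y => hK n y) (ae_mem_unitCell.mono h)

/-- The variance of the quotient of two stationary densities is controlled by the distance of the
coefficients. -/
lemma IsFluxDensity.variance_quotient_le (h₁ : IsFluxDensity T₁ β₁ θ₁ g₁)
    (h₂ : IsFluxDensity T₂ β₂ θ₂ g₂) {m δ η C B : ℝ} (hm : 0 < m) (hδ : 0 < δ)
    (hell : ∀ y v, m * ‖v‖ ^ 2 ≤ ⟪T₁ y v, v⟫) (hT : ∀ y, ‖T₂ y - T₁ y‖ ≤ η)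
    (hβ : ∀ y, ‖β₂ y - β₁ y‖ ≤ η) (hC : ∀ y, ‖T₁ y‖ ≤ C) (hB : ∀ y, ‖β₁ y‖ ≤ B)
    (hθδ : ∀ y, δ ≤ θ₁ y) :
    (m * δ) ^ 2 * (∫ y, (θ₂ y / θ₁ y) ^ 2 ∂cellMeasure N - (∫ y, θ₂ y / θ₁ y ∂cellMeasure N) ^ 2)
      ≤ 5 * N * η ^ 2 * (∫ y, ‖g₂ y‖ ^ 2 ∂cellMeasure N + ∫ y, θ₂ y ^ 2 ∂cellMeasure N) := by
  obtain ⟨M₁, -, hM₁⟩ := h₁.periodic.exists_bound h₁.cont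
  obtain ⟨M₂, hM₂0, hM₂⟩ := h₂.periodic.exists_bound h₂.cont
  obtain ⟨v, hv, hvp, hvb, hvt, hvg⟩ := exists_smooth_approx h₁.cont h₁.memLp h₁.weak
    (lo := δ) (hi := M₁) fun y => ⟨hθδ y, (abs_le.1 (hM₁ y)).2⟩
  obtain ⟨u, hu, hup, hub, hut, hug⟩ := exists_smooth_approx h₂.cont h₂.memLp h₂.weak
    (lo := 0) (hi := M₂) fun y => ⟨(h₂.pos y).le, (abs_le.1 (hM₂ y)).2⟩
  have c1 := h₁.cont
  have c2 := h₂.cont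
  have hv0 : ∀ n y, 0 < v n y := fun n y => hδ.trans_le (hvb n y).1
  let h : ℕ → Space N → ℝ := fun n y => u n y / v n y
  have hh : ∀ n, ContDiff ℝ 2 (h n) := fun n => (hu n).div (hv n) fun y => (hv0 n y).ne'
  have hhp : ∀ n, IsYPeriodic (h n) := fun n i y => by simp only [h, hup n i y, hvp n i y]
  have hhc : ∀ n, Continuous (h n) := fun n => (hh n).continuous
  have hR : ∀ n y, h n y ∈ Icc 0 (M₂ / δ) := fun n y =>
    ⟨div_nonneg (hub n y).1 (hv0 n y).le, div_le_div₀ hM₂0 (hub n y).2 hδ (hvb n y).1⟩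
  have hR0 : 0 ≤ M₂ / δ := by positivity
  have hmul : ∀ n, (fun y => h n y * v n y) = u n := fun n =>
    funext fun y => div_mul_cancel₀ _ (hv0 n y).ne'
  have ht : ∀ y ∈ unitCell N, Tendsto (fun n => h n y) atTop (𝓝 (θ₂ y / θ₁ y)) := fun y hy =>
    (hut y hy).div (hvt y hy) (h₁.pos y).ne'
  have ht1 : Tendsto (fun n => ∫ y, h n y ∂cellMeasure N) atTop
      (𝓝 (∫ y, θ₂ y / θ₁ y ∂cellMeasure N)) :=
    tendsto_integral_cell hhc (K := M₂ / δ)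
      (fun n y => by rw [abs_of_nonneg (hR n y).1]; exact (hR n y).2) ht
  have ht2 : Tendsto (fun n => ∫ y, h n y ^ 2 ∂cellMeasure N) atTop
      (𝓝 (∫ y, (θ₂ y / θ₁ y) ^ 2 ∂cellMeasure N)) :=
    tendsto_integral_cell (fun n => (hhc n).pow 2) (K := (M₂ / δ) ^ 2)
      (fun n y => by
        rw [abs_of_nonneg (sq_nonneg _)]
        exact pow_le_pow_left₀ (hR n y).1 (hR n y).2 2)
      fun y hy => (ht y hy).pow 2
  have ht3 : Tendsto (fun n => ∫ y, (θ₂ y - h n y * θ₁ y) ^ 2 ∂cellMeasure N) atTop (𝓝 0) := by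
    have h0 : ∫ y, (θ₂ y - θ₂ y / θ₁ y * θ₁ y) ^ 2 ∂cellMeasure N = 0 := by
      simp only [div_mul_cancel₀ _ (h₁.pos _).ne', sub_self]
      simp
    rw [← h0]
    refine tendsto_integral_cell (fun n => ?_) (K := (M₂ + M₂ / δ * M₁) ^ 2) (fun n y => ?_)
      fun y hy => (tendsto_const_nhds.sub ((ht y hy).mul_const _)).pow 2
    · have := hhc n
      fun_prop
    · rw [abs_of_nonneg (sq_nonneg _), ← sq_abs]
      refine pow_le_pow_left₀ (abs_nonneg _) ((abs_sub _ _).trans (add_le_add (hM₂ y) ?_)) 2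
      rw [abs_mul, abs_of_nonneg (hR n y).1]
      exact mul_le_mul (hR n y).2 (hM₁ y) (abs_nonneg _) hR0
  have hlim := ((((tendsto_const_nhds (x := η ^ 2 * ∫ y, ‖g₂ y‖ ^ 2 ∂cellMeasure N
    + η ^ 2 * ∫ y, θ₂ y ^ 2 ∂cellMeasure N)).add (hug.const_mul (C ^ 2))).add
    (hvg.const_mul ((M₂ / δ * C) ^ 2))).add (ht3.const_mul (B ^ 2))).const_mul (N * 5 : ℝ)
  have hkey := le_of_tendsto_of_tendsto' ((ht2.sub (ht1.pow 2)).const_mul ((m * δ) ^ 2)) hlim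
    fun n => ?_
  · refine hkey.trans_eq ?_
    ring
  · have h3 := h₁.integral_sq_gradient_quotient_le h₂ hm hδ hell hT hβ hC hB (hv n) (hh n)
      (hhp n) (fun y => (hvb n y).1) (hR n)
    rw [hmul n] at h3
    have h4 := variance_le_of_periodic ((hh n).of_le (by norm_num)) (hhp n)
    calc _ ≤ (m * δ) ^ 2 * (N * ∫ y, ‖gradient (h n) y‖ ^ 2 ∂cellMeasure N) :=
          mul_le_mul_of_nonneg_left h4 (sq_nonneg _)
      _ = N * ((m * δ) ^ 2 * ∫ y, ‖gradient (h n) y‖ ^ 2 ∂cellMeasure N) := by ring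
      _ ≤ N * _ := mul_le_mul_of_nonneg_left h3 (Nat.cast_nonneg N)
      _ = _ := by ring

/-- Stationary densities depend continuously on the coefficients, in `L²`. -/
theorem IsFluxDensity.exists_forall_integral_sq_sub_le (h₁ : IsFluxDensity T₁ β₁ θ₁ g₁)
    {m C B : ℝ} (hm : 0 < m) (hell₁ : ∀ y v, m * ‖v‖ ^ 2 ≤ ⟪T₁ y v, v⟫) (hC : ∀ y, ‖T₁ y‖ ≤ C)
    (hB : ∀ y, ‖β₁ y‖ ≤ B) {ε : ℝ} (hε : 0 < ε) :
    ∃ η, 0 < η ∧ ∀ (T₂ : Space N → Space N →L[ℝ] Space N) (β₂ : Space N → Space N)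
      (θ₂ : Space N → ℝ) (g₂ : Space N → Space N), IsFluxDensity T₂ β₂ θ₂ g₂ →
      (∀ y v, m * ‖v‖ ^ 2 ≤ ⟪T₂ y v, v⟫) → (∀ y, ‖T₂ y - T₁ y‖ ≤ η) → (∀ y, ‖β₂ y - β₁ y‖ ≤ η) →
      ∫ y, (θ₂ y - θ₁ y) ^ 2 ∂cellMeasure N ≤ ε := by
  obtain ⟨M, hM0, hM⟩ := h₁.periodic.exists_bound h₁.cont
  have hM : ∀ y, θ₁ y ≤ M := fun y => (abs_le.1 (hM y)).2
  obtain ⟨δ, hδ, hθδ⟩ : ∃ δ, 0 < δ ∧ ∀ y, δ ≤ θ₁ y := by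
    obtain ⟨y₀, hy₀⟩ := IsYPeriodic.exists_max (f := fun y => -θ₁ y)
      (fun i y => by simp only [h₁.periodic i y]) h₁.cont.neg
    exact ⟨θ₁ y₀, h₁.pos y₀, fun y => neg_le_neg_iff.1 (hy₀.2 y)⟩
  have hB0 : 0 ≤ B := (norm_nonneg _).trans (hB 0)
  set K := 5 * N * (((B + 1) / m) ^ 2 + 1) * M ^ 2 / (m * δ) ^ 2 with hK
  have hK0 : 0 ≤ K := by positivity
  set K' := 2 * (1 + M ^ 2) * K with hK'
  have hK'0 : 0 ≤ K' := by positivity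
  -- small enough for absorbing the distance, and for the final estimate
  obtain ⟨η, hη, hη1, hη2, hη3⟩ : ∃ η : ℝ, 0 < η ∧ η ≤ 1 ∧ K' * η ^ 2 ≤ 1 / 2 ∧
      M ^ 2 * (2 * K' * η ^ 2) ≤ ε := by
    have h1 : Tendsto (fun η : ℝ => K' * η ^ 2) (𝓝[>] 0) (𝓝 0) := by
      have : Continuous fun η : ℝ => K' * η ^ 2 := by fun_prop
      simpa using (this.tendsto 0).mono_left nhdsWithin_le_nhds
    have h2 : Tendsto (fun η : ℝ => M ^ 2 * (2 * K' * η ^ 2)) (𝓝[>] 0) (𝓝 0) := by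
      have : Continuous fun η : ℝ => M ^ 2 * (2 * K' * η ^ 2) := by fun_prop
      simpa using (this.tendsto 0).mono_left nhdsWithin_le_nhds
    have h3 : ∀ᶠ η : ℝ in 𝓝[>] 0, 0 < η ∧ η ≤ 1 :=
      (Ioc_mem_nhdsGT zero_lt_one : Ioc (0 : ℝ) 1 ∈ 𝓝[>] 0)
    obtain ⟨η, ⟨ha, hb⟩, hc, hd⟩ := (h3.and
      ((h1.eventually_le_const (by norm_num : (0 : ℝ) < 1 / 2)).and
      (h2.eventually_le_const hε))).exists
    exact ⟨η, ha, hb, hc, hd⟩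
  refine ⟨η, hη, fun T₂ β₂ θ₂ g₂ h₂ hell₂ hT hβ => ?_⟩
  have c1 := h₁.cont
  have c2 := h₂.cont
  let h : Space N → ℝ := fun y => θ₂ y / θ₁ y
  have hc : Continuous h := c2.div c1 fun y => (h₁.pos y).ne'
  have hmul : ∀ y, h y * θ₁ y = θ₂ y := fun y => div_mul_cancel₀ _ (h₁.pos y).ne'
  have i1 : Integrable h (cellMeasure N) := hc.integrable_cell
  have i2 : Integrable (fun y => h y ^ 2) (cellMeasure N) := (hc.pow 2).integrable_cell
  set μ := ∫ y, h y ∂cellMeasure N with hμ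
  set Q := ∫ y, h y ^ 2 ∂cellMeasure N with hQ
  have hD : ∀ k, ∫ y, (h y - k) ^ 2 ∂cellMeasure N = Q - 2 * k * μ + k ^ 2 := by
    intro k
    have h4 : ∀ y, (h y - k) ^ 2 = h y ^ 2 - 2 * k * h y + k ^ 2 := fun y => by ring
    simp only [h4]
    have j1 : Integrable (fun y => h y ^ 2 - 2 * k * h y) (cellMeasure N) := i2.sub (i1.const_mul _)
    rw [integral_add j1 (integrable_const _), integral_sub i2 (i1.const_mul _), integral_const_mul,
      integral_const]
    simp [hμ, hQ]
  have hθ2 : ∫ y, θ₂ y ^ 2 ∂cellMeasure N ≤ M ^ 2 * Q := by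
    rw [hQ, ← integral_const_mul]
    refine integral_mono (c2.pow 2).integrable_cell (i2.const_mul _) fun y => ?_
    simp only
    rw [← hmul y, mul_pow, mul_comm]
    exact mul_le_mul_of_nonneg_right (pow_le_pow_left₀ (h₁.pos y).le (hM y) 2) (sq_nonneg _)
  have hg2 := h₂.integral_sq_gradient_le hm hell₂ (B := B + 1) fun y => by
    have h5 := norm_add_le (β₂ y - β₁ y) (β₁ y)
    rw [sub_add_cancel] at h5
    linarith [hβ y, hB y]
  have hV : Q - μ ^ 2 ≤ K * η ^ 2 * Q := by
    have h5 := h₁.variance_quotient_le h₂ hm hδ hell₁ hT hβ hC hB hθδ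
    have h6 : ∫ y, ‖g₂ y‖ ^ 2 ∂cellMeasure N + ∫ y, θ₂ y ^ 2 ∂cellMeasure N
        ≤ (((B + 1) / m) ^ 2 + 1) * (M ^ 2 * Q) := by
      calc _ ≤ (((B + 1) / m) ^ 2 + 1) * ∫ y, θ₂ y ^ 2 ∂cellMeasure N := by linarith
        _ ≤ _ := mul_le_mul_of_nonneg_left hθ2 (by positivity)
    have h7 : (m * δ) ^ 2 * (Q - μ ^ 2)
        ≤ 5 * N * η ^ 2 * ((((B + 1) / m) ^ 2 + 1) * (M ^ 2 * Q)) :=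
      h5.trans (mul_le_mul_of_nonneg_left h6 (by positivity))
    have h8 : K * η ^ 2 * Q
        = 5 * N * η ^ 2 * ((((B + 1) / m) ^ 2 + 1) * (M ^ 2 * Q)) / (m * δ) ^ 2 := by
      rw [hK]; ring
    rw [h8, le_div_iff₀ (by positivity)]
    linarith
  -- the mean of the quotient is close to one, as the densities have the same mass
  have hmean : (1 - μ) ^ 2 ≤ M ^ 2 * (Q - μ ^ 2) := by
    have h5 : ∫ y, (h y - μ) * θ₁ y ∂cellMeasure N = 1 - μ := by
      simp only [sub_mul, hmul]
      rw [integral_sub c2.integrable_cell (c1.integrable_cell.const_mul _), integral_const_mul,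
        h₁.mass, h₂.mass, mul_one]
    have h6 : Continuous fun y => (h y - μ) * θ₁ y := by fun_prop
    have h7 : Continuous fun y => (h y - μ) ^ 2 := by fun_prop
    rw [← h5]
    refine (sq_integral_le (h6.memLp_cell 2)).trans ?_
    have h8 : ∫ y, (h y - μ) ^ 2 ∂cellMeasure N = Q - μ ^ 2 := by rw [hD]; ring
    rw [← h8, ← integral_const_mul]
    refine integral_mono (h6.pow 2).integrable_cell (h7.integrable_cell.const_mul _) fun y => ?_
    simp only
    rw [mul_pow, mul_comm]
    exact mul_le_mul_of_nonneg_right (pow_le_pow_left₀ (h₁.pos y).le (hM y) 2) (sq_nonneg _)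
  set D := ∫ y, (h y - 1) ^ 2 ∂cellMeasure N with hDdef
  have hD1 : D = Q - 2 * μ + 1 := by rw [hDdef, hD]; ring
  have hQ2 : Q ≤ 2 * D + 2 := by
    have h5 := hD 2
    have h6 : 0 ≤ ∫ y, (h y - 2) ^ 2 ∂cellMeasure N := integral_nonneg fun y => sq_nonneg _
    linarith
  have hDle : D ≤ 2 * K' * η ^ 2 := by
    have h5 : D ≤ (1 + M ^ 2) * (Q - μ ^ 2) := by nlinarith
    have h6 : (1 + M ^ 2) * (Q - μ ^ 2) ≤ (1 + M ^ 2) * (K * η ^ 2 * (2 * D + 2)) :=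
      mul_le_mul_of_nonneg_left (hV.trans (mul_le_mul_of_nonneg_left hQ2 (by positivity)))
        (by positivity)
    have h7 : (1 + M ^ 2) * (K * η ^ 2 * (2 * D + 2)) = K' * η ^ 2 * D + K' * η ^ 2 := by
      rw [hK']; ring
    have h8 : 0 ≤ D := integral_nonneg fun y => sq_nonneg _
    have h9 := mul_le_mul_of_nonneg_right hη2 h8
    linarith
  refine le_trans ?_ ((mul_le_mul_of_nonneg_left hDle (sq_nonneg M)).trans hη3)
  rw [hDdef, ← integral_const_mul]
  have j1 : Continuous fun y => (θ₂ y - θ₁ y) ^ 2 := by fun_prop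
  have j2 : Continuous fun y => (h y - 1) ^ 2 := by fun_prop
  refine integral_mono j1.integrable_cell (j2.integrable_cell.const_mul _) fun y => ?_
  have h5 : θ₂ y - θ₁ y = (h y - 1) * θ₁ y := by rw [sub_mul, hmul, one_mul]
  simp only
  rw [h5, mul_pow, mul_comm]
  exact mul_le_mul_of_nonneg_right (pow_le_pow_left₀ (h₁.pos y).le (hM y) 2) (sq_nonneg _)

end Stability

section InvariantDensity
open Filter Topology Metric Function
open scoped RealInnerProductSpace ENNReal

variable {N : ℕ}

/-! ### The averaged Hamiltonian -/

/-- The linear map with matrix `Aᵀ(y)` on `ℝ^N`. -/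
noncomputable def fluxMap (A : Space N → Matrix (Fin N) (Fin N) ℝ) (y : Space N) :
    Space N →L[ℝ] Space N :=
  ∑ i, ∑ j, A y i j •
    (EuclideanSpace.proj (𝕜 := ℝ) i : Space N →L[ℝ] ℝ).smulRight (EuclideanSpace.single j 1)

/-- The vector field with components `∑ i, ∂A^{ij}/∂y_i`. -/
noncomputable def fluxDrift (A : Space N → Matrix (Fin N) (Fin N) ℝ) (y : Space N) : Space N :=
  ∑ i, ∑ j, pderiv i (fun z => A z i j) y • EuclideanSpace.single j (1 : ℝ)

variable {A : Space N → Matrix (Fin N) (Fin N) ℝ} {θ : Space N → ℝ}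

lemma inner_fluxMap (y v w : Space N) :
    ⟪fluxMap A y v, w⟫ = ∑ i, ∑ j, A y i j * v i * w j := by
  simp only [fluxMap, _root_.sum_apply, sum_inner, _root_.smul_apply,
    ContinuousLinearMap.smulRight_apply, real_inner_smul_left, EuclideanSpace.inner_single_left,
    map_one, one_mul, mul_assoc]
  rfl

lemma inner_fluxDrift (y w : Space N) :
    ⟪fluxDrift A y, w⟫ = ∑ i, ∑ j, pderiv i (fun z => A z i j) y * w j := by
  simp only [fluxDrift, sum_inner, real_inner_smul_left, EuclideanSpace.inner_single_left,
    map_one, one_mul]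

lemma IsYPeriodic.pderiv {F : Type*} [NormedAddCommGroup F] [NormedSpace ℝ F] {f : Space N → F}
    (hf : IsYPeriodic f) (i : Fin N) : IsYPeriodic (pderiv i f) :=
  fun j y => by simp only [_root_.pderiv, hf.fderiv j y]

lemma isYPeriodic_fluxMap (hA : IsYPeriodic A) : IsYPeriodic (fluxMap A) :=
  fun i y => by simp only [fluxMap, hA i y]

lemma isYPeriodic_fluxDrift (hA : IsYPeriodic A) : IsYPeriodic (fluxDrift A) := by
  intro k y
  have h : ∀ i j, IsYPeriodic fun z => A z i j := fun i j l z => by simp only [hA l z]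
  simp only [fluxDrift, (h _ _).pderiv _ k y]

/-- Integration by parts: an invariant density solves the equation in divergence form. -/
lemma IsInvariantDensity.exists_isFluxDensity (h : IsInvariantDensity A θ)
    (hA : ∀ i j, ContDiff ℝ 1 fun y => A y i j) (hp : IsYPeriodic A) :
    ∃ g, IsFluxDensity (fluxMap A) (fluxDrift A) θ g := by
  obtain ⟨hc, hper, hpos, ⟨g, hg, hw⟩, heq, hmass⟩ := h
  have hAc : ∀ i j, Continuous fun y => A y i j := fun i j => (hA i j).continuous
  have hAd : ∀ k i j, Continuous (pderiv k fun y => A y i j) := fun k i j =>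
    ((hA i j).pderiv (m := 0) (by norm_num) k).continuous
  refine ⟨g, ?_, ?_, hc, hper, hpos, hg, hw, fun φ hφ hφp => ?_, hmass⟩
  · unfold fluxMap
    fun_prop
  · unfold fluxDrift
    fun_prop
  have hφ1 : ContDiff ℝ 1 φ := hφ.of_le (by norm_num)
  have hd1 : ∀ j, ContDiff ℝ 1 (pderiv j φ) := fun j => hφ.pderiv (by norm_num) j
  have hd1c : ∀ j, Continuous (pderiv j φ) := fun j => (hd1 j).continuous
  have hd2 : ∀ i j, Continuous (pderiv i (pderiv j φ)) := fun i j =>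
    ((hd1 j).pderiv (m := 0) (by norm_num) i).continuous
  have hdp : ∀ j, IsYPeriodic (pderiv j φ) := fun j => hφp.pderiv j
  -- the test functions `A^{ij} ∂φ/∂y_j`
  have hψ : ∀ i j, ContDiff ℝ 1 fun y => A y i j * pderiv j φ y := fun i j => (hA i j).mul (hd1 j)
  have hψp : ∀ i j, IsYPeriodic fun y => A y i j * pderiv j φ y := fun i j k y => by
    simp only [hp k y, hdp j k y]
  have hψd : ∀ i j y, pderiv i (fun y => A y i j * pderiv j φ y) y
      = A y i j * pderiv i (pderiv j φ) y + pderiv i (fun z => A z i j) y * pderiv j φ y := by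
    intro i j y
    have h1 := fderiv_fun_mul ((hA i j).differentiable one_ne_zero y)
      ((hd1 j).differentiable one_ne_zero y)
    rw [_root_.pderiv, h1, _root_.add_apply, _root_.smul_apply, _root_.smul_apply, smul_eq_mul,
      smul_eq_mul, mul_comm (pderiv j φ y)]
    rfl
  have hgi : ∀ i, Integrable (fun y => g y i) (cellMeasure N) := fun i =>
    (EuclideanSpace.proj (𝕜 := ℝ) i).integrable_comp (hg.integrable (by norm_num))
  have i1 : ∀ i j, Integrable (fun y => g y i * (A y i j * pderiv j φ y)) (cellMeasure N) := by
    intro i j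
    obtain ⟨C, hC⟩ := (hψ i j).continuous.exists_bound_cell
    exact (hgi i).mul_bdd (c := C) (hψ i j).continuous.aestronglyMeasurable
      (ae_mem_unitCell.mono fun y hy => hC y hy)
  have i2 : ∀ i j, Integrable (fun y => θ y * pderiv i (fun y => A y i j * pderiv j φ y) y)
      (cellMeasure N) := fun i j => by
    have := ((hψ i j).pderiv (m := 0) (by norm_num) i).continuous
    exact Continuous.integrable_cell (by fun_prop)
  have i3 : Integrable (fun y => (∑ i, ∑ j, A y i j * pderiv i (pderiv j φ) y) * θ y)
      (cellMeasure N) := Continuous.integrable_cell (by fun_prop)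
  have hpt : ∀ y, ⟪fluxMap A y (g y) + θ y • fluxDrift A y, gradient φ y⟫
      = (∑ i, ∑ j, (g y i * (A y i j * pderiv j φ y)
          + θ y * pderiv i (fun y => A y i j * pderiv j φ y) y))
        - (∑ i, ∑ j, A y i j * pderiv i (pderiv j φ) y) * θ y := by
    intro y
    rw [inner_add_left, real_inner_smul_left, inner_fluxMap, inner_fluxDrift]
    simp only [hψd, ← pderiv_eq_gradient (hφ1.differentiable one_ne_zero y), Finset.mul_sum,
      Finset.sum_mul, ← Finset.sum_add_distrib, ← Finset.sum_sub_distrib]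
    refine Finset.sum_congr rfl fun i _ => Finset.sum_congr rfl fun j _ => ?_
    ring
  have i4 : ∀ i j, Integrable (fun y => g y i * (A y i j * pderiv j φ y)
      + θ y * pderiv i (fun y => A y i j * pderiv j φ y) y) (cellMeasure N) :=
    fun i j => (i1 i j).add (i2 i j)
  have h0 : ∀ i j, ∫ y, (g y i * (A y i j * pderiv j φ y)
      + θ y * pderiv i (fun y => A y i j * pderiv j φ y) y) ∂cellMeasure N = 0 := by
    intro i j
    rw [integral_add (i1 i j) (i2 i j), hw _ (hψ i j) (hψp i j) i, add_neg_cancel]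
  simp only [hpt]
  rw [integral_sub (integrable_finsetSum _ fun i _ => integrable_finsetSum _ fun j _ => i4 i j) i3,
    heq φ hφ hφp, integral_finsetSum _ fun i _ => integrable_finsetSum _ fun j _ => i4 i j]
  simp only [integral_finsetSum _ fun j _ => i4 _ j, h0, Finset.sum_const_zero, sub_zero]

/-- The partial derivative of a `C¹` function on `S × Y` in the second variable is continuous. -/
lemma ContDiffOn.continuousOn_fderiv_snd {X Y G : Type*} [NormedAddCommGroup X] [NormedSpace ℝ X]
    [NormedAddCommGroup Y] [NormedSpace ℝ Y] [NormedAddCommGroup G] [NormedSpace ℝ G] {S : Set X}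
    {F : X × Y → G} (hF : ContDiffOn ℝ 1 F (S ×ˢ univ)) :
    ContinuousOn (fun z : X × Y => fderiv ℝ (fun y => F (z.1, y)) z.2) (S ×ˢ univ) := by
  intro z₀ hz₀
  have h1 : ContDiffWithinAt ℝ (0 + 1) F (S ×ˢ univ) z₀ := by simpa using hF z₀ hz₀
  obtain ⟨u, hu, -, -, F', hF', hF'c⟩ :=
    (contDiffWithinAt_succ_iff_hasFDerivWithinAt' (by simp)).1 h1
  rw [insert_eq_of_mem hz₀] at hu
  have h2 : ∀ z ∈ u ∩ S ×ˢ univ, fderiv ℝ (fun y => F (z.1, y)) z.2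
      = (F' z).comp (ContinuousLinearMap.inr ℝ X Y) := by
    rintro ⟨x, y⟩ ⟨hzu, hzS⟩
    have h3 : HasFDerivWithinAt (fun y : Y => (x, y)) (ContinuousLinearMap.inr ℝ X Y) univ y :=
      (hasFDerivAt_prodMk_right x y).hasFDerivWithinAt
    have h4 := (hF' (x, y) hzu).comp y h3 fun y' _ => ⟨hzS.1, mem_univ _⟩
    exact (hasFDerivWithinAt_univ.1 h4).fderiv
  have h5 : ContinuousWithinAt (fun z => (F' z).comp (ContinuousLinearMap.inr ℝ X Y))
      (S ×ˢ univ) z₀ :=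
    (ContinuousLinearMap.compL ℝ Y (X × Y) G).flip (ContinuousLinearMap.inr ℝ X Y)
      |>.continuous.continuousAt.comp_continuousWithinAt hF'c.continuousWithinAt
  refine h5.congr_of_eventuallyEq ?_ (h2 z₀ ⟨mem_of_mem_nhdsWithin hz₀ hu, hz₀⟩)
  filter_upwards [hu, self_mem_nhdsWithin] with z hz hzS using h2 z ⟨hz, hzS⟩

variable {Ω : Set (Space N)} {a : Space N → Space N → Matrix (Fin N) (Fin N) ℝ}
  {b : Space N → Space N → Space N} {c : Space N → Space N → ℝ}

lemma StandingAssumptions.cont_fluxMap (h : StandingAssumptions Ω a b c) :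
    ContinuousOn (fun z : Space N × Space N => fluxMap (a z.1) z.2) (closure Ω ×ˢ univ) := by
  unfold fluxMap
  exact continuousOn_finsetSum _ fun i _ => continuousOn_finsetSum _ fun j _ =>
    (h.cont_a i j).smul continuousOn_const

lemma StandingAssumptions.cont_fluxDrift (h : StandingAssumptions Ω a b c) :
    ContinuousOn (fun z : Space N × Space N => fluxDrift (a z.1) z.2) (closure Ω ×ˢ univ) := by
  unfold fluxDrift pderiv
  refine continuousOn_finsetSum _ fun i _ => continuousOn_finsetSum _ fun j _ =>
    ((h.a_C1 i j).continuousOn_fderiv_snd.clm_apply continuousOn_const).smul continuousOn_const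

lemma StandingAssumptions.contDiff_slice (h : StandingAssumptions Ω a b c) {x : Space N}
    (hx : x ∈ closure Ω) (i j : Fin N) : ContDiff ℝ 1 fun y => a x y i j :=
  contDiffOn_univ.1 ((h.a_C1 i j).comp (contDiff_prodMk_right x).contDiffOn
    fun y _ => ⟨hx, mem_univ y⟩)

/-- A family continuous on `closure Ω × ℝ^N` and periodic in `y` is continuous in `x`, uniformly
in `y`. -/
lemma eventually_forall_norm_sub_le {E : Type*} [NormedAddCommGroup E]
    {f : Space N → Space N → E} {S : Set (Space N)}
    (hf : ContinuousOn (fun z : Space N × Space N => f z.1 z.2) (S ×ˢ univ))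
    (hper : ∀ x ∈ S, IsYPeriodic (f x)) {x₀ : Space N} (hx₀ : x₀ ∈ S) {ε : ℝ} (hε : 0 < ε) :
    ∀ᶠ x in 𝓝[S] x₀, ∀ y, ‖f x y - f x₀ y‖ ≤ ε := by
  have h1 : ContinuousOn (uncurry fun x y => ‖f x y - f x₀ y‖) (S ×ˢ closedCell N) := by
    have h2 : ContinuousOn (fun z : Space N × Space N => f z.1 z.2) (S ×ˢ closedCell N) :=
      hf.mono (prod_mono subset_rfl (subset_univ _))
    have h3 : ContinuousOn (fun z : Space N × Space N => f x₀ z.2) (S ×ˢ closedCell N) :=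
      hf.comp (f := fun z : Space N × Space N => (x₀, z.2)) (by fun_prop)
        fun z _ => ⟨hx₀, mem_univ _⟩
    exact (h2.sub h3).norm
  filter_upwards [eventually_forall_abs_sub_lt isCompact_closedCell h1 hx₀ hε, self_mem_nhdsWithin]
    with x hx hxS y
  have hp : IsYPeriodic fun y => f x y - f x₀ y := fun i y => by
    simp only [hper x hxS i y, hper x₀ hx₀ i y]
  obtain ⟨z, hz, hzy⟩ := hp.exists_mem_closedCell_eq y
  have h2 := hx z hz
  simp only [sub_self, norm_zero, sub_zero, abs_norm] at h2
  rw [← hzy]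
  exact h2.le

/-- The invariant densities depend continuously on the parameter, in `L²`. -/
lemma StandingAssumptions.eventually_integral_sq_sub_le (h : StandingAssumptions Ω a b c)
    {θ : Space N → Space N → ℝ} (hθ : ∀ x ∈ closure Ω, IsInvariantDensity (a x) (θ x))
    {x₀ : Space N} (hx₀ : x₀ ∈ closure Ω) {ε : ℝ} (hε : 0 < ε) :
    ∀ᶠ x in 𝓝[closure Ω] x₀, ∫ y, (θ x y - θ x₀ y) ^ 2 ∂cellMeasure N ≤ ε := by
  obtain ⟨m, hm, hell⟩ := h.elliptic
  have hell' : ∀ x ∈ closure Ω, ∀ y v, m * ‖v‖ ^ 2 ≤ ⟪fluxMap (a x) y v, v⟫ := fun x hx y v => by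
    rw [inner_fluxMap]
    exact hell x hx y v
  have hpT := fun x hx => isYPeriodic_fluxMap (h.a_periodic x hx)
  have hpβ := fun x hx => isYPeriodic_fluxDrift (h.a_periodic x hx)
  obtain ⟨g₀, hg₀⟩ := (hθ x₀ hx₀).exists_isFluxDensity (h.contDiff_slice hx₀) (h.a_periodic x₀ hx₀)
  obtain ⟨C, -, hC⟩ := (hpT x₀ hx₀).exists_bound hg₀.cont_T
  obtain ⟨B, -, hB⟩ := (hpβ x₀ hx₀).exists_bound hg₀.cont_β
  obtain ⟨η, hη, hstab⟩ := hg₀.exists_forall_integral_sq_sub_le hm (hell' x₀ hx₀) hC hB hε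
  filter_upwards [eventually_forall_norm_sub_le h.cont_fluxMap hpT hx₀ hη,
    eventually_forall_norm_sub_le h.cont_fluxDrift hpβ hx₀ hη, self_mem_nhdsWithin] with x hT hβ hx
  obtain ⟨g, hg⟩ := (hθ x hx).exists_isFluxDensity (h.contDiff_slice hx) (h.a_periodic x hx)
  exact hstab _ _ _ g hg (hell' x hx) hT hβ

lemma StandingAssumptions.continuous_micro (h : StandingAssumptions Ω a b c) (p : Space N)
    {x : Space N} (hx : x ∈ closure Ω) : Continuous (microHamiltonian a b c p x) := by
  refine continuousOn_univ.1 (h.cont_micro.comp (f := fun y : Space N => (p, x, y)) (by fun_prop)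
    fun y _ => ⟨mem_univ _, hx, mem_univ _⟩)

/-- For `α > 1`, the average of the Hamiltonian against the invariant density is continuous, convex
and coercive. -/
theorem StandingAssumptions.isConvexCoercive_of_invariantDensity (h : StandingAssumptions Ω a b c)
    {H : Space N → Space N → ℝ} (hH : ∀ x ∈ closure Ω, ∃ θ : Space N → ℝ,
      IsInvariantDensity (a x) θ ∧
      ∀ p, H p x = ∫ y in unitCell N, microHamiltonian a b c p x y * θ y) :
    IsConvexCoercive Ω H := by
  choose! θ hθ hHθ using hH
  have hθc : ∀ x ∈ closure Ω, Continuous (θ x) := fun x hx => (hθ x hx).1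
  have hθpos : ∀ x ∈ closure Ω, ∀ y, 0 < θ x y := fun x hx => (hθ x hx).2.2.1
  have hmass : ∀ x ∈ closure Ω, ∫ y, θ x y ∂cellMeasure N = 1 := fun x hx => (hθ x hx).2.2.2.2.2
  have hint : ∀ x ∈ closure Ω, ∀ p x', x' ∈ closure Ω →
      Integrable (fun y => microHamiltonian a b c p x' y * θ x y) (cellMeasure N) :=
    fun x hx p x' hx' => ((h.continuous_micro p hx').mul (hθc x hx)).integrable_cell
  refine ⟨?_, ?_, h.coercive_of_lower ?_⟩
  · rintro ⟨p₀, x₀⟩ ⟨-, hx₀⟩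
    replace hx₀ : x₀ ∈ closure Ω := hx₀
    refine Metric.tendsto_nhds.2 fun ε hε => ?_
    obtain ⟨B, hB0, hB⟩ := (h.periodic_micro p₀ hx₀).exists_bound (h.continuous_micro p₀ hx₀)
    have hδ : 0 < ε / (2 * (B + 1)) := by positivity
    have hev1 : ∀ᶠ z : Space N × Space N in 𝓝[univ ×ˢ closure Ω] (p₀, x₀),
        ∫ y, (θ z.2 y - θ x₀ y) ^ 2 ∂cellMeasure N ≤ (ε / (2 * (B + 1))) ^ 2 := by
      have ht : Tendsto Prod.snd (𝓝[univ ×ˢ closure Ω] (p₀, x₀)) (𝓝[closure Ω] x₀) :=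
        tendsto_nhdsWithin_of_tendsto_nhds_of_eventually_within _
          (continuous_snd.continuousWithinAt) (eventually_mem_nhdsWithin.mono fun z hz => hz.2)
      exact ht.eventually (h.eventually_integral_sq_sub_le hθ hx₀ (by positivity))
    have hev2 : ∀ᶠ z : Space N × Space N in 𝓝[univ ×ˢ closure Ω] (p₀, x₀), ∀ y ∈ closedCell N,
        |microHamiltonian a b c z.1 z.2 y - microHamiltonian a b c p₀ x₀ y| < ε / 4 := by
      let T : (Space N × Space N) × Space N → Space N × Space N × Space N :=
        fun w => (w.1.1, w.1.2, w.2)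
      have hT : Continuous T := by fun_prop
      have hm : MapsTo T ((univ ×ˢ closure Ω) ×ˢ closedCell N) (univ ×ˢ closure Ω ×ˢ univ) :=
        fun w hw => ⟨mem_univ _, hw.1.2, mem_univ _⟩
      have hc : ContinuousOn (uncurry fun (z : Space N × Space N) (y : Space N) =>
          microHamiltonian a b c z.1 z.2 y) ((univ ×ˢ closure Ω) ×ˢ closedCell N) :=
        (h.cont_micro.comp hT.continuousOn hm).congr fun w _ => by
          simp only [uncurry, comp_apply, T]
      have hmem : ((p₀, x₀) : Space N × Space N) ∈ univ ×ˢ closure Ω := ⟨mem_univ _, hx₀⟩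
      exact eventually_forall_abs_sub_lt isCompact_closedCell hc hmem (by positivity)
    filter_upwards [hev1, hev2, self_mem_nhdsWithin] with ⟨p, x⟩ h1 h2 hz
    obtain ⟨-, hx⟩ := hz
    replace hx : x ∈ closure Ω := hx
    have c0 := h.continuous_micro p₀ hx₀
    have c1 := h.continuous_micro p hx
    have d0 := hθc x₀ hx₀
    have d1 := hθc x hx
    rw [Real.dist_eq]
    simp only [uncurry]
    have e1 : Continuous fun y => (microHamiltonian a b c p x y - microHamiltonian a b c p₀ x₀ y)
      * θ x y := by fun_prop
    have e2 : Continuous fun y => microHamiltonian a b c p₀ x₀ y * (θ x y - θ x₀ y) := by fun_prop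
    have hsplit : H p x - H p₀ x₀
        = ∫ y, (microHamiltonian a b c p x y - microHamiltonian a b c p₀ x₀ y) * θ x y
          ∂cellMeasure N
        + ∫ y, microHamiltonian a b c p₀ x₀ y * (θ x y - θ x₀ y) ∂cellMeasure N := by
      rw [hHθ x hx, hHθ x₀ hx₀, ← integral_sub (hint x hx p x hx) (hint x₀ hx₀ p₀ x₀ hx₀),
        ← integral_add e1.integrable_cell e2.integrable_cell]
      refine integral_congr_ae (Eventually.of_forall fun y => ?_)
      simp only
      ring
    have b1 : |∫ y, (microHamiltonian a b c p x y - microHamiltonian a b c p₀ x₀ y) * θ x y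
        ∂cellMeasure N| ≤ ε / 4 := by
      rw [← Real.norm_eq_abs]
      refine (norm_integral_le_of_norm_le (g := fun y => ε / 4 * θ x y)
        (d1.integrable_cell.const_mul _) ?_).trans_eq ?_
      · filter_upwards [ae_mem_unitCell] with y hy
        rw [norm_mul, Real.norm_of_nonneg (hθpos x hx y).le]
        exact mul_le_mul_of_nonneg_right (h2 y (unitCell_subset_closedCell hy)).le (hθpos x hx y).le
      · rw [integral_const_mul, hmass x hx, mul_one]
    have b2 : |∫ y, microHamiltonian a b c p₀ x₀ y * (θ x y - θ x₀ y) ∂cellMeasure N|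
        ≤ B * (ε / (2 * (B + 1))) := by
      have e3 : Continuous fun y => |θ x y - θ x₀ y| := by fun_prop
      have e4 : ∫ y, |θ x y - θ x₀ y| ∂cellMeasure N ≤ ε / (2 * (B + 1)) := by
        refine le_of_sq_le_sq ((sq_integral_le (e3.memLp_cell 2)).trans ?_) hδ.le
        simpa only [sq_abs] using h1
      rw [← Real.norm_eq_abs]
      refine (norm_integral_le_of_norm_le (g := fun y => B * |θ x y - θ x₀ y|)
        (e3.integrable_cell.const_mul _) (Eventually.of_forall fun y => ?_)).trans ?_
      · rw [norm_mul]
        exact mul_le_mul_of_nonneg_right (hB y) (abs_nonneg _)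
      · rw [integral_const_mul]
        exact mul_le_mul_of_nonneg_left e4 hB0
    have b3 : B * (ε / (2 * (B + 1))) ≤ ε / 2 := by
      rw [← mul_div_assoc, div_le_div_iff₀ (by positivity) (by positivity)]
      nlinarith
    rw [hsplit]
    refine (abs_add_le _ _).trans_lt ?_
    linarith
  · intro x hx
    refine ⟨convex_univ, fun p _ q _ s t hs ht hst => ?_⟩
    simp only [hHθ x hx, smul_eq_mul]
    rw [← integral_const_mul, ← integral_const_mul, ← integral_add
      ((hint x hx p x hx).const_mul s) ((hint x hx q x hx).const_mul t)]
    refine integral_mono (hint x hx _ x hx)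
      (((hint x hx p x hx).const_mul s).add ((hint x hx q x hx).const_mul t)) fun y => ?_
    have h1 := (h.convex_micro hx y).2 (mem_univ p) (mem_univ q) hs ht hst
    have h2 := mul_le_mul_of_nonneg_right h1 (hθpos x hx y).le
    simp only [smul_eq_mul] at h2
    simp only
    linarith
  · intro x hx p B hB
    rw [hHθ x hx, ← mul_one B, ← hmass x hx, ← integral_const_mul]
    exact integral_mono ((hθc x hx).integrable_cell.const_mul B) (hint x hx p x hx) fun y =>
      mul_le_mul_of_nonneg_right (hB y) (hθpos x hx y).le

end InvariantDensity

theorem propositionA1 {N : ℕ} (hN : 0 < N) (Ω : Set (Space N))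
    (a : Space N → Space N → Matrix (Fin N) (Fin N) ℝ)
    (b : Space N → Space N → Space N) (c : Space N → Space N → ℝ)
    (hstd : StandingAssumptions Ω a b c) (α : ℝ) (hα : 0 < α)
    (H : Space N → Space N → ℝ) (hH : IsEffectiveHamiltonian Ω α a b c H)
    (lam : ℝ) (hlam : lam = additiveEigenvalue Ω H) :
    (∃ W : Space N → ℝ, IsErgodicSolution Ω H lam W) ∧
    ((∀ W₁ W₂ : Space N → ℝ, IsErgodicSolution Ω H lam W₁ → IsErgodicSolution Ω H lam W₂ →
        ∃ k : ℝ, ∀ x ∈ closure Ω, W₂ x = W₁ x + k) ↔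
      ∀ x ∈ aubrySet Ω H lam, ∀ y ∈ aubrySet Ω H lam, symmDist Ω H lam x y = 0) := by
  have hconv : IsConvexCoercive Ω H := by
    rcases lt_trichotomy α 1 with h | h | h
    · exact hstd.isConvexCoercive_of_ergodicConstant fun x hx => (hH x hx).2.2 h
    · exact hstd.isConvexCoercive_of_firstEigenvalue fun x hx => (hH x hx).2.1 h
    · exact hstd.isConvexCoercive_of_invariantDensity fun x hx => (hH x hx).1 h
  exact ergodic_of_isConvexCoercive hstd.isOpen hstd.isBounded hstd.isConnected
    (hstd.boundary.hasInteriorCone hstd.isOpen) hconv hlam
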